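/- Let $\Bbbk$ be a field. For $a\in\mathbb N_0$ let $\mathbb I_{[a,\infty)}$ be the free $\mathbb N_0$-graded $\Bbbk[t]$-module on one generator of degree $a$, and for $a\le b<\infty$ let $\mathbb I_{[a,b)}=\mathbb I_{[a,\infty)}/t^{b-a}\mathbb I_{[a,\infty)}$ (so $\mathbb I_{[a,a)}=0$). The barcode of a finitely generated graded $\Bbbk[t]$-module $H$ is the finite multiset of intervals $[a_i,b_i)$, $a_i<b_i\le\infty$, with $H\cong\bigoplus_i\mathbb I_{[a_i,b_i)}$ as graded modules. A homogeneous morphism of finitely generated free graded modules with chosen homogeneous bases is represented by a matrix over $\Bbbk$ whose rows and columns are labelled by the degrees of the generators; the entry $A_{ij}$, which must vanish unless $\deg(\text{row }i)\le\deg(\text{column }j)$, stands for $A_{ij}\,t^{\deg(\text{column }j)-\deg(\text{row }i)}$. Let $L\xrightarrow{\phi}M\xrightarrow{\psi}N$ be homogeneous morphisms of graded $\Bbbk[t]$-modules with $\psi\phi=0$, and let $$\begin{array}{ccccccccc}0&\leftarrow&L&\xleftarrow{\lambda}&P_0&\xleftarrow{p}&P_1&\leftarrow&0\\&&{\scriptstyle\phi}\downarrow&&{\scriptstyle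 f_0}\downarrow&&{\scriptstyle f_1}\downarrow&&\\0&\leftarrow&M&\xleftarrow{\mu}&Q_0&\xleftarrow{q}&Q_1&\leftarrow&0\\&&{\scriptstyle\psi}\downarrow&&{\scriptstyle g_0}\downarrow&&{\scriptstyle g_1}\downarrow&&\\0&\leftarrow&N&\xleftarrow{\nu}&R_0&\xleftarrow{r}&R_1&\leftarrow&0\end{array}$$ be a commutative diagram of graded modules and homogeneous maps with exact rows, where $P_0,P_1,Q_0,Q_1,R_0,R_1$ are free and finitely generated, such that $g_0f_0=0$ and $g_1f_1=0$. Let $p,q,r,f_0,f_1,g_0,g_1$ be given by labelled matrices over $\Bbbk$. The algorithm PresHom is the following. *Step 1.* Build $G=\begin{pmatrix}g_0&-r\end{pmatrix}$ and $F=\begin{pmatrix}f_0&-q\\0&-g_1\end{pmatrix}$, and order the columns of each by increasing degree (ties in the given order); the rows of $F$ correspond to the columns of $G$ (both to the generators of $Q_0\oplus R_1$) and are kept in the same order as these. *Step 2.* Column reduce $G$ from left to right. *Step 3.* Delete from $F$ the rows that correspond to nonzero columns of the reduced $G$. *Step 4.* Column reduce the resulting matrix $K$ from left to right. *Output.* For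 every row $\rho$ of $K$: if $\rho$ is the pivot row of a column $\gamma$ of the reduced $K$, output the bar $[\deg\rho,\deg\gamma)$; otherwise output $[\deg\rho,\infty)$. Here the pivot of a nonzero column is its lowest nonzero entry, and column reduction treats the columns from left to right: as long as the lowest nonzero entry of the current column lies in the pivot row of an earlier column, the multiple of that earlier column that cancels it is subtracted. **Theorem.** 1. The algorithm computes the barcode of $\ker\psi/\operatorname{im}\phi$: every bar $[a,b)$ that it outputs has $a\le b$, and the multiset of output bars with $a<b$ (that is, after discarding the empty bars $[a,a)$, which stand for the zero module) is the barcode of $\ker\psi/\operatorname{im}\phi$. 2. The algorithm takes $O(n^3)$ time if the matrices $p,q,r,f_0,f_1,g_0,g_1$ are of size $O(n)\times O(n)$: for every $c\in\mathbb N_0$ there is a constant $C$, depending only on $c$, such that for every field and every input whose matrices have at most $cn$ rows and at most $cn$ columns, $n\ge1$, the algorithm makes at most $Cn^3$ steps. Steps are counted in the unit-cost model: each arithmetic operation or comparison in $\Bbbk$ or in $\mathbb N_0$, each memory access, assignment, branching and loop iteration costs one step. -/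

import Mathlib

open Polynomial

namespace GradedPres

/-! ## Graded modules over `k[t]`

The variable `t` of `k[t]` is `X : k[X]`. A graded module is a `k[X]`-module with a family
`deg : ℕ → Submodule k M` of homogeneous components. -/

section Graded

variable {k : Type*} [Field k]

/-- `M` is the direct sum of the `k`-subspaces `deg i`, and `t ^ i` maps degree `j` into
degree `i + j`. -/
structure IsGrading {M : Type*} [AddCommGroup M] [Module k M] [Module k[X] M]
    (deg : ℕ → Submodule k M) : Prop where
  isInternal : DirectSum.IsInternal deg
  pow_smul_mem : ∀ (i j : ℕ) (m : M), m ∈ deg j → (X : k[X]) ^ i • m ∈ deg (i + j)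

/-- A `k[X]`-linear map that maps degree `i` into degree `i` for every `i`. -/
def IsHomogeneousMap {M N : Type*} [AddCommGroup M] [Module k M] [Module k[X] M]
    [AddCommGroup N] [Module k N] [Module k[X] N]
    (degM : ℕ → Submodule k M) (degN : ℕ → Submodule k N) (φ : M →ₗ[k[X]] N) : Prop :=
  ∀ (i : ℕ) (m : M), m ∈ degM i → φ m ∈ degN i

/-- Degree-`i` part of the free graded module `I_[a,∞)` of rank one with its generator in
degree `a`: the line spanned by `t ^ (i - a)` if `a ≤ i`, and zero otherwise. -/
noncomputable def lineDeg (k : Type*) [Field k] (a i : ℕ) : Submodule k k[X] :=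
  Submodule.span k {f | ∃ e : ℕ, a + e = i ∧ f = X ^ e}

/-- Degree-`i` part of the free graded module `⨁ j, I_[d j,∞)`, with underlying module
`Fin n → k[X]`. -/
noncomputable def freeDeg (k : Type*) [Field k] {n : ℕ} (d : Fin n → ℕ) (i : ℕ) :
    Submodule k (Fin n → k[X]) :=
  Submodule.pi Set.univ (fun j => lineDeg k (d j) i)

/-- A matrix over `k` with degree labels on rows and columns is compatible with the labels: an
entry can be nonzero only if the degree of its row is at most the degree of its column. -/
def Compatible {m n : ℕ} (dr : Fin m → ℕ) (dc : Fin n → ℕ) (A : Matrix (Fin m) (Fin n) k) :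
    Prop :=
  ∀ i j, A i j ≠ 0 → dr i ≤ dc j

/-- The morphism `⨁ j, I_[dc j,∞) → ⨁ i, I_[dr i,∞)` of free graded modules represented by a
labelled matrix over `k`: the entry `A i j` stands for `A i j * t ^ (dc j - dr i)`. -/
noncomputable def freeMap {m n : ℕ} (dr : Fin m → ℕ) (dc : Fin n → ℕ)
    (A : Matrix (Fin m) (Fin n) k) : (Fin n → k[X]) →ₗ[k[X]] (Fin m → k[X]) :=
  Matrix.mulVecLin (Matrix.of fun i j => C (A i j) * X ^ (dc j - dr i))

/-- A bar `[a,b)` with `a : ℕ` and `b : ℕ ∪ {∞}`. -/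
abbrev Bar := ℕ × ℕ∞

/-- The submodule of `I_[a,∞)` that is the image of `I_[b,∞)`: it is generated by
`t ^ (b - a)` if `b` is finite, and it is zero if `b = ∞`. -/
noncomputable def barIdeal (k : Type*) [Field k] (b : Bar) : Ideal k[X] :=
  Ideal.span {f | ∃ e : ℕ, b.2 = (e : ℕ∞) ∧ f = X ^ (e - b.1)}

/-- The `k[X]`-module underlying the interval module `I_[a,b) = I_[a,∞) / I_[b,∞)`. -/
abbrev Interval (k : Type*) [Field k] (b : Bar) : Type _ := k[X] ⧸ barIdeal k b

/-- Degree-`i` part of the interval module. -/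
noncomputable def intervalDeg (k : Type*) [Field k] (b : Bar) (i : ℕ) :
    Submodule k (Interval k b) :=
  (lineDeg k b.1 i).map ((barIdeal k b).mkQ.restrictScalars k)

/-- The multiset `B` is the barcode of the graded module `M` with homogeneous components `deg`:
it consists of nonempty bars, and `M` is isomorphic, as a graded module, to the direct sum of
the interval modules of the bars of `B`, counted with multiplicity. -/
def IsBarcode {M : Type*} [AddCommGroup M] [Module k M] [Module k[X] M]
    (deg : ℕ → Submodule k M) (B : Multiset Bar) : Prop :=
  (∀ b ∈ B, (b.1 : ℕ∞) < b.2) ∧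
  ∃ (d : ℕ) (bar : Fin d → Bar), Finset.univ.val.map bar = B ∧
    ∃ e : M ≃ₗ[k[X]] ((j : Fin d) → Interval k (bar j)),
      ∀ (i : ℕ) (m : M),
        m ∈ deg i ↔ e m ∈ Submodule.pi Set.univ (fun j => intervalDeg k (bar j) i)

section Homology

variable {L M N : Type*} [AddCommGroup L] [Module k[X] L]
  [AddCommGroup M] [Module k M] [Module k[X] M] [IsScalarTower k k[X] M]
  [AddCommGroup N] [Module k[X] N]

/-- The `k[X]`-module `ker ψ / im φ`. -/
abbrev Homology (φ : L →ₗ[k[X]] M) (ψ : M →ₗ[k[X]] N) : Type _ :=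
  LinearMap.ker ψ ⧸ (LinearMap.range φ).submoduleOf (LinearMap.ker ψ)

/-- Degree-`i` part of `ker ψ / im φ`: the classes of the elements of `ker ψ` of degree `i`. -/
noncomputable def homologyDeg (degM : ℕ → Submodule k M) (φ : L →ₗ[k[X]] M) (ψ : M →ₗ[k[X]] N) (i : ℕ) :
    Submodule k (Homology φ ψ) :=
  ((degM i).comap ((LinearMap.ker ψ).subtype.restrictScalars k)).map
    (((LinearMap.range φ).submoduleOf (LinearMap.ker ψ)).mkQ.restrictScalars k)

end Homology

end Graded

/-! ## Complexes of reduced presentations, given by labelled matrices -/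

/-- Input data: the degrees of the generators of six free graded modules
`P₀, P₁, Q₀, Q₁, R₀, R₁` and seven matrices over `k`. -/
structure Input (k : Type*) where
  (nP0 nP1 nQ0 nQ1 nR0 nR1 : ℕ)
  degP0 : Fin nP0 → ℕ
  degP1 : Fin nP1 → ℕ
  degQ0 : Fin nQ0 → ℕ
  degQ1 : Fin nQ1 → ℕ
  degR0 : Fin nR0 → ℕ
  degR1 : Fin nR1 → ℕ
  p : Matrix (Fin nP0) (Fin nP1) k
  q : Matrix (Fin nQ0) (Fin nQ1) k
  r : Matrix (Fin nR0) (Fin nR1) k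
  f0 : Matrix (Fin nQ0) (Fin nP0) k
  f1 : Matrix (Fin nQ1) (Fin nP1) k
  g0 : Matrix (Fin nR0) (Fin nQ0) k
  g1 : Matrix (Fin nR1) (Fin nQ1) k

/-- All seven matrices have at most `n` rows and at most `n` columns. -/
def Input.SizeLE {k : Type*} (D : Input k) (n : ℕ) : Prop :=
  D.nP0 ≤ n ∧ D.nP1 ≤ n ∧ D.nQ0 ≤ n ∧ D.nQ1 ≤ n ∧ D.nR0 ≤ n ∧ D.nR1 ≤ n

section Presents

variable {k : Type*} [Field k]

/-- `0 ← M ← P₀ ← P₁ ← 0` is a reduced presentation of the graded module `M`: the augmentation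
`μ` is homogeneous and surjective, the matrix `A` of `P₁ → P₀` is compatible with the degrees,
its image is the kernel of `μ`, and it is injective. -/
structure IsReducedPresentation {M : Type*} [AddCommGroup M] [Module k M] [Module k[X] M]
    (degM : ℕ → Submodule k M) {n0 n1 : ℕ} (d0 : Fin n0 → ℕ) (d1 : Fin n1 → ℕ)
    (A : Matrix (Fin n0) (Fin n1) k) (μ : (Fin n0 → k[X]) →ₗ[k[X]] M) : Prop where
  homogeneous : IsHomogeneousMap (freeDeg k d0) degM μ
  surjective : Function.Surjective μ
  compatible : Compatible d0 d1 A
  exact : LinearMap.range (freeMap d0 d1 A) = LinearMap.ker μ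
  injective : Function.Injective (freeMap d0 d1 A)

variable {L M N : Type*}
  [AddCommGroup L] [Module k L] [Module k[X] L]
  [AddCommGroup M] [Module k M] [Module k[X] M]
  [AddCommGroup N] [Module k N] [Module k[X] N]

/-- The matrices of `D` form a complex of reduced presentations of `L → M → N` (maps `φ`, `ψ`),
with augmentations `lam : P₀ → L`, `mu : Q₀ → M`, `nu : R₀ → N`: rows are reduced presentations,
all squares commute, `g₀ ∘ f₀ = 0` and `g₁ ∘ f₁ = 0`. -/
structure Input.Presents (D : Input k)
    (degL : ℕ → Submodule k L) (degM : ℕ → Submodule k M) (degN : ℕ → Submodule k N)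
    (φ : L →ₗ[k[X]] M) (ψ : M →ₗ[k[X]] N)
    (lam : (Fin D.nP0 → k[X]) →ₗ[k[X]] L) (mu : (Fin D.nQ0 → k[X]) →ₗ[k[X]] M)
    (nu : (Fin D.nR0 → k[X]) →ₗ[k[X]] N) : Prop where
  presL : IsReducedPresentation degL D.degP0 D.degP1 D.p lam
  presM : IsReducedPresentation degM D.degQ0 D.degQ1 D.q mu
  presN : IsReducedPresentation degN D.degR0 D.degR1 D.r nu
  compatible_f0 : Compatible D.degQ0 D.degP0 D.f0
  compatible_f1 : Compatible D.degQ1 D.degP1 D.f1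
  compatible_g0 : Compatible D.degR0 D.degQ0 D.g0
  compatible_g1 : Compatible D.degR1 D.degQ1 D.g1
  comm_φ : φ ∘ₗ lam = mu ∘ₗ freeMap D.degQ0 D.degP0 D.f0
  comm_ψ : ψ ∘ₗ mu = nu ∘ₗ freeMap D.degR0 D.degQ0 D.g0
  comm_f : freeMap D.degQ0 D.degP0 D.f0 ∘ₗ freeMap D.degP0 D.degP1 D.p =
    freeMap D.degQ0 D.degQ1 D.q ∘ₗ freeMap D.degQ1 D.degP1 D.f1
  comm_g : freeMap D.degR0 D.degQ0 D.g0 ∘ₗ freeMap D.degQ0 D.degQ1 D.q =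
    freeMap D.degR0 D.degR1 D.r ∘ₗ freeMap D.degR1 D.degQ1 D.g1
  comp_zero : freeMap D.degR0 D.degQ0 D.g0 ∘ₗ freeMap D.degQ0 D.degP0 D.f0 = 0
  comp_one : freeMap D.degR1 D.degQ1 D.g1 ∘ₗ freeMap D.degQ1 D.degP1 D.f1 = 0

end Presents

/-! ## A machine with a step count

Programs are finite pieces of code over a memory with named natural-number registers, one scalar
register, named arrays of natural numbers and named two-dimensional arrays of scalars. Every
evaluation of a constant, a register, an array entry, an arithmetic operation (in `ℕ` or in the
field), a comparison or a Boolean connective costs one step; so does every assignment, every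
branching, every loop entry and every loop iteration. -/

/-- Natural-number registers. The first six hold the ranks of the free modules of the input. -/
inductive NReg
  | nP0 | nP1 | nQ0 | nQ1 | nR0 | nR1
  | m | c | h | i | j | l | s | t
  deriving DecidableEq

/-- Arrays of natural numbers. The first six hold the degrees of the input. -/
inductive NArr
  | degP0 | degP1 | degQ0 | degQ1 | degR0 | degR1
  | degG | degF | ordG | ordF | sdegG | sdegF
  | pivG | nzG | pivK | nzK | birth | death | finite
  deriving DecidableEq

/-- Two-dimensional arrays of scalars. The first seven hold the matrices of the input. -/
inductive SArr
  | p | q | r | f0 | f1 | g0 | g1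
  | G | F | sG | sF | K
  deriving DecidableEq

/-- Expressions with values in `ℕ`. -/
inductive NExp
  | lit (n : ℕ)
  | reg (x : NReg)
  | get (a : NArr) (e : NExp)
  | add (e₁ e₂ : NExp)
  | sub (e₁ e₂ : NExp)

/-- Expressions with values in the field; `acc` is the scalar register. -/
inductive SExp
  | zero
  | acc
  | get (A : SArr) (e₁ e₂ : NExp)
  | neg (u : SExp)
  | sub (u v : SExp)
  | mul (u v : SExp)
  | div (u v : SExp)

/-- Tests. -/
inductive Test
  | lt (e₁ e₂ : NExp)
  | eq (e₁ e₂ : NExp)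
  | isZero (u : SExp)
  | not (b : Test)
  | and (b₁ b₂ : Test)
  | or (b₁ b₂ : Test)

/-- Programs. `loop x e s` evaluates `e` once and then runs `s` that many times, with the
register `x` set to `0, 1, 2, …` in turn. -/
inductive Code
  | setReg (x : NReg) (e : NExp)
  | setArr (a : NArr) (e₁ e₂ : NExp)
  | setAcc (u : SExp)
  | setMat (A : SArr) (e₁ e₂ : NExp) (u : SExp)
  | seq (s₁ s₂ : Code)
  | ifThen (b : Test) (s : Code)
  | ifElse (b : Test) (s₁ s₂ : Code)
  | loop (x : NReg) (e : NExp) (s : Code)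

/-- The contents of the memory. -/
structure Memory (k : Type*) where
  reg : NReg → ℕ
  arr : NArr → ℕ → ℕ
  acc : k
  mat : SArr → ℕ → ℕ → k

section Semantics

variable {k : Type*}

/-- Memory after writing `n` into the register `x`. -/
def Memory.setReg (σ : Memory k) (x : NReg) (n : ℕ) : Memory k :=
  { σ with reg := Function.update σ.reg x n }

/-- Memory after writing `n` into entry `i` of the array `a`. -/
def Memory.setArr (σ : Memory k) (a : NArr) (i n : ℕ) : Memory k :=
  { σ with arr := Function.update σ.arr a (Function.update (σ.arr a) i n) }

/-- Memory after writing `u` into entry `(i, j)` of the array `A`. -/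
def Memory.setMat (σ : Memory k) (A : SArr) (i j : ℕ) (u : k) : Memory k :=
  { σ with
    mat := Function.update σ.mat A
      (Function.update (σ.mat A) i (Function.update (σ.mat A i) j u)) }

/-- Value of a natural-number expression. -/
def NExp.eval (σ : Memory k) : NExp → ℕ
  | lit n => n
  | reg x => σ.reg x
  | get a e => σ.arr a (e.eval σ)
  | add e₁ e₂ => e₁.eval σ + e₂.eval σ
  | sub e₁ e₂ => e₁.eval σ - e₂.eval σ

/-- Number of steps for evaluating a natural-number expression. -/
def NExp.cost : NExp → ℕ
  | lit _ => 1
  | reg _ => 1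
  | get _ e => e.cost + 1
  | add e₁ e₂ => e₁.cost + e₂.cost + 1
  | sub e₁ e₂ => e₁.cost + e₂.cost + 1

/-- Number of steps for evaluating a scalar expression. -/
def SExp.cost : SExp → ℕ
  | zero => 1
  | acc => 1
  | get _ e₁ e₂ => e₁.cost + e₂.cost + 1
  | neg u => u.cost + 1
  | sub u v => u.cost + v.cost + 1
  | mul u v => u.cost + v.cost + 1
  | div u v => u.cost + v.cost + 1

/-- Number of steps for evaluating a test. -/
def Test.cost : Test → ℕ
  | lt e₁ e₂ => e₁.cost + e₂.cost + 1
  | eq e₁ e₂ => e₁.cost + e₂.cost + 1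
  | isZero u => u.cost + 1
  | not b => b.cost + 1
  | and b₁ b₂ => b₁.cost + b₂.cost + 1
  | or b₁ b₂ => b₁.cost + b₂.cost + 1

variable [Field k]

/-- Value of a scalar expression. -/
def SExp.eval (σ : Memory k) : SExp → k
  | zero => 0
  | acc => σ.acc
  | get A e₁ e₂ => σ.mat A (e₁.eval σ) (e₂.eval σ)
  | neg u => - u.eval σ
  | sub u v => u.eval σ - v.eval σ
  | mul u v => u.eval σ * v.eval σ
  | div u v => u.eval σ / v.eval σ

variable [DecidableEq k]

/-- Value of a test. -/
def Test.eval (σ : Memory k) : Test → Bool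
  | lt e₁ e₂ => decide (e₁.eval σ < e₂.eval σ)
  | eq e₁ e₂ => decide (e₁.eval σ = e₂.eval σ)
  | isZero u => decide (u.eval σ = 0)
  | not b => !(b.eval σ)
  | and b₁ b₂ => b₁.eval σ && b₂.eval σ
  | or b₁ b₂ => b₁.eval σ || b₂.eval σ

/-- `iter f n a` applies `f 0`, `f 1`, …, `f (n - 1)` in this order, starting from `a`. -/
def iter {α : Type*} (f : ℕ → α → α) : ℕ → α → α
  | 0, a => a
  | n + 1, a => f n (iter f n a)

/-- Memory after running a program. -/
def Code.exec : Code → Memory k → Memory k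
  | setReg x e, σ => σ.setReg x (e.eval σ)
  | setArr a e₁ e₂, σ => σ.setArr a (e₁.eval σ) (e₂.eval σ)
  | setAcc u, σ => { σ with acc := u.eval σ }
  | setMat A e₁ e₂ u, σ => σ.setMat A (e₁.eval σ) (e₂.eval σ) (u.eval σ)
  | seq s₁ s₂, σ => s₂.exec (s₁.exec σ)
  | ifThen b s, σ => if b.eval σ then s.exec σ else σ
  | ifElse b s₁ s₂, σ => if b.eval σ then s₁.exec σ else s₂.exec σ
  | loop x e s, σ => iter (fun i τ => s.exec (τ.setReg x i)) (e.eval σ) σ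

/-- Number of steps that a program takes. -/
def Code.steps : Code → Memory k → ℕ
  | setReg _ e, _ => e.cost + 1
  | setArr _ e₁ e₂, _ => e₁.cost + e₂.cost + 1
  | setAcc u, _ => u.cost + 1
  | setMat _ e₁ e₂ u, _ => e₁.cost + e₂.cost + u.cost + 1
  | seq s₁ s₂, σ => s₁.steps σ + s₂.steps (s₁.exec σ)
  | ifThen b s, σ => b.cost + 1 + if b.eval σ then s.steps σ else 0
  | ifElse b s₁ s₂, σ => b.cost + 1 + if b.eval σ then s₁.steps σ else s₂.steps σ
  | loop x e s, σ => e.cost + 1 + ∑ n ∈ Finset.range (e.eval σ),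
      (s.steps ((iter (fun i τ => s.exec (τ.setReg x i)) n σ).setReg x n) + 1)

end Semantics

/-! ## The algorithm PresHom -/

section Algorithm

open NExp SExp Test Code

/-- Sequential composition. -/
local infixr:50 " ;; " => Code.seq

/-- Step 1, first half: build `G = (g₀  -r)` and `F = (f₀ -q ; 0 -g₁)`, with the degrees of
their columns in `degG` and `degF`. The rows of `F` correspond to the columns of `G`;
`m` is the number of columns of `G`, and `c` is the number of columns of `F`. -/
def build : Code :=
  setReg .m (add (reg .nQ0) (reg .nR1)) ;;
  setReg .c (add (reg .nP0) (reg .nQ1)) ;;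
  loop .j (reg .nQ0)
    (setArr .degG (reg .j) (get .degQ0 (reg .j)) ;;
     loop .i (reg .nR0) (setMat .G (reg .i) (reg .j) (.get .g0 (reg .i) (reg .j)))) ;;
  loop .j (reg .nR1)
    (setArr .degG (add (reg .nQ0) (reg .j)) (get .degR1 (reg .j)) ;;
     loop .i (reg .nR0)
       (setMat .G (reg .i) (add (reg .nQ0) (reg .j)) (neg (.get .r (reg .i) (reg .j))))) ;;
  loop .j (reg .nP0)
    (setArr .degF (reg .j) (get .degP0 (reg .j)) ;;
     loop .i (reg .nQ0) (setMat .F (reg .i) (reg .j) (.get .f0 (reg .i) (reg .j))) ;;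
     loop .i (reg .nR1) (setMat .F (add (reg .nQ0) (reg .i)) (reg .j) zero)) ;;
  loop .j (reg .nQ1)
    (setArr .degF (add (reg .nP0) (reg .j)) (get .degQ1 (reg .j)) ;;
     loop .i (reg .nQ0)
       (setMat .F (reg .i) (add (reg .nP0) (reg .j)) (neg (.get .q (reg .i) (reg .j)))) ;;
     loop .i (reg .nR1)
       (setMat .F (add (reg .nQ0) (reg .i)) (add (reg .nP0) (reg .j))
         (neg (.get .g1 (reg .i) (reg .j)))))

/-- Write into `ord` the indices `0, …, n - 1` in the order of increasing degree `deg` (ties in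
the order of the indices): index `j` goes to the position that is the number of indices before
it. -/
def sortBy (n : NReg) (deg ord : NArr) : Code :=
  loop .j (reg n)
    (setReg .s (lit 0) ;;
     loop .i (reg n)
       (ifThen
         (or (lt (get deg (reg .i)) (get deg (reg .j)))
           (and (eq (get deg (reg .i)) (get deg (reg .j))) (lt (reg .i) (reg .j))))
         (setReg .s (add (reg .s) (lit 1)))) ;;
     setArr ord (reg .s) (reg .j))

/-- Step 1, second half: order the columns of `G` and of `F` by degree, giving `sG` and `sF`.
The rows of `sF` stay in correspondence with the columns of `sG`. -/
def order : Code :=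
  sortBy .m .degG .ordG ;;
  sortBy .c .degF .ordF ;;
  loop .j (reg .m)
    (setArr .sdegG (reg .j) (get .degG (get .ordG (reg .j))) ;;
     loop .i (reg .nR0)
       (setMat .sG (reg .i) (reg .j) (.get .G (reg .i) (get .ordG (reg .j))))) ;;
  loop .j (reg .c)
    (setArr .sdegF (reg .j) (get .degF (get .ordF (reg .j))) ;;
     loop .i (reg .m)
       (setMat .sF (reg .i) (reg .j)
         (.get .F (get .ordG (reg .i)) (get .ordF (reg .j)))))

/-- Column reduction, from left to right, of the first `rows` rows and `cols` columns of `A`. The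
pivot of a column is its lowest nonzero entry. Column `j` is processed from bottom to top: at a
nonzero entry in row `i`, if an earlier column `l` has its pivot in row `i`, then the multiple of
column `l` that cancels this entry is subtracted from column `j`; otherwise the entry is the pivot
of column `j` and column `j` is finished. Afterwards `piv i` is `l + 1` if row `i` is the pivot row
of column `l`, and `0` if it is not a pivot row; `nz j` is `1` if column `j` of the reduced matrix
is nonzero, and `0` otherwise. -/
def reduce (A : SArr) (rows cols : NReg) (piv nz : NArr) : Code :=
  loop .i (reg rows) (setArr piv (reg .i) (lit 0)) ;;
  loop .j (reg cols)
    (setArr nz (reg .j) (lit 0) ;;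
     loop .t (reg rows)
       (setReg .i (sub (sub (reg rows) (lit 1)) (reg .t)) ;;
        ifThen
          (and (eq (get nz (reg .j)) (lit 0)) (not (isZero (.get A (reg .i) (reg .j)))))
          (ifElse (eq (get piv (reg .i)) (lit 0))
            (setArr piv (reg .i) (add (reg .j) (lit 1)) ;;
             setArr nz (reg .j) (lit 1))
            (setReg .l (sub (get piv (reg .i)) (lit 1)) ;;
             setAcc (div (.get A (reg .i) (reg .j)) (.get A (reg .i) (reg .l))) ;;
             loop .s (reg rows)
               (setMat A (reg .s) (reg .j)
                 (.sub (.get A (reg .s) (reg .j))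
                   (mul acc (.get A (reg .s) (reg .l)))))))))

/-- Step 3: remove from `sF` the rows corresponding to nonzero columns of the reduced matrix `sG`.
The result `K` has `h` rows, whose degrees are in `birth`. -/
def removeRows : Code :=
  setReg .h (lit 0) ;;
  loop .i (reg .m)
    (ifThen (eq (get .nzG (reg .i)) (lit 0))
      (setArr .birth (reg .h) (get .sdegG (reg .i)) ;;
       loop .j (reg .c) (setMat .K (reg .h) (reg .j) (.get .sF (reg .i) (reg .j))) ;;
       setReg .h (add (reg .h) (lit 1))))

/-- Output: a row of `K` with its pivot in some column dies at the degree of this column; a row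
that is not a pivot row lives forever. -/
def readBars : Code :=
  loop .i (reg .h)
    (ifElse (eq (get .pivK (reg .i)) (lit 0))
      (setArr .finite (reg .i) (lit 0))
      (setArr .finite (reg .i) (lit 1) ;;
       setArr .death (reg .i) (get .sdegF (sub (get .pivK (reg .i)) (lit 1)))))

/-- The algorithm: Step 1 (build and order the matrices), Step 2 (reduce `sG`), Step 3 (remove
rows), Step 4 (reduce `K`), output. -/
def presHom : Code :=
  build ;;
  order ;;
  reduce .sG .nR0 .m .pivG .nzG ;;
  removeRows ;;
  reduce .K .h .c .pivK .nzK ;;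
  readBars

end Algorithm

/-! ## Loading the input and reading the output -/

/-- Array contents given by a finite vector, with zeros behind it. -/
def padVec {n : ℕ} (v : Fin n → ℕ) (i : ℕ) : ℕ :=
  if h : i < n then v ⟨i, h⟩ else 0

/-- Contents of a two-dimensional array given by a matrix, with zeros around it. -/
def padMat {k : Type*} [Zero k] {m n : ℕ} (A : Matrix (Fin m) (Fin n) k) (i j : ℕ) : k :=
  if h : i < m ∧ j < n then A ⟨i, h.1⟩ ⟨j, h.2⟩ else 0

/-- The initial memory: the input data; everything else is zero. -/
def Input.load {k : Type*} [Field k] (D : Input k) : Memory k where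
  reg
    | .nP0 => D.nP0
    | .nP1 => D.nP1
    | .nQ0 => D.nQ0
    | .nQ1 => D.nQ1
    | .nR0 => D.nR0
    | .nR1 => D.nR1
    | _ => 0
  arr
    | .degP0 => padVec D.degP0
    | .degP1 => padVec D.degP1
    | .degQ0 => padVec D.degQ0
    | .degQ1 => padVec D.degQ1
    | .degR0 => padVec D.degR0
    | .degR1 => padVec D.degR1
    | _ => fun _ => 0
  acc := 0
  mat
    | .p => padMat D.p
    | .q => padMat D.q
    | .r => padMat D.r
    | .f0 => padMat D.f0
    | .f1 => padMat D.f1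
    | .g0 => padMat D.g0
    | .g1 => padMat D.g1
    | _ => fun _ _ => 0

/-- The multiset of bars found in the final memory, one for each row of `K`. -/
def Memory.bars {k : Type*} (σ : Memory k) : Multiset Bar :=
  (Multiset.range (σ.reg .h)).map fun i =>
    (σ.arr .birth i, if σ.arr .finite i = 0 then (⊤ : ℕ∞) else (σ.arr .death i : ℕ∞))

/-- The bars that the algorithm outputs on the input `D`. -/
def Input.output {k : Type*} [Field k] [DecidableEq k] (D : Input k) : Multiset Bar :=
  (presHom.exec D.load).bars

/-- The number of steps that the algorithm takes on the input `D`. -/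
def Input.time {k : Type*} [Field k] [DecidableEq k] (D : Input k) : ℕ :=
  presHom.steps D.load

end GradedPres

/-! The matrices `F` and `G` form a complex `P₀ ⊕ Q₁ → Q₀ ⊕ R₁ → R₀` whose middle homology is `ker ψ
/ im φ`. A pair `(u, t)` lies in `ker G` exactly when `g₀ u = r t`, and `(u, t) ↦ μ u` maps `ker G`
onto `ker ψ`, because `μ` is surjective and the bottom row is exact at `R₀`. The preimage of `im φ`
is `im F`: if `μ u = φ (λ a)`, exactness at `Q₀` gives `u = f₀ a + q b`, hence `r t = g₀ u = r (g₁
b)`, and injectivity of `r` forces `t = g₁ b` (`Input.Presents.mem_range_iff`). Homogeneous elements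
have homogeneous lifts (`Input.Presents.exists_homogeneous_lift`).

It remains to compute `ker G / im F`. Reduction from left to right replaces `G` by `G U` with `U`
upper unitriangular; as the columns are sorted by degree, `U` is automatically a homogeneous change
of basis. The nonzero columns of `G U` have distinct pivots, so they are independent and `ker (G U)`
is free on the zero columns. Since `U` restricted to the indices of the zero columns is again
unitriangular, projecting `ker G` to these coordinates is an isomorphism onto a free graded module
(`exists_kernel_matrix`). Under this isomorphism `F` becomes the submatrix `K` of the corresponding
rows, which is why Step 3 may simply delete the other rows.

If `K W` is the reduction of `K`, its nonzero columns, placed at their pivot rows and completed by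
unit vectors, form an invertible triangular matrix `T`, homogeneous because the rows are sorted too.
Then `K W = T S`, where `S` has a single `1` for each pivot, and the cokernel splits into interval
modules (`exists_cokernel_matrix`). A pivot is a nonzero entry of a matrix compatible with the
labels, so birth is at most death; the empty bars are zero summands.

The program is linked to these matrices by loop invariants (`ReduceInv`, `exec_reduce`,
`exists_reduction_output`). For the running time, loops are nested at most three deep, and each loop
count is a register that stays constant during its phase and is linear in `n`
(`Code.steps_le_bound`, `time_le_bound`). -/

namespace GradedPres

/-! ### Maps of free graded modules given by labelled matrices -/

section FreeModules

variable {k : Type*} [Field k] {ι κ τ : Type*}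

/-- The morphism of free graded modules represented by a labelled matrix with arbitrary finite
index types. -/
noncomputable def labelMap [Fintype κ] (dr : ι → ℕ) (dc : κ → ℕ) (A : Matrix ι κ k) :
    (κ → k[X]) →ₗ[k[X]] (ι → k[X]) :=
  Matrix.mulVecLin (Matrix.of fun i j => C (A i j) * X ^ (dc j - dr i))

/-- Nonzero entries have row degree at most column degree. -/
def LabelCompatible (dr : ι → ℕ) (dc : κ → ℕ) (A : Matrix ι κ k) : Prop :=
  ∀ i j, A i j ≠ 0 → dr i ≤ dc j

/-- Degree-`i` part of the free graded module with generators in degrees `d`. -/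
noncomputable def homogeneousPart (k : Type*) [Field k] (d : ι → ℕ) (i : ℕ) :
    Submodule k (ι → k[X]) :=
  Submodule.pi Set.univ (fun j => lineDeg k (d j) i)

theorem labelMap_apply [Fintype κ] (dr : ι → ℕ) (dc : κ → ℕ) (A : Matrix ι κ k) (x : κ → k[X])
    (i : ι) : labelMap dr dc A x i = ∑ j, C (A i j) * X ^ (dc j - dr i) * x j := by
  simp [labelMap, Matrix.mulVec, dotProduct]

theorem LabelCompatible.mul [Fintype κ] {dr : ι → ℕ} {dc : κ → ℕ} {de : τ → ℕ}
    {A : Matrix ι κ k} {B : Matrix κ τ k} (hA : LabelCompatible dr dc A)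
    (hB : LabelCompatible dc de B) : LabelCompatible dr de (A * B) := by
  intro i j hij
  rw [Matrix.mul_apply] at hij
  obtain ⟨l, -, hl⟩ := Finset.exists_ne_zero_of_sum_ne_zero hij
  exact (hA i l (left_ne_zero_of_mul hl)).trans (hB l j (right_ne_zero_of_mul hl))

/-- The exponents of `t` add up along `j → l → i`. With truncated subtraction this needs both label
inequalities, and compatibility supplies them wherever both entries are nonzero. -/
theorem labelMap_mul [Fintype κ] [Fintype τ] {dr : ι → ℕ} {dc : κ → ℕ} {de : τ → ℕ}
    {A : Matrix ι κ k} {B : Matrix κ τ k} (hA : LabelCompatible dr dc A)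
    (hB : LabelCompatible dc de B) (x : τ → k[X]) :
    labelMap dr de (A * B) x = labelMap dr dc A (labelMap dc de B x) := by
  funext i
  simp only [labelMap_apply, Finset.mul_sum, Matrix.mul_apply, map_sum, Finset.sum_mul, map_mul]
  rw [Finset.sum_comm]
  refine Finset.sum_congr rfl fun l _ => Finset.sum_congr rfl fun j _ => ?_
  by_cases h1 : A i l = 0
  · simp [h1]
  by_cases h2 : B l j = 0
  · simp [h2]
  have e : de j - dr i = (dc l - dr i) + (de j - dc l) := by
    have := hA i l h1
    have := hB l j h2
    omega
  rw [e, pow_add]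
  ring

theorem labelMap_one [Fintype ι] [DecidableEq ι] (d : ι → ℕ) (x : ι → k[X]) :
    labelMap d d (1 : Matrix ι ι k) x = x := by
  funext i
  rw [labelMap_apply, Finset.sum_eq_single i]
  · simp
  · intro j _ hj
    simp [Matrix.one_apply_ne hj.symm]
  · simp

/-- Turns homogeneity into a condition on coefficients; the form `a + n = i` avoids truncated
subtraction and covers `i < a`. -/
theorem mem_lineDeg {a i : ℕ} {f : k[X]} :
    f ∈ lineDeg k a i ↔ ∀ n, f.coeff n ≠ 0 → a + n = i := by
  constructor
  · intro hf
    induction hf using Submodule.span_induction with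
    | mem f hf =>
      obtain ⟨e, he, rfl⟩ := hf
      intro n hn
      rw [coeff_X_pow] at hn
      split_ifs at hn with h
      · omega
      · exact absurd rfl hn
    | zero => simp
    | add f g _ _ hf hg =>
      intro n hn
      by_cases h : f.coeff n = 0
      · exact hg n (by simpa [h] using hn)
      · exact hf n h
    | smul c f _ hf =>
      intro n hn
      exact hf n (by simp only [coeff_smul, smul_eq_mul] at hn; exact right_ne_zero_of_mul hn)
  · intro h
    rw [f.as_sum_support_C_mul_X_pow]
    refine Submodule.sum_mem _ fun n hn => ?_
    rw [← smul_eq_C_mul]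
    exact Submodule.smul_mem _ _ (Submodule.subset_span ⟨n, h n (mem_support_iff.1 hn), rfl⟩)

theorem mem_homogeneousPart {d : ι → ℕ} {i : ℕ} {x : ι → k[X]} :
    x ∈ homogeneousPart k d i ↔ ∀ j n, (x j).coeff n ≠ 0 → d j + n = i := by
  simp [homogeneousPart, Submodule.mem_pi, mem_lineDeg]

theorem labelMap_mem_homogeneousPart [Fintype κ] {dr : ι → ℕ} {dc : κ → ℕ} {A : Matrix ι κ k}
    (hA : LabelCompatible dr dc A) {i : ℕ} {x : κ → k[X]} (hx : x ∈ homogeneousPart k dc i) :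
    labelMap dr dc A x ∈ homogeneousPart k dr i := by
  rw [mem_homogeneousPart] at hx ⊢
  intro a n hn
  rw [labelMap_apply, finsetSum_coeff] at hn
  obtain ⟨l, -, hl⟩ := Finset.exists_ne_zero_of_sum_ne_zero hn
  rw [mul_assoc, coeff_C_mul, coeff_X_pow_mul'] at hl
  have h1 := hA a l (left_ne_zero_of_mul hl)
  have h2 := right_ne_zero_of_mul hl
  split_ifs at h2 with h3
  · have := hx l _ h2
    omega
  · exact absurd rfl h2

/-- The projection of a free graded module onto its degree-`i` part. -/
noncomputable def homogeneousProj (d : ι → ℕ) (i : ℕ) : (ι → k[X]) →ₗ[k] (ι → k[X]) :=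
  LinearMap.pi fun j =>
    (if d j ≤ i then monomial (i - d j) ∘ₗ lcoeff k (i - d j) else 0) ∘ₗ LinearMap.proj j

theorem homogeneousProj_apply (d : ι → ℕ) (i : ℕ) (x : ι → k[X]) (j : ι) :
    homogeneousProj d i x j =
      if d j ≤ i then monomial (i - d j) ((x j).coeff (i - d j)) else 0 := by
  rw [homogeneousProj, LinearMap.pi_apply]
  split_ifs <;> simp

theorem homogeneousProj_mem (d : ι → ℕ) (i : ℕ) (x : ι → k[X]) :
    homogeneousProj d i x ∈ homogeneousPart k d i := by
  rw [mem_homogeneousPart]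
  intro j n hn
  rw [homogeneousProj_apply] at hn
  split_ifs at hn with h
  · rw [coeff_monomial] at hn
    split_ifs at hn with h'
    · omega
    · exact absurd rfl hn
  · simp at hn

theorem homogeneousProj_of_mem {d : ι → ℕ} {i : ℕ} {x : ι → k[X]}
    (hx : x ∈ homogeneousPart k d i) : homogeneousProj d i x = x := by
  rw [mem_homogeneousPart] at hx
  funext j
  ext n
  rw [homogeneousProj_apply]
  by_cases h : (x j).coeff n = 0
  · rw [h]
    split_ifs with h'
    · rw [coeff_monomial]
      split_ifs with h2
      · rw [h2, h]
      · rfl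
    · simp
  · have := hx j n h
    rw [if_pos (by omega), coeff_monomial, if_pos (by omega)]
    congr 1
    omega

theorem homogeneousProj_of_mem_ne {d : ι → ℕ} {i l : ℕ} (hil : l ≠ i) {x : ι → k[X]}
    (hx : x ∈ homogeneousPart k d l) : homogeneousProj d i x = 0 := by
  rw [mem_homogeneousPart] at hx
  funext j
  rw [homogeneousProj_apply]
  split_ifs with h
  · have : (x j).coeff (i - d j) = 0 := by
      by_contra h'
      have := hx j _ h'
      omega
    simp [this]
  · rfl

theorem single_monomial_mem [DecidableEq ι] (d : ι → ℕ) (j : ι) (n : ℕ) (a : k) :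
    (Pi.single j (monomial n a) : ι → k[X]) ∈ homogeneousPart k d (d j + n) := by
  rw [mem_homogeneousPart]
  intro l e he
  by_cases h : l = j
  · subst h
    rw [Pi.single_eq_same, coeff_monomial] at he
    split_ifs at he with h
    · omega
    · exact absurd rfl he
  · simp [Pi.single_eq_of_ne h] at he

/-- A homogeneous element in the image of a homogeneous map of a free module is the image of a
homogeneous element. -/
theorem exists_homogeneous_lift [Finite ι] {M : Type*} [AddCommGroup M] [Module k M] [Module k[X] M]
    [IsScalarTower k k[X] M] {deg : ℕ → Submodule k M} {d : ι → ℕ}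
    (f : (ι → k[X]) →ₗ[k[X]] M) (hf : ∀ i, ∀ x ∈ homogeneousPart k d i, f x ∈ deg i) {i : ℕ}
    (pr : M →ₗ[k] M) (hpr : ∀ m ∈ deg i, pr m = m) (hpr' : ∀ l ≠ i, ∀ m ∈ deg l, pr m = 0)
    {x : ι → k[X]} (hx : f x ∈ deg i) : ∃ y ∈ homogeneousPart k d i, f y = f x := by
  classical
  have := Fintype.ofFinite ι
  refine ⟨homogeneousProj d i x, homogeneousProj_mem d i x, ?_⟩
  rw [← hpr _ hx]
  -- The lift is the degree-`i` component of `x`. That `f` commutes with the projections is checked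
  -- on monomial multiples of basis vectors, which are homogeneous: both sides keep them or both
  -- kill them.
  suffices h : (f.restrictScalars k) ∘ₗ homogeneousProj d i = pr ∘ₗ f.restrictScalars k from
    congrArg (fun g => g x) h
  refine LinearMap.pi_ext' fun j => Polynomial.lhom_ext' fun n => LinearMap.ext fun a => ?_
  have hm := single_monomial_mem (k := k) d j n a
  simp only [LinearMap.coe_comp, Function.comp_apply, LinearMap.coe_restrictScalars,
    LinearMap.coe_single]
  by_cases h : d j + n = i
  · rw [h] at hm
    rw [homogeneousProj_of_mem hm, hpr _ (hf _ _ hm)]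
  · rw [homogeneousProj_of_mem_ne h hm, hpr' _ h _ (hf _ _ hm), map_zero]

theorem labelMap_submatrix [Fintype κ] [Fintype τ] (dr : ι → ℕ) (dc : κ → ℕ) (A : Matrix ι κ k)
    (e : τ ≃ κ) (x : κ → k[X]) :
    labelMap dr (dc ∘ e) (A.submatrix id e) (x ∘ e) = labelMap dr dc A x := by
  funext i
  simp only [labelMap_apply, Matrix.submatrix_apply, id, Function.comp_apply]
  exact e.sum_comp fun j => C (A i j) * X ^ (dc j - dr i) * x j

theorem labelMap_submatrix_left [Fintype κ] (dr : ι → ℕ) (dc : κ → ℕ) (A : Matrix ι κ k)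
    (e : τ → ι) (x : κ → k[X]) :
    labelMap (dr ∘ e) dc (A.submatrix e id) x = labelMap dr dc A x ∘ e := by
  funext i
  simp [labelMap_apply]

theorem comp_mem_homogeneousPart (d : ι → ℕ) (e : τ ≃ ι) (i : ℕ) (x : ι → k[X]) :
    x ∘ e ∈ homogeneousPart k (d ∘ e) i ↔ x ∈ homogeneousPart k d i := by
  simp only [mem_homogeneousPart, Function.comp_apply]
  exact e.forall_congr_left.trans (by simp)

end FreeModules

/-! ### Triangular base changes and reduced matrices -/

section Triangular

variable {k : Type*} [Field k]

/-- The reason for sorting: adding an earlier column to a later one never violates the degrees. -/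
theorem labelCompatible_of_blockTriangular {n : ℕ} {d : Fin n → ℕ} (hd : Monotone d)
    {U : Matrix (Fin n) (Fin n) k} (hU : U.BlockTriangular id) : LabelCompatible d d U := by
  intro i j hij
  apply hd
  by_contra h
  exact hij (hU (not_le.1 h))

/-- Triangularity of the inverse matters: through `labelCompatible_of_blockTriangular` it makes the
inverse homogeneous as well. -/
theorem exists_inverse_of_blockTriangular {n : ℕ} {U : Matrix (Fin n) (Fin n) k}
    (hU : U.BlockTriangular id) (hdiag : ∀ i, U i i ≠ 0) :
    ∃ V : Matrix (Fin n) (Fin n) k, V.BlockTriangular id ∧ U * V = 1 ∧ V * U = 1 := by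
  have hdet : IsUnit U.det := by
    rw [Matrix.det_of_isUpperTriangular hU]
    exact (Finset.prod_ne_zero_iff.2 fun i _ => hdiag i).isUnit
  have := U.invertibleOfIsUnitDet hdet
  exact ⟨U⁻¹, Matrix.blockTriangular_inv_of_blockTriangular hU, U.mul_nonsing_inv hdet,
    U.nonsing_inv_mul hdet⟩

/-- A matrix is column reduced, with `piv` sending every pivot row to the column with this pivot:
pivots are lowest nonzero entries, and every nonzero column has a pivot. -/
structure IsReduced {m n : ℕ} (A : Matrix (Fin m) (Fin n) k) (piv : Fin m → Option (Fin n)) :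
    Prop where
  ne_zero : ∀ i j, piv i = some j → A i j ≠ 0
  lowest : ∀ i j, piv i = some j → ∀ i', i < i' → A i' j = 0
  exists_pivot : ∀ j, (∃ i, A i j ≠ 0) → ∃ i, piv i = some j

namespace IsReduced

variable {m n : ℕ} {A : Matrix (Fin m) (Fin n) k} {piv : Fin m → Option (Fin n)}

theorem pivot_unique (h : IsReduced A piv) {i i' : Fin m} {j : Fin n} (hi : piv i = some j)
    (hi' : piv i' = some j) : i = i' := by
  rcases lt_trichotomy i i' with hlt | heq | hlt
  · exact absurd (h.lowest i j hi i' hlt) (h.ne_zero i' j hi')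
  · exact heq
  · exact absurd (h.lowest i' j hi' i hlt) (h.ne_zero i j hi)

/-- Independence of the nonzero columns, by induction from the bottom row upwards. In row `i`, a
column other than `j` with a nonzero entry has its pivot strictly below, so its coefficient is
already known to vanish; only the pivot entry of `j` remains. -/
theorem eq_zero_of_labelMap_eq_zero (h : IsReduced A piv) {dr : Fin m → ℕ} {dc : Fin n → ℕ}
    {x : Fin n → k[X]} (hx : labelMap dr dc A x = 0) (i : Fin m) :
    ∀ j, piv i = some j → x j = 0 := by
  induction i using (wellFounded_gt (α := Fin m)).induction with
  | _ i ih =>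
    intro j hij
    have hrow := congrFun hx i
    rw [labelMap_apply, Finset.sum_eq_single j] at hrow
    · simpa [h.ne_zero i j hij] using hrow
    · intro j' _ hj'
      by_cases h0 : A i j' = 0
      · simp [h0]
      obtain ⟨i', hi'⟩ := h.exists_pivot j' ⟨i, h0⟩
      have hne : i' ≠ i := by
        rintro rfl
        exact hj' (Option.some_injective _ (hi'.symm.trans hij))
      have hgt : i < i' := by
        by_contra hle
        exact h0 (h.lowest i' j' hi' i (lt_of_le_of_ne (not_lt.1 hle) hne))
      rw [ih i' hgt j' hi', mul_zero]
    · simp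

end IsReduced

end Triangular

/-! ### Interval modules and barcodes -/

section Bars

variable {k : Type*} [Field k]

theorem mem_barIdeal_top {a : ℕ} {f : k[X]} : f ∈ barIdeal k (a, ⊤) ↔ f = 0 := by
  have : {f : k[X] | ∃ e : ℕ, ((a, ⊤) : Bar).2 = (e : ℕ∞) ∧
      f = X ^ (e - ((a, ⊤) : Bar).1)} = ∅ := by
    ext f
    simp
  rw [barIdeal, this]
  simp

theorem mem_barIdeal_coe {a b : ℕ} {f : k[X]} :
    f ∈ barIdeal k (a, (b : ℕ∞)) ↔ (X : k[X]) ^ (b - a) ∣ f := by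
  have : {f : k[X] | ∃ e : ℕ, ((a, (b : ℕ∞)) : Bar).2 = (e : ℕ∞) ∧
      f = X ^ (e - ((a, (b : ℕ∞)) : Bar).1)} = {X ^ (b - a)} := by
    ext f
    simp
  rw [barIdeal, this, Ideal.mem_span_singleton]

/-- The truncated exponent `e - a` is `0`, so the generator is `1`. Coordinates with an empty bar
therefore impose no condition and can be dropped. -/
theorem barIdeal_eq_top_of_not_lt {b : Bar} (hb : ¬ (b.1 : ℕ∞) < b.2) (f : k[X]) :
    f ∈ barIdeal k b := by
  obtain ⟨a, e⟩ := b
  cases e with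
  | top => simp at hb
  | coe e =>
    simp only [Nat.cast_lt, not_lt] at hb
    rw [mem_barIdeal_coe, Nat.sub_eq_zero_of_le hb]
    simp

/-- `IsBarcode` asks for a family indexed by some `Fin d`; the injection `u` reindexes the bars that
survive the filter and keeps track of their coordinates. -/
theorem exists_fin_map_eq_filter {α : Type*} {h : ℕ} (bar : Fin h → α) (p : α → Prop)
    [DecidablePred p] :
    ∃ (d : ℕ) (u : Fin d → Fin h), Function.Injective u ∧ (∀ i, (∃ j, u j = i) ↔ p (bar i)) ∧
      Finset.univ.val.map (fun j => bar (u j)) = (Finset.univ.val.map bar).filter p := by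
  let S : Finset (Fin h) := Finset.univ.filter fun i => p (bar i)
  refine ⟨S.card, fun j => (S.equivFin.symm j : Fin h), ?_, ?_, ?_⟩
  · exact Subtype.val_injective.comp S.equivFin.symm.injective
  · intro i
    constructor
    · rintro ⟨j, rfl⟩
      exact (Finset.mem_filter.1 (S.equivFin.symm j).2).2
    · intro hi
      exact ⟨S.equivFin ⟨i, Finset.mem_filter.2 ⟨Finset.mem_univ _, hi⟩⟩, by simp⟩
  · have h1 : Finset.univ.map
        ((S.equivFin.symm.toEmbedding).trans (Function.Embedding.subtype (· ∈ S))) = S := by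
      ext i
      simp only [Finset.mem_map, Finset.mem_univ, true_and, Function.Embedding.trans_apply,
        Equiv.coe_toEmbedding, Function.Embedding.subtype_apply]
      constructor
      · rintro ⟨j, rfl⟩
        exact (S.equivFin.symm j).2
      · intro hi
        exact ⟨S.equivFin ⟨i, hi⟩, by simp⟩
    rw [Multiset.filter_map]
    change _ = Multiset.map bar S.val
    conv_rhs => rw [← h1]
    rw [Finset.map_val, Multiset.map_map]
    rfl

/-- A surjection from a graded free module whose kernel is the product of the bar ideals exhibits
the barcode. -/
theorem isBarcode_of_surjective {M : Type*} [AddCommGroup M] [Module k M] [Module k[X] M]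
    (deg : ℕ → Submodule k M) {h : ℕ} (bar : Fin h → Bar) (Θ : (Fin h → k[X]) →ₗ[k[X]] M)
    (hsurj : Function.Surjective Θ) (hker : ∀ v, Θ v = 0 ↔ ∀ i, v i ∈ barIdeal k (bar i))
    (hdeg : ∀ i m, m ∈ deg i ↔ ∃ v ∈ homogeneousPart k (fun j => (bar j).1) i, Θ v = m) :
    IsBarcode deg ((Finset.univ.val.map bar).filter fun b => (b.1 : ℕ∞) < b.2) := by
  obtain ⟨d, u, hu, hmem, hmap⟩ :=
    exists_fin_map_eq_filter bar (fun b => (b.1 : ℕ∞) < b.2)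
  refine ⟨fun b hb => (Multiset.mem_filter.1 hb).2, d, fun j => bar (u j), hmap, ?_⟩
  let Ξ : (Fin h → k[X]) →ₗ[k[X]] ((j : Fin d) → Interval k (bar (u j))) :=
    LinearMap.pi fun j => (barIdeal k (bar (u j))).mkQ ∘ₗ LinearMap.proj (u j)
  have hΞ : ∀ v j, Ξ v j = (barIdeal k (bar (u j))).mkQ (v (u j)) := fun v j => rfl
  have hΞlift : ∀ w : Fin d → k[X], ∃ v : Fin h → k[X], (∀ j, v (u j) = w j) ∧
      ∀ i, (∀ j, u j ≠ i) → v i = 0 := by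
    intro w
    -- Extension by zero, because zero lies in every degree: a homogeneous `w` gets a homogeneous
    -- lift.
    refine ⟨Function.extend u w 0, fun j => hu.extend_apply w 0 j, fun i hi => ?_⟩
    rw [Function.extend_apply' _ _ _ (fun ⟨j, hj⟩ => hi j hj)]
    rfl
  have hΞsurj : Function.Surjective Ξ := by
    intro y
    choose w hw using fun j => Submodule.mkQ_surjective (barIdeal k (bar (u j))) (y j)
    obtain ⟨v, hv, -⟩ := hΞlift w
    exact ⟨v, funext fun j => by rw [hΞ, hv, hw]⟩
  -- The dropped coordinates have unit ideals, so both surjections from the free module have the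
  -- same kernel and their targets are identified.
  have hkereq : LinearMap.ker Θ = LinearMap.ker Ξ := by
    ext v
    rw [LinearMap.mem_ker, LinearMap.mem_ker, hker, funext_iff]
    simp only [hΞ, Pi.zero_apply, Submodule.mkQ_apply, Submodule.Quotient.mk_eq_zero]
    constructor
    · intro hv j
      exact hv (u j)
    · intro hv i
      by_cases hi : ((bar i).1 : ℕ∞) < (bar i).2
      · obtain ⟨j, rfl⟩ := (hmem i).2 hi
        exact hv j
      · exact barIdeal_eq_top_of_not_lt hi _
  let e := (Θ.quotKerEquivOfSurjective hsurj).symm.trans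
    ((Submodule.quotEquivOfEq _ _ hkereq).trans (Ξ.quotKerEquivOfSurjective hΞsurj))
  have he : ∀ v, e (Θ v) = Ξ v := by
    intro v
    have : (Θ.quotKerEquivOfSurjective hsurj).symm (Θ v) = Submodule.Quotient.mk v := by
      rw [LinearEquiv.symm_apply_eq]
      rfl
    simp only [e, LinearEquiv.trans_apply, this]
    rfl
  refine ⟨e, fun i m => ?_⟩
  rw [hdeg]
  constructor
  · rintro ⟨v, hv, rfl⟩
    rw [he]
    intro j _
    exact ⟨v (u j), hv (u j) (Set.mem_univ _), rfl⟩
  · intro hm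
    choose w hw hw' using fun j => hm j (Set.mem_univ j)
    obtain ⟨v, hv, hv'⟩ := hΞlift w
    refine ⟨v, fun a _ => ?_, e.injective ?_⟩
    · by_cases ha : ∃ j, u j = a
      · obtain ⟨j, rfl⟩ := ha
        rw [hv]
        exact hw j
      · push Not at ha
        rw [hv' a ha]
        exact Submodule.zero_mem _
    · rw [he]
      funext j
      rw [hΞ, hv]
      exact hw' j

end Bars

/-! ### Kernel and cokernel from column reductions -/

section Reduction

variable {k : Type*} [Field k]

/-- The kernel of a column-reducible labelled matrix is free: it projects isomorphically onto the
coordinates of the columns that become zero. -/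
theorem exists_kernel_matrix {r m h : ℕ} {dr : Fin r → ℕ} {d : Fin m → ℕ} (hd : Monotone d)
    {G : Matrix (Fin r) (Fin m) k} (hG : LabelCompatible dr d G)
    {U : Matrix (Fin m) (Fin m) k} (hU : U.BlockTriangular id) (hU1 : ∀ i, U i i = 1)
    {piv : Fin r → Option (Fin m)} (hred : IsReduced (G * U) piv)
    {z : Fin h → Fin m} (hz : StrictMono z)
    (hz0 : ∀ j, (∃ a, z a = j) ↔ ∀ i, (G * U) i j = 0) :
    ∃ E : Matrix (Fin m) (Fin h) k, LabelCompatible d (d ∘ z) E ∧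
      (∀ v, labelMap d (d ∘ z) E v ∘ z = v) ∧
      (∀ v, labelMap dr d G (labelMap d (d ∘ z) E v) = 0) ∧
      (∀ x, labelMap dr d G x = 0 → labelMap d (d ∘ z) E (x ∘ z) = x) := by
  obtain ⟨V, hV, hUV, hVU⟩ := exists_inverse_of_blockTriangular hU (fun i => by simp [hU1])
  -- Restricting to increasing indices preserves unitriangularity. The columns of `U` at `z` form a
  -- basis of the kernel; multiplying by the inverse `Y` of their `z`-rows normalizes it so that the
  -- `z`-coordinates of `E v` are `v` itself.
  have hUz : (U.submatrix z z).BlockTriangular id := fun i j hij => hU (hz hij)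
  obtain ⟨Y, hY, hUY, hYU⟩ := exists_inverse_of_blockTriangular hUz (fun i => by simp [hU1])
  have cU := labelCompatible_of_blockTriangular hd hU
  have cV := labelCompatible_of_blockTriangular hd hV
  have cY := labelCompatible_of_blockTriangular (hd.comp hz.monotone) hY
  have cUz : LabelCompatible d (d ∘ z) (U.submatrix id z) := fun i j hij => cU i (z j) hij
  have cE : LabelCompatible d (d ∘ z) (U.submatrix id z * Y) := cUz.mul cY
  have hEz : ∀ v, labelMap d (d ∘ z) (U.submatrix id z * Y) v ∘ z = v := by
    intro v
    rw [← labelMap_submatrix_left]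
    have : (U.submatrix id z * Y).submatrix z id = 1 := by
      rw [← hUY]
      rfl
    rw [this, labelMap_one]
  refine ⟨U.submatrix id z * Y, cE, hEz, ?_, ?_⟩
  · intro v
    rw [← labelMap_mul hG cE]
    have : G * (U.submatrix id z * Y) = 0 := by
      rw [← Matrix.mul_assoc]
      have : G * U.submatrix id z = 0 := by
        ext i a
        exact (hz0 (z a)).1 ⟨a, rfl⟩ i
      rw [this, Matrix.zero_mul]
    rw [this]
    funext i
    simp [labelMap_apply]
  · intro x hx
    -- In the reduced basis, `x = U y` with `G U y = 0`, so `y` is supported on the zero columns.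
    -- Hence `x` and `x ∘ z` are the images of `y ∘ z` under `U.submatrix id z` and `U.submatrix z
    -- z`, and `Y` undoes the latter.
    set y := labelMap d d V x with hy
    have hUy : labelMap d d U y = x := by
      rw [hy, ← labelMap_mul cU cV, hUV, labelMap_one]
    have hy0 : ∀ j, (∀ a, z a ≠ j) → y j = 0 := by
      intro j hj
      have h1 : labelMap dr d (G * U) y = 0 := by
        rw [labelMap_mul hG cU, hUy, hx]
      have h2 : ¬ ∀ i, (G * U) i j = 0 := fun h => by
        obtain ⟨a, ha⟩ := (hz0 j).2 h
        exact hj a ha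
      push Not at h2
      obtain ⟨i, hi⟩ := hred.exists_pivot j h2
      exact hred.eq_zero_of_labelMap_eq_zero h1 i j hi
    have hxy : labelMap d (d ∘ z) (U.submatrix id z) (y ∘ z) = x := by
      rw [← hUy]
      funext i
      rw [labelMap_apply, labelMap_apply]
      refine Fintype.sum_of_injective z hz.injective _ _ (fun j hj => ?_) (fun a => rfl)
      rw [hy0 j (fun a ha => hj ⟨a, ha⟩), mul_zero]
    have hxz : labelMap (d ∘ z) (d ∘ z) (U.submatrix z z) (y ∘ z) = x ∘ z := by
      rw [← hxy, ← labelMap_submatrix_left]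
      rfl
    have cUzz : LabelCompatible (d ∘ z) (d ∘ z) (U.submatrix z z) := fun i j hij => cU _ _ hij
    rw [labelMap_mul cUz cY, ← hxz, ← labelMap_mul cY cUzz, hYU, labelMap_one, hxy]

/-- The cokernel of a column-reducible labelled matrix is, up to a triangular change of basis, the
sum of the interval modules given by the pivots. -/
theorem exists_cokernel_matrix {h c : ℕ} {b : Fin h → ℕ} (hb : Monotone b) {dc : Fin c → ℕ}
    (hdc : Monotone dc) {K : Matrix (Fin h) (Fin c) k} (hK : LabelCompatible b dc K)
    {W : Matrix (Fin c) (Fin c) k} (hW : W.BlockTriangular id) (hW1 : ∀ i, W i i = 1)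
    {piv : Fin h → Option (Fin c)} (hred : IsReduced (K * W) piv) :
    ∃ T T' : Matrix (Fin h) (Fin h) k, LabelCompatible b b T ∧ LabelCompatible b b T' ∧
      T * T' = 1 ∧ T' * T = 1 ∧
      ∀ v, (∃ w, labelMap b dc K w = labelMap b b T v) ↔
        ∀ a, v a ∈ barIdeal k (b a, (piv a).elim ⊤ fun g => (dc g : ℕ∞)) := by
  obtain ⟨V, hV, hWV, hVW⟩ := exists_inverse_of_blockTriangular hW (fun i => by simp [hW1])
  have cW := labelCompatible_of_blockTriangular hdc hW
  have cV := labelCompatible_of_blockTriangular hdc hV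
  -- Column `a` of `T` is the reduced column with pivot `a`, or the unit vector if `a` is no pivot
  -- row. Pivots are lowest entries, so `T` is upper triangular with nonzero diagonal.
  let T : Matrix (Fin h) (Fin h) k := Matrix.of fun i a =>
    (piv a).elim (if i = a then 1 else 0) fun g => (K * W) i g
  have hT : T.BlockTriangular id := by
    intro i a hia
    simp only [id] at hia
    simp only [T, Matrix.of_apply]
    cases hp : piv a with
    | none => simp [hia.ne']
    | some g => exact hred.lowest a g hp i hia
  have hT1 : ∀ a, T a a ≠ 0 := by
    intro a
    simp only [T, Matrix.of_apply]
    cases hp : piv a with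
    | none => simp
    | some g => exact hred.ne_zero a g hp
  obtain ⟨T', hT', hTT', hT'T⟩ := exists_inverse_of_blockTriangular hT hT1
  have cT := labelCompatible_of_blockTriangular hb hT
  have cT' := labelCompatible_of_blockTriangular hb hT'
  refine ⟨T, T', cT, cT', hTT', hT'T, fun v => ?_⟩
  -- Normal form of `K`: after the base changes `T` and `W` only the pivot positions are left, so
  -- the image is a product of ideals, one for each row.
  let S : Matrix (Fin h) (Fin c) k := Matrix.of fun i g => if piv i = some g then 1 else 0
  have cS : LabelCompatible b dc S := by
    intro i g hig
    simp only [S, Matrix.of_apply, ne_eq, ite_eq_right_iff, one_ne_zero, imp_false, not_not] at hig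
    exact (hK.mul cW) i g (hred.ne_zero i g hig)
  have hTS : K * W = T * S := by
    ext i g
    rw [Matrix.mul_apply (M := T)]
    by_cases h0 : ∃ i, (K * W) i g ≠ 0
    · obtain ⟨a, ha⟩ := hred.exists_pivot g h0
      rw [Finset.sum_eq_single a]
      · simp [T, S, ha]
      · intro a' _ ha'
        have : piv a' ≠ some g := fun h => ha' (hred.pivot_unique h ha)
        simp [S, this]
      · simp
    · push Not at h0
      rw [h0 i]
      symm
      refine Finset.sum_eq_zero fun a _ => ?_
      have : piv a ≠ some g := fun h => hred.ne_zero a g h (h0 a)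
      simp [S, this]
  have hSv : ∀ w a, labelMap b dc S w a = (piv a).elim 0 fun g => X ^ (dc g - b a) * w g := by
    intro w a
    rw [labelMap_apply]
    cases hp : piv a with
    | none => simp [S, hp]
    | some g =>
      rw [Finset.sum_eq_single g]
      · simp [S, hp]
      · intro g' _ hg'
        simp [S, hp, hg'.symm]
      · simp
  have key : (∃ w, labelMap b dc K w = labelMap b b T v) ↔ ∃ w, labelMap b dc S w = v := by
    constructor
    · rintro ⟨w, hw⟩
      refine ⟨labelMap dc dc V w, ?_⟩
      have : labelMap b b T (labelMap b dc S (labelMap dc dc V w)) = labelMap b b T v := by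
        rw [← labelMap_mul cT cS, ← hTS, ← labelMap_mul (hK.mul cW) cV, Matrix.mul_assoc, hWV,
          Matrix.mul_one, hw]
      have h2 := congrArg (labelMap b b T') this
      rwa [← labelMap_mul cT' cT, ← labelMap_mul cT' cT, hT'T, labelMap_one, labelMap_one] at h2
    · rintro ⟨w, rfl⟩
      exact ⟨labelMap dc dc W w, by
        rw [← labelMap_mul cT cS, ← hTS, labelMap_mul hK cW]⟩
  rw [key]
  constructor
  · rintro ⟨w, rfl⟩ a
    rw [hSv]
    cases hp : piv a with
    | none => exact mem_barIdeal_top.2 rfl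
    | some g => exact mem_barIdeal_coe.2 (dvd_mul_right _ _)
  · intro hv
    -- A column is the pivot column of at most one row, so the quotients can be chosen columnwise;
    -- columns without pivot get `0`.
    have : ∀ g, ∃ p : k[X], ∀ a, piv a = some g → v a = X ^ (dc g - b a) * p := by
      intro g
      by_cases hg : ∃ a, piv a = some g
      · obtain ⟨a, ha⟩ := hg
        have h1 := hv a
        rw [ha] at h1
        obtain ⟨p, hp⟩ := mem_barIdeal_coe.1 h1
        exact ⟨p, fun a' ha' => by rw [hred.pivot_unique ha' ha, hp]⟩
      · exact ⟨0, fun a ha => absurd ⟨a, ha⟩ hg⟩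
    choose w hw using this
    refine ⟨w, funext fun a => ?_⟩
    rw [hSv]
    cases hp : piv a with
    | none =>
      have h1 := hv a
      rw [hp] at h1
      exact (mem_barIdeal_top.1 h1).symm
    | some g => exact (hw g a hp).symm

end Reduction

/-! ### The homology of a pair of reducible matrices -/

section Parametrization

variable {k : Type*} [Field k]

/-- Homogeneous parametrization of the kernel of a reducible labelled matrix `G` in which the image
of `F` becomes a product of bar ideals. -/
theorem exists_parametrization {r m h c : ℕ} {dr : Fin r → ℕ} {d : Fin m → ℕ} (hd : Monotone d)
    {dc : Fin c → ℕ} (hdc : Monotone dc)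
    {G : Matrix (Fin r) (Fin m) k} (hG : LabelCompatible dr d G)
    {F : Matrix (Fin m) (Fin c) k} (hF : LabelCompatible d dc F)
    (hGF : ∀ w, labelMap dr d G (labelMap d dc F w) = 0)
    {U : Matrix (Fin m) (Fin m) k} (hU : U.BlockTriangular id) (hU1 : ∀ i, U i i = 1)
    {pivG : Fin r → Option (Fin m)} (hredG : IsReduced (G * U) pivG)
    {z : Fin h → Fin m} (hz : StrictMono z)
    (hz0 : ∀ j, (∃ a, z a = j) ↔ ∀ i, (G * U) i j = 0)
    {W : Matrix (Fin c) (Fin c) k} (hW : W.BlockTriangular id) (hW1 : ∀ i, W i i = 1)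
    {piv : Fin h → Option (Fin c)} (hred : IsReduced (F.submatrix z id * W) piv) :
    ∃ E : (Fin h → k[X]) →ₗ[k[X]] (Fin m → k[X]),
      (∀ v, labelMap dr d G (E v) = 0) ∧
      (∀ x, labelMap dr d G x = 0 → ∃ v, E v = x) ∧
      (∀ i v, E v ∈ homogeneousPart k d i ↔ v ∈ homogeneousPart k (d ∘ z) i) ∧
      ∀ v, (∃ w, labelMap d dc F w = E v) ↔
        ∀ a, v a ∈ barIdeal k (d (z a), (piv a).elim ⊤ fun g => (dc g : ℕ∞)) := by
  obtain ⟨E, cE, hEz, hGE, hEG⟩ := exists_kernel_matrix hd hG hU hU1 hredG hz hz0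
  have hK : LabelCompatible (d ∘ z) dc (F.submatrix z id) := fun i j hij => hF _ _ hij
  obtain ⟨T, T', cT, cT', hTT', hT'T, hcok⟩ :=
    exists_cokernel_matrix (hd.comp hz.monotone) hdc hK hW hW1 hred
  refine ⟨labelMap d (d ∘ z) E ∘ₗ labelMap (d ∘ z) (d ∘ z) T, fun v => hGE _, ?_, ?_, ?_⟩
  · intro x hx
    refine ⟨labelMap (d ∘ z) (d ∘ z) T' (x ∘ z), ?_⟩
    rw [LinearMap.comp_apply, ← labelMap_mul cT cT', hTT', labelMap_one, hEG x hx]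
  · intro i v
    constructor
    · intro hv
      -- The inverse is homogeneous too: read off the `z`-coordinates of `E v`, then apply `T'`.
      have h1 : v = labelMap (d ∘ z) (d ∘ z) T' ((labelMap d (d ∘ z) E ∘ₗ
          labelMap (d ∘ z) (d ∘ z) T) v ∘ z) := by
        rw [LinearMap.comp_apply, hEz, ← labelMap_mul cT' cT, hT'T, labelMap_one]
      rw [h1]
      refine labelMap_mem_homogeneousPart cT' ?_
      intro a _
      exact hv (z a) (Set.mem_univ _)
    · intro hv
      exact labelMap_mem_homogeneousPart cE (labelMap_mem_homogeneousPart cT hv)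
  · intro v
    refine Iff.trans ?_ (hcok v)
    refine exists_congr fun w => ?_
    rw [labelMap_submatrix_left, LinearMap.comp_apply]
    -- Both `F w` and the embedded vector lie in `ker G`, and an element of `ker G` is determined by
    -- its `z`-coordinates; so deleting the other rows of `F` loses nothing.
    constructor
    · intro hw
      rw [hw, hEz]
    · intro hw
      rw [← hw, hEG _ (hGF w)]

end Parametrization

/-! ### From a complex of presentations to `ker G / im F` -/

section Homology

variable {k : Type*} [Field k]
  {L : Type*} [AddCommGroup L] [Module k L] [Module k[X] L]
  {M : Type*} [AddCommGroup M] [Module k M] [Module k[X] M]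
  {N : Type*} [AddCommGroup N] [Module k N] [Module k[X] N]
  {degL : ℕ → Submodule k L} {degM : ℕ → Submodule k M} {degN : ℕ → Submodule k N}
  {φ : L →ₗ[k[X]] M} {ψ : M →ₗ[k[X]] N} {D : Input k}
  {lam : (Fin D.nP0 → k[X]) →ₗ[k[X]] L} {mu : (Fin D.nQ0 → k[X]) →ₗ[k[X]] M}
  {nu : (Fin D.nR0 → k[X]) →ₗ[k[X]] N}

/-- Degrees of the generators of `Q₀ ⊕ R₁`. -/
def Input.degQR (D : Input k) : Fin D.nQ0 ⊕ Fin D.nR1 → ℕ := Sum.elim D.degQ0 D.degR1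

/-- Degrees of the generators of `P₀ ⊕ Q₁`. -/
def Input.degPQ (D : Input k) : Fin D.nP0 ⊕ Fin D.nQ1 → ℕ := Sum.elim D.degP0 D.degQ1

/-- The matrix `(g₀ -r)`. -/
def Input.matG (D : Input k) : Matrix (Fin D.nR0) (Fin D.nQ0 ⊕ Fin D.nR1) k :=
  Matrix.fromCols D.g0 (-D.r)

/-- The matrix `(f₀ -q ; 0 -g₁)`. -/
def Input.matF (D : Input k) : Matrix (Fin D.nQ0 ⊕ Fin D.nR1) (Fin D.nP0 ⊕ Fin D.nQ1) k :=
  Matrix.fromBlocks D.f0 (-D.q) 0 (-D.g1)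

theorem Input.labelMap_matG (D : Input k) (x : Fin D.nQ0 ⊕ Fin D.nR1 → k[X]) :
    labelMap D.degR0 D.degQR D.matG x =
      freeMap D.degR0 D.degQ0 D.g0 (x ∘ Sum.inl) - freeMap D.degR0 D.degR1 D.r (x ∘ Sum.inr) := by
  funext i
  change _ = labelMap D.degR0 D.degQ0 D.g0 (x ∘ Sum.inl) i - labelMap D.degR0 D.degR1 D.r _ i
  simp [labelMap_apply, Input.matG, Input.degQR, sub_eq_add_neg, Finset.sum_neg_distrib]

theorem Input.labelMap_matF_inl (D : Input k) (w : Fin D.nP0 ⊕ Fin D.nQ1 → k[X]) :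
    labelMap D.degQR D.degPQ D.matF w ∘ Sum.inl =
      freeMap D.degQ0 D.degP0 D.f0 (w ∘ Sum.inl) - freeMap D.degQ0 D.degQ1 D.q (w ∘ Sum.inr) := by
  funext i
  change _ = labelMap D.degQ0 D.degP0 D.f0 (w ∘ Sum.inl) i - labelMap D.degQ0 D.degQ1 D.q _ i
  simp [labelMap_apply, Input.matF, Input.degQR, Input.degPQ, sub_eq_add_neg,
    Finset.sum_neg_distrib]

theorem Input.labelMap_matF_inr (D : Input k) (w : Fin D.nP0 ⊕ Fin D.nQ1 → k[X]) :
    labelMap D.degQR D.degPQ D.matF w ∘ Sum.inr =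
      - freeMap D.degR1 D.degQ1 D.g1 (w ∘ Sum.inr) := by
  funext i
  change _ = - labelMap D.degR1 D.degQ1 D.g1 _ i
  simp [labelMap_apply, Input.matF, Input.degQR, Input.degPQ, Finset.sum_neg_distrib]

namespace Input.Presents

theorem matG_compatible (hD : D.Presents degL degM degN φ ψ lam mu nu) :
    LabelCompatible D.degR0 D.degQR D.matG := by
  rintro i (j | j) hij
  · exact hD.compatible_g0 i j hij
  · exact hD.presN.compatible i j (by simpa [Input.matG] using hij)

theorem matF_compatible (hD : D.Presents degL degM degN φ ψ lam mu nu) :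
    LabelCompatible D.degQR D.degPQ D.matF := by
  rintro (i | i) (j | j) hij
  · exact hD.compatible_f0 i j hij
  · exact hD.presM.compatible i j (by simpa [Input.matF] using hij)
  · simp [Input.matF] at hij
  · exact hD.compatible_g1 i j (by simpa [Input.matF] using hij)

/-- The contributions of `Q₁` are `-g₀ q + r g₁`, which cancel by commutativity of the lower square;
that of `P₀` is `g₀ f₀ = 0`. -/
theorem matG_matF (hD : D.Presents degL degM degN φ ψ lam mu nu)
    (w : Fin D.nP0 ⊕ Fin D.nQ1 → k[X]) :
    labelMap D.degR0 D.degQR D.matG (labelMap D.degQR D.degPQ D.matF w) = 0 := by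
  have h1 := LinearMap.congr_fun hD.comp_zero (w ∘ Sum.inl)
  have h2 := LinearMap.congr_fun hD.comm_g (w ∘ Sum.inr)
  simp only [LinearMap.comp_apply, LinearMap.zero_apply] at h1 h2
  rw [D.labelMap_matG, D.labelMap_matF_inl, D.labelMap_matF_inr, map_sub, map_neg, h1, h2]
  abel

theorem mem_ker_of_matG (hD : D.Presents degL degM degN φ ψ lam mu nu)
    {x : Fin D.nQ0 ⊕ Fin D.nR1 → k[X]}
    (hx : labelMap D.degR0 D.degQR D.matG x = 0) : ψ (mu (x ∘ Sum.inl)) = 0 := by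
  rw [D.labelMap_matG, sub_eq_zero] at hx
  have h1 := LinearMap.congr_fun hD.comm_ψ (x ∘ Sum.inl)
  simp only [LinearMap.comp_apply] at h1
  rw [h1, hx, ← LinearMap.mem_ker, ← hD.presN.exact]
  exact LinearMap.mem_range_self _ _

/-- The nontrivial direction first corrects `x` by `f₀ u`, then uses exactness at `Q₀` to write the
rest as `q w`. The `R₁`-component is then forced to be `g₁ w`, since `r` is injective. -/
theorem mem_range_iff (hD : D.Presents degL degM degN φ ψ lam mu nu)
    {x : Fin D.nQ0 ⊕ Fin D.nR1 → k[X]}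
    (hx : labelMap D.degR0 D.degQR D.matG x = 0) :
    mu (x ∘ Sum.inl) ∈ LinearMap.range φ ↔ ∃ w, labelMap D.degQR D.degPQ D.matF w = x := by
  have hφ := fun u => LinearMap.congr_fun hD.comm_φ u
  simp only [LinearMap.comp_apply] at hφ
  constructor
  · rintro ⟨l, hl⟩
    obtain ⟨u, rfl⟩ := hD.presL.surjective l
    rw [hφ] at hl
    have h1 : x ∘ Sum.inl - freeMap D.degQ0 D.degP0 D.f0 u ∈ LinearMap.ker mu := by
      rw [LinearMap.mem_ker, map_sub, hl, sub_self]
    rw [← hD.presM.exact] at h1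
    obtain ⟨w, hw⟩ := h1
    have hinl : x ∘ Sum.inl = freeMap D.degQ0 D.degP0 D.f0 u + freeMap D.degQ0 D.degQ1 D.q w := by
      rw [hw]
      abel
    rw [D.labelMap_matG, sub_eq_zero, hinl, map_add] at hx
    have h2 := LinearMap.congr_fun hD.comp_zero u
    have h3 := LinearMap.congr_fun hD.comm_g w
    simp only [LinearMap.comp_apply, LinearMap.zero_apply] at h2 h3
    rw [h2, h3, zero_add] at hx
    have hinr := hD.presN.injective hx
    -- The minus sign compensates for the blocks `-q` and `-g₁` of `F`.
    refine ⟨Sum.elim u (-w), ?_⟩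
    have e1 := D.labelMap_matF_inl (Sum.elim u (-w))
    have e2 := D.labelMap_matF_inr (Sum.elim u (-w))
    rw [Sum.elim_comp_inr, map_neg, neg_neg, hinr] at e2
    rw [Sum.elim_comp_inl, Sum.elim_comp_inr, map_neg, sub_neg_eq_add, ← hinl] at e1
    funext i
    rcases i with i | i
    · exact congrFun e1 i
    · exact congrFun e2 i
  · rintro ⟨w, rfl⟩
    refine ⟨lam (w ∘ Sum.inl), ?_⟩
    have h1 : mu (freeMap D.degQ0 D.degQ1 D.q (w ∘ Sum.inr)) = 0 := by
      rw [← LinearMap.mem_ker, ← hD.presM.exact]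
      exact LinearMap.mem_range_self _ _
    rw [hφ, D.labelMap_matF_inl, map_sub, h1, sub_zero]

theorem exists_lift (hD : D.Presents degL degM degN φ ψ lam mu nu) {y : M} (hy : ψ y = 0) :
    ∃ x, labelMap D.degR0 D.degQR D.matG x = 0 ∧ mu (x ∘ Sum.inl) = y := by
  obtain ⟨u, rfl⟩ := hD.presM.surjective y
  have h1 := LinearMap.congr_fun hD.comm_ψ u
  simp only [LinearMap.comp_apply] at h1
  rw [hy, eq_comm, ← LinearMap.mem_ker, ← hD.presN.exact] at h1
  obtain ⟨t, ht⟩ := h1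
  refine ⟨Sum.elim u t, ?_, rfl⟩
  rw [D.labelMap_matG, Sum.elim_comp_inl, Sum.elim_comp_inr, ht, sub_self]

/-- Two successive homogeneous lifts: `u` of `y` along `μ`, then `t` of `g₀ u` along `r`. The second
is possible because `g₀ u` is homogeneous and lies in `ker ν = im r`. -/
theorem exists_homogeneous_lift [IsScalarTower k k[X] M]
    (hD : D.Presents degL degM degN φ ψ lam mu nu) (hM : IsGrading degM)
    {i : ℕ} {y : M} (hyi : y ∈ degM i)
    (hy : ψ y = 0) :
    ∃ x ∈ homogeneousPart k D.degQR i,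
      labelMap D.degR0 D.degQR D.matG x = 0 ∧ mu (x ∘ Sum.inl) = y := by
  obtain ⟨u', rfl⟩ := hD.presM.surjective y
  -- Projection of `M` to its degree-`i` component, obtained from the internal direct sum
  -- decomposition.
  let pr : M →ₗ[k] M := (degM i).subtype ∘ₗ DirectSum.component k ℕ (fun j => degM j) i ∘ₗ
    (LinearEquiv.ofBijective (DirectSum.coeLinearMap degM) hM.isInternal).symm.toLinearMap
  obtain ⟨u, hu, huu⟩ := GradedPres.exists_homogeneous_lift (d := D.degQ0) mu
    (fun i x hx => hD.presM.homogeneous i x hx) pr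
    (fun m hm => congrArg Subtype.val (hM.isInternal.ofBijective_coeLinearMap_of_mem hm))
    (fun l hl m hm =>
      congrArg Subtype.val (hM.isInternal.ofBijective_coeLinearMap_of_mem_ne hl hm)) hyi
  have h1 := LinearMap.congr_fun hD.comm_ψ u
  simp only [LinearMap.comp_apply] at h1
  rw [huu, hy, eq_comm, ← LinearMap.mem_ker, ← hD.presN.exact] at h1
  obtain ⟨t', ht'⟩ := h1
  have hg : freeMap D.degR0 D.degQ0 D.g0 u ∈ homogeneousPart k D.degR0 i :=
    labelMap_mem_homogeneousPart (dr := D.degR0) hD.compatible_g0 hu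
  obtain ⟨t, ht, htt⟩ := GradedPres.exists_homogeneous_lift (d := D.degR1)
    (deg := homogeneousPart k D.degR0) (i := i) (x := t')
    (freeMap D.degR0 D.degR1 D.r)
    (fun i x hx => labelMap_mem_homogeneousPart (dr := D.degR0) hD.presN.compatible hx)
    (homogeneousProj D.degR0 i) (fun m hm => homogeneousProj_of_mem hm)
    (fun l hl m hm => homogeneousProj_of_mem_ne hl hm) (by rw [ht']; exact hg)
  refine ⟨Sum.elim u t, ?_, ?_, huu⟩
  · rintro (j | j) _
    · exact hu j (Set.mem_univ _)
    · exact ht j (Set.mem_univ _)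
  · rw [D.labelMap_matG, Sum.elim_comp_inl, Sum.elim_comp_inr, htt, ht', sub_self]

/-- The barcode of `ker ψ / im φ` can be read off from column reductions of the sorted matrices. -/
theorem isBarcode_homology [IsScalarTower k k[X] M]
    (hD : D.Presents degL degM degN φ ψ lam mu nu) (hM : IsGrading degM) {m h c : ℕ}
    (e : Fin m ≃ Fin D.nQ0 ⊕ Fin D.nR1) (he : Monotone (D.degQR ∘ e))
    (e' : Fin c ≃ Fin D.nP0 ⊕ Fin D.nQ1) (he' : Monotone (D.degPQ ∘ e'))
    {U : Matrix (Fin m) (Fin m) k} (hU : U.BlockTriangular id) (hU1 : ∀ i, U i i = 1)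
    {pivG : Fin D.nR0 → Option (Fin m)} (hredG : IsReduced (D.matG.submatrix id e * U) pivG)
    {z : Fin h → Fin m} (hz : StrictMono z)
    (hz0 : ∀ j, (∃ a, z a = j) ↔ ∀ i, (D.matG.submatrix id e * U) i j = 0)
    {W : Matrix (Fin c) (Fin c) k} (hW : W.BlockTriangular id) (hW1 : ∀ i, W i i = 1)
    {piv : Fin h → Option (Fin c)}
    (hred : IsReduced ((D.matF.submatrix e e').submatrix z id * W) piv) :
    IsBarcode (homologyDeg degM φ ψ) ((Finset.univ.val.map fun a =>
      (D.degQR (e (z a)), (piv a).elim ⊤ fun g => (D.degPQ (e' g) : ℕ∞))).filter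
        fun b => (b.1 : ℕ∞) < b.2) := by
  have hGs : ∀ x, labelMap D.degR0 (D.degQR ∘ e) (D.matG.submatrix id e) x =
      labelMap D.degR0 D.degQR D.matG (x ∘ e.symm) := by
    intro x
    rw [← labelMap_submatrix D.degR0 D.degQR D.matG e]
    simp [Function.comp_assoc]
  have hFs : ∀ w, labelMap (D.degQR ∘ e) (D.degPQ ∘ e') (D.matF.submatrix e e') w =
      labelMap D.degQR D.degPQ D.matF (w ∘ e'.symm) ∘ e := by
    intro w
    rw [← labelMap_submatrix D.degQR D.degPQ D.matF e', ← labelMap_submatrix_left]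
    simp [Function.comp_assoc]
  obtain ⟨E, hGE, hEG, hEhom, hEF⟩ := exists_parametrization (dr := D.degR0) he he'
    (G := D.matG.submatrix id e) (fun i j hij => hD.matG_compatible _ _ hij)
    (F := D.matF.submatrix e e') (fun i j hij => hD.matF_compatible _ _ hij)
    (fun w => by
      rw [hGs, hFs, Function.comp_assoc, Equiv.self_comp_symm, Function.comp_id]
      exact hD.matG_matF _) hU hU1 hredG hz hz0 hW hW1 hred
  -- Parametrize `ker G`, undo the sorting, keep the `Q₀`-component and apply `μ`; modulo `im φ`
  -- this is the surjection whose kernel is the product of the bar ideals.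
  let Θ₀ : (Fin h → k[X]) →ₗ[k[X]] LinearMap.ker ψ :=
    LinearMap.codRestrict _ (mu ∘ₗ LinearMap.funLeft k[X] k[X] Sum.inl ∘ₗ
      LinearMap.funLeft k[X] k[X] e.symm ∘ₗ E)
      (fun v => LinearMap.mem_ker.2
        (hD.mem_ker_of_matG (x := E v ∘ e.symm) (by rw [← hGE v, hGs])))
  have hΘ₀ : ∀ v, (Θ₀ v : M) = mu ((E v ∘ e.symm) ∘ Sum.inl) := fun v => rfl
  have hlift : ∀ x, labelMap D.degR0 D.degQR D.matG x = 0 → ∃ v, E v ∘ e.symm = x := by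
    intro x hx
    obtain ⟨v, hv⟩ := hEG (x ∘ e) (by
      rw [hGs, Function.comp_assoc, Equiv.self_comp_symm, Function.comp_id, hx])
    exact ⟨v, by rw [hv, Function.comp_assoc, Equiv.self_comp_symm, Function.comp_id]⟩
  refine isBarcode_of_surjective (homologyDeg degM φ ψ) _
    (((LinearMap.range φ).submoduleOf (LinearMap.ker ψ)).mkQ ∘ₗ Θ₀) ?_ ?_ ?_
  · refine (Submodule.mkQ_surjective _).comp ?_
    rintro ⟨y, hy⟩
    obtain ⟨x, hx, rfl⟩ := hD.exists_lift hy
    obtain ⟨v, rfl⟩ := hlift x hx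
    exact ⟨v, rfl⟩
  · intro v
    rw [LinearMap.comp_apply, Submodule.mkQ_apply, Submodule.Quotient.mk_eq_zero]
    refine Iff.trans ?_ (hEF v)
    change (Θ₀ v : M) ∈ LinearMap.range φ ↔ _
    rw [hΘ₀, hD.mem_range_iff (by rw [← hGE v, hGs])]
    constructor
    · rintro ⟨w, hw⟩
      refine ⟨w ∘ e', ?_⟩
      rw [hFs, Function.comp_assoc, Equiv.self_comp_symm, Function.comp_id, hw,
        Function.comp_assoc, Equiv.symm_comp_self, Function.comp_id]
    · rintro ⟨w, hw⟩
      refine ⟨w ∘ e'.symm, ?_⟩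
      rw [← hw, hFs, Function.comp_assoc, Equiv.self_comp_symm, Function.comp_id]
  · intro i y
    constructor
    · rintro ⟨⟨y, hy⟩, hyi, rfl⟩
      obtain ⟨x, hxi, hx, rfl⟩ := hD.exists_homogeneous_lift hM hyi hy
      obtain ⟨v, rfl⟩ := hlift x hx
      refine ⟨v, ?_, rfl⟩
      refine (hEhom i v).1 ?_
      rw [← comp_mem_homogeneousPart _ e] at hxi
      rwa [Function.comp_assoc, Equiv.symm_comp_self, Function.comp_id] at hxi
    · rintro ⟨v, hv, rfl⟩
      refine ⟨Θ₀ v, ?_, rfl⟩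
      have h1 := (hEhom i v).2 hv
      have h2 : E v ∘ e.symm ∈ homogeneousPart k D.degQR i := by
        rw [← comp_mem_homogeneousPart _ e, Function.comp_assoc, Equiv.symm_comp_self,
          Function.comp_id]
        exact h1
      exact hD.presM.homogeneous i _ fun j _ => h2 (Sum.inl j) (Set.mem_univ _)

end Input.Presents

end Homology

/-! ### Frame conditions and loop invariants for programs -/

section Semantics

/-- The registers that a program writes. -/
def Code.modReg : Code → List NReg
  | setReg x _ => [x]
  | setArr _ _ _ => []
  | setAcc _ => []
  | setMat _ _ _ _ => []
  | seq s₁ s₂ => s₁.modReg ++ s₂.modReg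
  | ifThen _ s => s.modReg
  | ifElse _ s₁ s₂ => s₁.modReg ++ s₂.modReg
  | loop x _ s => x :: s.modReg

/-- The arrays of natural numbers that a program writes. -/
def Code.modArr : Code → List NArr
  | setReg _ _ => []
  | setArr a _ _ => [a]
  | setAcc _ => []
  | setMat _ _ _ _ => []
  | seq s₁ s₂ => s₁.modArr ++ s₂.modArr
  | ifThen _ s => s.modArr
  | ifElse _ s₁ s₂ => s₁.modArr ++ s₂.modArr
  | loop _ _ s => s.modArr

/-- The arrays of scalars that a program writes. -/
def Code.modMat : Code → List SArr
  | setReg _ _ => []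
  | setArr _ _ _ => []
  | setAcc _ => []
  | setMat A _ _ _ => [A]
  | seq s₁ s₂ => s₁.modMat ++ s₂.modMat
  | ifThen _ s => s.modMat
  | ifElse _ s₁ s₂ => s₁.modMat ++ s₂.modMat
  | loop _ _ s => s.modMat

/-- `τ` agrees with `σ` on everything that `c` does not write, except possibly on the scalar
register. -/
structure Frame {k : Type*} (c : Code) (σ τ : Memory k) : Prop where
  reg : ∀ x, x ∉ c.modReg → τ.reg x = σ.reg x
  arr : ∀ a, a ∉ c.modArr → τ.arr a = σ.arr a
  mat : ∀ A, A ∉ c.modMat → τ.mat A = σ.mat A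

variable {k : Type*}

@[simp]
theorem Memory.setReg_reg (σ : Memory k) (x y : NReg) (n : ℕ) :
    (σ.setReg x n).reg y = if y = x then n else σ.reg y := by
  simp [Memory.setReg, Function.update_apply]

@[simp]
theorem Memory.setReg_arr (σ : Memory k) (x : NReg) (n : ℕ) : (σ.setReg x n).arr = σ.arr := rfl

@[simp]
theorem Memory.setReg_mat (σ : Memory k) (x : NReg) (n : ℕ) : (σ.setReg x n).mat = σ.mat := rfl

@[simp]
theorem Memory.setReg_acc (σ : Memory k) (x : NReg) (n : ℕ) : (σ.setReg x n).acc = σ.acc := rfl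

@[simp]
theorem Memory.setArr_reg (σ : Memory k) (a : NArr) (i n : ℕ) : (σ.setArr a i n).reg = σ.reg := rfl

@[simp]
theorem Memory.setArr_arr (σ : Memory k) (a b : NArr) (i n l : ℕ) :
    (σ.setArr a i n).arr b l = if b = a ∧ l = i then n else σ.arr b l := by
  simp only [Memory.setArr, Function.update_apply]
  by_cases h : b = a
  · subst h
    simp [Function.update_apply]
  · simp [h]

@[simp]
theorem Memory.setArr_mat (σ : Memory k) (a : NArr) (i n : ℕ) : (σ.setArr a i n).mat = σ.mat := rfl

@[simp]
theorem Memory.setMat_mat (σ : Memory k) (A B : SArr) (i j r c : ℕ) (u : k) :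
    (σ.setMat A i j u).mat B r c = if B = A ∧ r = i ∧ c = j then u else σ.mat B r c := by
  simp only [Memory.setMat, Function.update_apply]
  by_cases h : B = A
  · subst h
    by_cases h' : r = i
    · subst h'
      simp [Function.update_apply]
    · simp [h']
  · simp [h]

theorem Frame.refl (c : Code) (σ : Memory k) : Frame c σ σ :=
  ⟨fun _ _ => rfl, fun _ _ => rfl, fun _ _ => rfl⟩

theorem Frame.trans {c : Code} {σ τ υ : Memory k} (h₁ : Frame c σ τ) (h₂ : Frame c τ υ) :
    Frame c σ υ :=
  ⟨fun x hx => (h₂.reg x hx).trans (h₁.reg x hx), fun x hx => (h₂.arr x hx).trans (h₁.arr x hx),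
    fun x hx => (h₂.mat x hx).trans (h₁.mat x hx)⟩

theorem Frame.mono {c c' : Code} {σ τ : Memory k} (h : Frame c σ τ)
    (hr : c.modReg ⊆ c'.modReg) (ha : c.modArr ⊆ c'.modArr) (hm : c.modMat ⊆ c'.modMat) :
    Frame c' σ τ :=
  ⟨fun x hx => h.reg x fun h' => hx (hr h'), fun x hx => h.arr x fun h' => hx (ha h'),
    fun x hx => h.mat x fun h' => hx (hm h')⟩

theorem iter_invariant {α : Type*} {f : ℕ → α → α} (P : ℕ → α → Prop) {n : ℕ} {a : α} (h0 : P 0 a)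
    (hs : ∀ i < n, ∀ b, P i b → P (i + 1) (f i b)) : P n (iter f n a) := by
  induction n with
  | zero => exact h0
  | succ n ih => exact hs n n.lt_succ_self _ (ih fun i hi => hs i (hi.trans n.lt_succ_self))

theorem frame_setReg_loop (x : NReg) (e : NExp) (s : Code) (σ : Memory k) (i : ℕ) :
    Frame (.loop x e s) σ (σ.setReg x i) := by
  refine ⟨fun y hy => ?_, fun _ _ => rfl, fun _ _ => rfl⟩
  simp only [Code.modReg, List.mem_cons, not_or] at hy
  simp [hy.1]

variable [Field k] [DecidableEq k]

/-- What a program may overwrite is determined by its syntax. Preservation of all other data thereby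
reduces to membership in explicit finite lists, which `decide` or `simp` settles. -/
theorem frame_exec (c : Code) (σ : Memory k) : Frame c σ (c.exec σ) := by
  induction c generalizing σ with
  | setReg x e =>
    refine ⟨fun y hy => ?_, fun _ _ => rfl, fun _ _ => rfl⟩
    simp only [Code.modReg, List.mem_singleton] at hy
    simp [Code.exec, hy]
  | setArr a e₁ e₂ =>
    refine ⟨fun _ _ => rfl, fun b hb => ?_, fun _ _ => rfl⟩
    simp only [Code.modArr, List.mem_singleton] at hb
    funext l
    simp [Code.exec, hb]
  | setAcc u => exact ⟨fun _ _ => rfl, fun _ _ => rfl, fun _ _ => rfl⟩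
  | setMat A e₁ e₂ u =>
    refine ⟨fun _ _ => rfl, fun _ _ => rfl, fun B hB => ?_⟩
    simp only [Code.modMat, List.mem_singleton] at hB
    funext r c
    simp [Code.exec, hB]
  | seq s₁ s₂ ih₁ ih₂ =>
    refine Frame.trans (τ := s₁.exec σ) ((ih₁ σ).mono ?_ ?_ ?_)
      ((ih₂ (s₁.exec σ)).mono ?_ ?_ ?_) <;>
    simp [Code.modReg, Code.modArr, Code.modMat]
  | ifThen b s ih =>
    simp only [Code.exec]
    split_ifs
    · exact (ih σ).mono (List.Subset.refl _) (List.Subset.refl _) (List.Subset.refl _)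
    · exact Frame.refl _ _
  | ifElse b s₁ s₂ ih₁ ih₂ =>
    simp only [Code.exec]
    split_ifs
    · exact (ih₁ σ).mono (by simp [Code.modReg]) (by simp [Code.modArr]) (by simp [Code.modMat])
    · exact (ih₂ σ).mono (by simp [Code.modReg]) (by simp [Code.modArr]) (by simp [Code.modMat])
  | loop x e s ih =>
    refine iter_invariant (fun _ τ => Frame (.loop x e s) σ τ) (Frame.refl _ _) ?_
    intro i _ τ hτ
    exact hτ.trans ((frame_setReg_loop x e s τ i).trans
      ((ih _).mono (by simp [Code.modReg]) (List.Subset.refl _) (List.Subset.refl _)))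

theorem frame_loop_body (x : NReg) (e : NExp) (s : Code) (τ : Memory k) (i : ℕ) :
    Frame (.loop x e s) τ (s.exec (τ.setReg x i)) :=
  (frame_setReg_loop x e s τ i).trans
    ((frame_exec s _).mono (by simp [Code.modReg]) (List.Subset.refl _) (List.Subset.refl _))

/-- Loop invariants; the frame condition comes for free. -/
theorem exec_loop_invariant {x : NReg} {e : NExp} {s : Code} {σ : Memory k}
    (P : ℕ → Memory k → Prop) (h0 : P 0 σ)
    (hs : ∀ i < e.eval σ, ∀ τ, Frame (.loop x e s) σ τ → P i τ →
      P (i + 1) (s.exec (τ.setReg x i))) :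
    P (e.eval σ) ((Code.loop x e s).exec σ) := by
  refine (iter_invariant (fun i τ => Frame (.loop x e s) σ τ ∧ P i τ) ⟨Frame.refl _ _, h0⟩ ?_).2
  rintro i hi τ ⟨hτ, hP⟩
  exact ⟨hτ.trans (frame_loop_body x e s τ i), hs i hi τ hτ hP⟩

/-- A loop that establishes `Q i` in iteration `i` and keeps it in later iterations. -/
theorem exec_loop_forall {x : NReg} {e : NExp} {s : Code} {σ : Memory k}
    (Q : ℕ → Memory k → Prop)
    (hself : ∀ i < e.eval σ, ∀ τ, Frame (.loop x e s) σ τ → Q i (s.exec (τ.setReg x i)))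
    (hkeep : ∀ i < e.eval σ, ∀ l < i, ∀ τ, Frame (.loop x e s) σ τ → Q l τ →
      Q l (s.exec (τ.setReg x i))) :
    ∀ l < e.eval σ, Q l ((Code.loop x e s).exec σ) := by
  refine exec_loop_invariant (fun i τ => ∀ l < i, Q l τ) (by simp) ?_
  intro i hi τ hτ hQ l hl
  rcases Nat.lt_succ_iff_lt_or_eq.1 hl with hl | rfl
  · exact hkeep i hi l hl τ hτ (hQ l hl)
  · exact hself l hi τ hτ

/-- A loop that fills part of a two-dimensional array from data that it does not change. -/
theorem exec_fill {x : NReg} {e : NExp} {A : SArr} {e₁ e₂ : NExp} {u : SExp} {σ : Memory k}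
    (a₁ a₂ : ℕ → ℕ) (w : ℕ → k)
    (h : ∀ i < e.eval σ, ∀ τ, τ.reg x = i → Frame (.loop x e (.setMat A e₁ e₂ u)) σ τ →
      e₁.eval τ = a₁ i ∧ e₂.eval τ = a₂ i ∧ u.eval τ = w i)
    (hinj : ∀ i i', a₁ i = a₁ i' → a₂ i = a₂ i' → i = i') :
    (∀ i < e.eval σ,
      ((Code.loop x e (.setMat A e₁ e₂ u)).exec σ).mat A (a₁ i) (a₂ i) = w i) ∧
    ∀ r c, (∀ i < e.eval σ, a₁ i = r → a₂ i ≠ c) →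
      ((Code.loop x e (.setMat A e₁ e₂ u)).exec σ).mat A r c = σ.mat A r c := by
  have key : ∀ i < e.eval σ, ∀ τ, Frame (.loop x e (.setMat A e₁ e₂ u)) σ τ → ∀ r c,
      ((Code.setMat A e₁ e₂ u).exec (τ.setReg x i)).mat A r c =
        if r = a₁ i ∧ c = a₂ i then w i else τ.mat A r c := by
    intro i hi τ hτ r c
    obtain ⟨h1, h2, h3⟩ := h i hi (τ.setReg x i) (by simp)
      (hτ.trans (frame_setReg_loop x e _ τ i))
    simp [Code.exec, h1, h2, h3]
  constructor
  · refine exec_loop_forall (fun i τ => τ.mat A (a₁ i) (a₂ i) = w i) ?_ ?_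
    · intro i hi τ hτ
      rw [key i hi τ hτ, if_pos ⟨rfl, rfl⟩]
    · intro i hi l hl τ hτ hQ
      rw [key i hi τ hτ, if_neg, hQ]
      rintro ⟨h1, h2⟩
      exact hl.ne (hinj _ _ h1 h2)
  · intro r c hrc
    refine exec_loop_invariant (fun _ τ => τ.mat A r c = σ.mat A r c) rfl ?_
    intro i hi τ hτ hQ
    rw [key i hi τ hτ, if_neg, hQ]
    rintro ⟨h1, h2⟩
    exact hrc i hi h1.symm h2.symm

/-- A loop that fills the columns of a two-dimensional array, and the entries of an array, from
data that it does not change. -/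
theorem exec_columns {x : NReg} {e : NExp} {s : Code} {σ : Memory k} (a : NArr) (A : SArr)
    (off R : ℕ) (v : ℕ → ℕ) (w : ℕ → ℕ → k)
    (h : ∀ j < e.eval σ, ∀ τ, Frame (.loop x e s) σ τ →
      (s.exec (τ.setReg x j)).arr a (off + j) = v j ∧
      (∀ l, l ≠ off + j → (s.exec (τ.setReg x j)).arr a l = τ.arr a l) ∧
      (∀ i < R, (s.exec (τ.setReg x j)).mat A i (off + j) = w i j) ∧
      ∀ i l, l ≠ off + j → (s.exec (τ.setReg x j)).mat A i l = τ.mat A i l) :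
    (∀ j < e.eval σ, ((Code.loop x e s).exec σ).arr a (off + j) = v j ∧
      ∀ i < R, ((Code.loop x e s).exec σ).mat A i (off + j) = w i j) ∧
    ∀ l, (∀ j < e.eval σ, l ≠ off + j) →
      ((Code.loop x e s).exec σ).arr a l = σ.arr a l ∧
      ∀ i, ((Code.loop x e s).exec σ).mat A i l = σ.mat A i l := by
  constructor
  · refine exec_loop_forall
      (fun j τ => τ.arr a (off + j) = v j ∧ ∀ i < R, τ.mat A i (off + j) = w i j) ?_ ?_
    · intro j hj τ hτ
      obtain ⟨h1, -, h3, -⟩ := h j hj τ hτ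
      exact ⟨h1, h3⟩
    · intro j hj l hl τ hτ hQ
      obtain ⟨-, h2, -, h4⟩ := h j hj τ hτ
      exact ⟨by rw [h2 _ (by omega), hQ.1], fun i hi => by rw [h4 _ _ (by omega), hQ.2 i hi]⟩
  · intro l hl
    refine exec_loop_invariant
      (fun _ τ => τ.arr a l = σ.arr a l ∧ ∀ i, τ.mat A i l = σ.mat A i l) ⟨rfl, fun _ => rfl⟩ ?_
    intro j hj τ hτ hQ
    obtain ⟨-, h2, -, h4⟩ := h j hj τ hτ
    exact ⟨by rw [h2 _ (hl j hj), hQ.1], fun i => by rw [h4 _ _ (hl j hj), hQ.2 i]⟩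

end Semantics

/-! ### A syntactic bound for the number of steps -/

section Steps

/-- Every loop of the program runs as often as a register of `S` says. -/
def Code.LoopsIn (S : List NReg) : Code → Prop
  | setReg _ _ => True
  | setArr _ _ _ => True
  | setAcc _ => True
  | setMat _ _ _ _ => True
  | seq s₁ s₂ => s₁.LoopsIn S ∧ s₂.LoopsIn S
  | ifThen _ s => s.LoopsIn S
  | ifElse _ s₁ s₂ => s₁.LoopsIn S ∧ s₂.LoopsIn S
  | loop _ e s => (∃ y ∈ S, e = .reg y) ∧ s.LoopsIn S

/-- Bound for the number of steps of a program whose loops run at most `B` times. -/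
def Code.bound (B : ℕ) : Code → ℕ
  | setReg _ e => e.cost + 1
  | setArr _ e₁ e₂ => e₁.cost + e₂.cost + 1
  | setAcc u => u.cost + 1
  | setMat _ e₁ e₂ u => e₁.cost + e₂.cost + u.cost + 1
  | seq s₁ s₂ => s₁.bound B + s₂.bound B
  | ifThen b s => b.cost + 1 + s.bound B
  | ifElse b s₁ s₂ => b.cost + 1 + (s₁.bound B + s₂.bound B)
  | loop _ e s => e.cost + 1 + B * (s.bound B + 1)

/-- The registers in `S` that control the loops are never written by `c`, so they stay at most `B`
during the whole run and every loop runs at most `B` times. For a branching, the bound counts both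
branches. -/
theorem Code.steps_le_bound {k : Type*} [Field k] [DecidableEq k] (S : List NReg) (B : ℕ)
    (c : Code) (hc : c.LoopsIn S) (hS : ∀ y ∈ S, y ∉ c.modReg) (σ : Memory k)
    (hB : ∀ y ∈ S, σ.reg y ≤ B) : c.steps σ ≤ c.bound B := by
  induction c generalizing σ with
  | setReg x e => exact le_rfl
  | setArr a e₁ e₂ => exact le_rfl
  | setAcc u => exact le_rfl
  | setMat A e₁ e₂ u => exact le_rfl
  | seq s₁ s₂ ih₁ ih₂ =>
    simp only [Code.modReg, List.mem_append, not_or] at hS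
    refine Nat.add_le_add (ih₁ hc.1 (fun y hy => (hS y hy).1) σ hB)
      (ih₂ hc.2 (fun y hy => (hS y hy).2) _ fun y hy => ?_)
    rw [(frame_exec s₁ σ).reg y (hS y hy).1]
    exact hB y hy
  | ifThen b s ih =>
    refine Nat.add_le_add_left ?_ _
    split_ifs
    · exact ih hc hS σ hB
    · exact Nat.zero_le _
  | ifElse b s₁ s₂ ih₁ ih₂ =>
    simp only [Code.modReg, List.mem_append, not_or] at hS
    refine Nat.add_le_add_left ?_ _
    split_ifs
    · exact (ih₁ hc.1 (fun y hy => (hS y hy).1) σ hB).trans (Nat.le_add_right _ _)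
    · exact (ih₂ hc.2 (fun y hy => (hS y hy).2) σ hB).trans (Nat.le_add_left _ _)
  | loop x e s ih =>
    obtain ⟨⟨z, hz, rfl⟩, hs⟩ := hc
    refine Nat.add_le_add_left ?_ _
    refine le_trans (Finset.sum_le_card_nsmul _ _ (s.bound B + 1) fun n _ => ?_) ?_
    · refine Nat.add_le_add_right (ih hs (fun y hy h' => hS y hy ?_) _ fun y hy => ?_) _
      · simp [Code.modReg, h']
      · have hyx : y ≠ x := by
          rintro rfl
          exact hS y hy (by simp [Code.modReg])
        have : Frame (.loop x (.reg z) s) σ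
            (iter (fun i τ => s.exec (τ.setReg x i)) n σ) :=
          iter_invariant (fun _ τ => Frame (.loop x (.reg z) s) σ τ) (Frame.refl _ _)
            fun i _ τ hτ => hτ.trans (frame_loop_body x _ s τ i)
        simp only [Memory.setReg_reg, if_neg hyx]
        rw [this.reg y (hS y hy)]
        exact hB y hy
    · rw [Finset.card_range, smul_eq_mul]
      exact Nat.mul_le_mul_right _ (hB z hz)

end Steps

/-! ### Stable sorting by counting predecessors -/

section Sorting

/-- Number of indices below `n` that come before `j` in the order by values (ties by index). -/
def rankOf (n : ℕ) (v : ℕ → ℕ) (j : ℕ) : ℕ :=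
  ((Finset.range n).filter fun i => v i < v j ∨ (v i = v j ∧ i < j)).card

/-- The comparison is lexicographic in value and index, hence a strict linear order: predecessors of
`i` are predecessors of `j`, and `i` precedes `j` but not itself. -/
theorem rankOf_lt_rankOf {n : ℕ} {v : ℕ → ℕ} {i j : ℕ} (hi : i < n)
    (hij : v i < v j ∨ (v i = v j ∧ i < j)) : rankOf n v i < rankOf n v j := by
  refine Finset.card_lt_card ⟨fun l hl => ?_, fun h => ?_⟩
  · simp only [Finset.mem_filter] at hl ⊢
    exact ⟨hl.1, by omega⟩
  · have := h (Finset.mem_filter.2 ⟨Finset.mem_range.2 hi, hij⟩)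
    simp at this

theorem rankOf_lt {n : ℕ} {v : ℕ → ℕ} {j : ℕ} (hj : j < n) : rankOf n v j < n := by
  calc rankOf n v j < (Finset.range n).card := by
        refine Finset.card_lt_card ⟨Finset.filter_subset _ _, fun h => ?_⟩
        have := h (Finset.mem_range.2 hj)
        simp at this
    _ = n := Finset.card_range n

theorem rankOf_injOn {n : ℕ} {v : ℕ → ℕ} {i j : ℕ} (hi : i < n) (hj : j < n)
    (h : rankOf n v i = rankOf n v j) : i = j := by
  by_contra hne
  rcases (by omega : (v i < v j ∨ (v i = v j ∧ i < j)) ∨ (v j < v i ∨ (v j = v i ∧ j < i)))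
    with h' | h'
  · exact (rankOf_lt_rankOf hi h').ne h
  · exact (rankOf_lt_rankOf hj h').ne' h

/-- The rank is injective on a finite set, hence a bijection onto positions; its inverse lists the
indices in increasing order. -/
theorem exists_sorting_perm (n : ℕ) (v : ℕ → ℕ) :
    ∃ e : Equiv.Perm (Fin n), Monotone (fun s => v (e s)) ∧
      ∀ s, rankOf n v (e s) = (s : ℕ) := by
  let f : Fin n → Fin n := fun j => ⟨rankOf n v j, rankOf_lt j.2⟩
  have hf : Function.Injective f := fun i j hij =>
    Fin.ext (rankOf_injOn i.2 j.2 (congrArg Fin.val hij))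
  let E := Equiv.ofBijective f (Finite.injective_iff_bijective.1 hf)
  have hE : ∀ s, rankOf n v (E.symm s) = (s : ℕ) := fun s =>
    congrArg Fin.val (E.apply_symm_apply s)
  refine ⟨E.symm, fun s s' hs => ?_, hE⟩
  by_contra hlt
  have := rankOf_lt_rankOf (n := n) (v := v) (E.symm s').2 (Or.inl (not_le.1 hlt))
  rw [hE, hE] at this
  exact absurd hs (not_le.2 this)

variable {k : Type*} [Field k] [DecidableEq k]

theorem exec_sortBy {n : NReg} {deg ord : NArr} {σ : Memory k} (hn : n ∉ [NReg.i, .j, .s])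
    (hne : deg ≠ ord) :
    ∀ j < σ.reg n, ((sortBy n deg ord).exec σ).arr ord (rankOf (σ.reg n) (σ.arr deg) j) = j := by
  simp only [List.mem_cons, List.not_mem_nil, or_false, not_or] at hn
  obtain ⟨hni, hnj, hns⟩ := hn
  have key : ∀ j, ∀ τ, Frame (sortBy n deg ord) σ τ → ∀ s,
      s = (Code.seq (.setReg .s (.lit 0)) (.seq (.loop .i (.reg n) (.ifThen
        (.or (.lt (.get deg (.reg .i)) (.get deg (.reg .j)))
          (.and (.eq (.get deg (.reg .i)) (.get deg (.reg .j))) (.lt (.reg .i) (.reg .j))))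
        (.setReg .s (.add (.reg .s) (.lit 1))))) (.setArr ord (.reg .s) (.reg .j)))).exec
          (τ.setReg .j j) →
      ∀ l, s.arr ord l = if l = rankOf (σ.reg n) (σ.arr deg) j then j else τ.arr ord l := by
    intro j τ hτ s hs l
    have hτn : τ.reg n = σ.reg n := hτ.reg n (by
      simp [sortBy, Code.modReg, hni, hnj, hns])
    have hτd : τ.arr deg = σ.arr deg := hτ.arr deg (by
      simp [sortBy, Code.modArr, hne])
    set τ₁ : Memory k := (τ.setReg .j j).setReg .s 0 with hτ₁
    have h1 : ((Code.loop .i (.reg n) (.ifThen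
        (.or (.lt (.get deg (.reg .i)) (.get deg (.reg .j)))
          (.and (.eq (.get deg (.reg .i)) (.get deg (.reg .j))) (.lt (.reg .i) (.reg .j))))
        (.setReg .s (.add (.reg .s) (.lit 1))))).exec τ₁).reg .s =
          rankOf ((NExp.reg n).eval τ₁) (σ.arr deg) j := by
      -- After `t` iterations the counter is the rank among the first `t` indices only, so the bound
      -- in `rankOf` serves as the loop variable.
      refine exec_loop_invariant (fun t υ => υ.reg .s = rankOf t (σ.arr deg) j)
        (by simp [hτ₁, rankOf]) ?_
      intro t ht υ hυ hυs
      have hj : υ.reg .j = j := by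
        rw [hυ.reg .j (by simp [Code.modReg]), hτ₁]
        simp
      have hd : υ.arr deg = σ.arr deg := by
        rw [hυ.arr deg (by simp [Code.modArr]), hτ₁, ← hτd]
        rfl
      simp only [Code.exec, Test.eval, NExp.eval, Memory.setReg_reg, Memory.setReg_arr, if_true,
        hd, reduceCtorEq, if_false, hj]
      rw [rankOf, Finset.range_add_one, Finset.filter_insert]
      simp only [Bool.or_eq_true, decide_eq_true_eq, Bool.and_eq_true]
      split_ifs with hc
      · rw [Finset.card_insert_of_notMem (by simp)]
        simp [hυs, rankOf]
      · simp [hυs, rankOf]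
    have h2 : (NExp.reg n).eval τ₁ = σ.reg n := by
      simp [hτ₁, NExp.eval, hnj, hns, hτn]
    rw [h2] at h1
    have h3 := frame_exec (Code.loop .i (.reg n) (.ifThen
        (.or (.lt (.get deg (.reg .i)) (.get deg (.reg .j)))
          (.and (.eq (.get deg (.reg .i)) (.get deg (.reg .j))) (.lt (.reg .i) (.reg .j))))
        (.setReg .s (.add (.reg .s) (.lit 1))))) τ₁
    have h4 := h3.reg .j (by simp [Code.modReg])
    have h5 := h3.arr ord (by simp [Code.modArr])
    rw [hs, Code.exec, Code.exec, Code.exec, Code.exec]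
    simp only [NExp.eval, Memory.setArr_arr, true_and]
    rw [← hτ₁, h1, h4, h5, hτ₁]
    simp
  unfold sortBy at key ⊢
  change ∀ j < (NExp.reg n).eval σ, _
  refine exec_loop_forall
    (fun j (τ : Memory k) => τ.arr ord (rankOf (σ.reg n) (σ.arr deg) j) = j) ?_ ?_
  · intro j hj τ hτ
    rw [key j τ hτ _ rfl, if_pos rfl]
  · intro j hj l hl τ hτ hQ
    rw [key j τ hτ _ rfl, if_neg, hQ]
    -- Distinct indices have distinct ranks, so a later iteration does not overwrite this position.
    exact fun h => hl.ne (rankOf_injOn (hl.trans hj) hj h)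

end Sorting

/-! ### Correctness of the column reduction -/

section ColumnReduction

variable {k : Type*}

/-- The upper left `m × n` block of a two-dimensional array. -/
def Memory.block (σ : Memory k) (A : SArr) (m n : ℕ) : Matrix (Fin m) (Fin n) k :=
  Matrix.of fun i j => σ.mat A i j

/-- The body of the inner loop of a column reduction. -/
def reduceStep (A : SArr) (rows : NReg) (piv nz : NArr) : Code :=
  .seq (.setReg .i (.sub (.sub (.reg rows) (.lit 1)) (.reg .t)))
    (.ifThen
      (.and (.eq (.get nz (.reg .j)) (.lit 0)) (.not (.isZero (.get A (.reg .i) (.reg .j)))))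
      (.ifElse (.eq (.get piv (.reg .i)) (.lit 0))
        (.seq (.setArr piv (.reg .i) (.add (.reg .j) (.lit 1)))
          (.setArr nz (.reg .j) (.lit 1)))
        (.seq (.setReg .l (.sub (.get piv (.reg .i)) (.lit 1)))
          (.seq (.setAcc (.div (.get A (.reg .i) (.reg .j)) (.get A (.reg .i) (.reg .l))))
            (.loop .s (.reg rows)
              (.setMat A (.reg .s) (.reg .j)
                (.sub (.get A (.reg .s) (.reg .j))
                  (.mul .acc (.get A (.reg .s) (.reg .l))))))))))

variable [Field k]

/-- State of a column reduction of a matrix `M₀`: the first `j` columns are finished, and column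
`j` is clear in its lowest `t` rows unless its pivot has been found. -/
structure ReduceInv (A : SArr) (piv nz : NArr) {m n : ℕ} (M₀ : Matrix (Fin m) (Fin n) k)
    (j t : ℕ) (τ : Memory k) : Prop where
  exists_factor : ∃ U : Matrix (Fin n) (Fin n) k, U.BlockTriangular id ∧ (∀ i, U i i = 1) ∧
    τ.block A m n = M₀ * U
  pivot : ∀ i < m, τ.arr piv i = 0 ∨ ∃ l, τ.arr piv i = l + 1 ∧
    (l < j ∨ (l = j ∧ τ.arr nz j = 1)) ∧ τ.mat A i l ≠ 0 ∧
      ∀ i', i < i' → i' < m → τ.mat A i' l = 0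
  done : ∀ l < j, (τ.arr nz l = 0 ∧ ∀ i < m, τ.mat A i l = 0) ∨
    (τ.arr nz l = 1 ∧ ∃ i < m, τ.arr piv i = l + 1)
  current : (τ.arr nz j = 0 ∧ ∀ i < m, m - t ≤ i → τ.mat A i j = 0) ∨
    (τ.arr nz j = 1 ∧ ∃ i < m, τ.arr piv i = j + 1)

theorem ReduceInv.congr {A : SArr} {piv nz : NArr} {m n : ℕ} {M₀ : Matrix (Fin m) (Fin n) k}
    {j t : ℕ} {σ τ : Memory k} (h : ReduceInv A piv nz M₀ j t σ) (hA : τ.mat A = σ.mat A)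
    (hp : τ.arr piv = σ.arr piv) (hz : τ.arr nz = σ.arr nz) : ReduceInv A piv nz M₀ j t τ := by
  obtain ⟨h1, h2, h3, h4⟩ := h
  refine ⟨?_, by rwa [hA, hp, hz], by rwa [hA, hp, hz], by rwa [hA, hp, hz]⟩
  simpa only [Memory.block, hA] using h1

/-- A column operation is right multiplication by a transvection; this is how the invariant
accumulates the factor `U`. -/
theorem block_eq_mul_transvection {A : SArr} {m n : ℕ} {σ τ : Memory k} {j l : Fin n} (x : k)
    (h : ∀ r < m, ∀ c, τ.mat A r c =
      if c = (j : ℕ) then σ.mat A r c - x * σ.mat A r l else σ.mat A r c) :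
    τ.block A m n = σ.block A m n * Matrix.transvection l j (-x) := by
  ext r c
  by_cases hc : c = j
  · subst hc
    rw [Matrix.mul_transvection_apply_same]
    simp only [Memory.block, Matrix.of_apply]
    rw [h r r.2, if_pos rfl]
    ring
  · rw [Matrix.mul_transvection_apply_of_ne _ _ _ _ hc]
    simp only [Memory.block, Matrix.of_apply]
    rw [h r r.2, if_neg fun h' => hc (Fin.ext h')]

variable [DecidableEq k]

/-- As `j ≠ l`, column `l` is not altered while column `j` is overwritten, and each row of column
`j` is read before it is written. -/
theorem exec_subtractColumn {A : SArr} {rows : NReg} {σ : Memory k}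
    (hjl : σ.reg .j ≠ σ.reg .l) (r c : ℕ) :
    ((Code.loop .s (.reg rows) (.setMat A (.reg .s) (.reg .j)
      (.sub (.get A (.reg .s) (.reg .j)) (.mul .acc (.get A (.reg .s) (.reg .l)))))).exec
        σ).mat A r c =
      if c = σ.reg .j ∧ r < σ.reg rows then σ.mat A r c - σ.acc * σ.mat A r (σ.reg .l)
      else σ.mat A r c := by
  refine (exec_loop_invariant (fun t τ => τ.acc = σ.acc ∧ ∀ r c, τ.mat A r c =
    if c = σ.reg .j ∧ r < t then σ.mat A r c - σ.acc * σ.mat A r (σ.reg .l)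
    else σ.mat A r c) ⟨rfl, by simp⟩ ?_).2 r c
  rintro t ht τ hτ ⟨hacc, hQ⟩
  have hj : τ.reg .j = σ.reg .j := hτ.reg _ (by simp [Code.modReg])
  have hl : τ.reg .l = σ.reg .l := hτ.reg _ (by simp [Code.modReg])
  refine ⟨hacc, fun r c => ?_⟩
  simp only [Code.exec, NExp.eval, SExp.eval, Memory.setMat_mat, Memory.setReg_reg, reduceCtorEq,
    if_false, if_true, true_and, hj, hl, Memory.setReg_mat, Memory.setReg_acc, hacc, hQ]
  by_cases hc : c = σ.reg .j
  · subst hc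
    rcases lt_trichotomy r t with h | h | h
    · simp [h, h.ne, h.trans (Nat.lt_succ_self t)]
    · simp [h, hjl.symm]
    · have : ¬ r < t + 1 := by omega
      simp [h.ne', this, h.not_gt]
  · simp [hc]

/-- Iteration `t` inspects row `m - 1 - t`. A zero entry, or a pivot already found, requires
nothing; an entry in a row without pivot becomes the pivot of column `j`. Otherwise an earlier
column `l` with this pivot row is subtracted, and since column `l` vanishes below its pivot, the
rows cleared so far stay clear. -/
theorem ReduceInv.step {A : SArr} {rows : NReg} {piv nz : NArr} {m n : ℕ}
    {M₀ : Matrix (Fin m) (Fin n) k} {j t : ℕ} {τ : Memory k}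
    (hinv : ReduceInv A piv nz M₀ j t τ) (hpz : piv ≠ nz) (hrows : rows ∉ [NReg.i, .l, .s, .t])
    (hm : τ.reg rows = m) (hj : τ.reg .j = j) (hjn : j < n) (ht : t < m) :
    ReduceInv A piv nz M₀ j (t + 1) ((reduceStep A rows piv nz).exec (τ.setReg .t t)) := by
  simp only [List.mem_cons, List.not_mem_nil, or_false, not_or] at hrows
  obtain ⟨hri, hrl, hrs, hrt⟩ := hrows
  set τ₁ : Memory k := (τ.setReg .t t).setReg .i (m - 1 - t) with hτ₁
  have hinv₁ : ReduceInv A piv nz M₀ j t τ₁ := hinv.congr rfl rfl rfl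
  have hj₁ : τ₁.reg .j = j := by simp [hτ₁, hj]
  have hi₁ : τ₁.reg .i = m - 1 - t := by simp [hτ₁]
  have hm₁ : τ₁.reg rows = m := by simp [hτ₁, hri, hrt, hm]
  rw [reduceStep, Code.exec, Code.exec,
    show (NExp.sub (NExp.sub (NExp.reg rows) (NExp.lit 1)) (NExp.reg NReg.t)).eval
      (τ.setReg .t t) = m - 1 - t by simp [NExp.eval, hrt, hm], ← hτ₁]
  clear_value τ₁
  clear hτ₁ hinv hm hj τ
  obtain ⟨i, hi⟩ : ∃ i, i = m - 1 - t := ⟨_, rfl⟩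
  rw [← hi] at hi₁
  have him : i < m := by omega
  obtain ⟨⟨U, hU, hU1, hblock⟩, hpivot, hdone, hcur⟩ := hinv₁
  rw [Code.exec]
  simp only [Test.eval, NExp.eval, SExp.eval, hj₁, hi₁, Bool.and_eq_true, decide_eq_true_eq,
    Bool.not_eq_true', decide_eq_false_iff_not]
  split_ifs with hc
  swap
  · refine ⟨⟨U, hU, hU1, hblock⟩, hpivot, hdone, ?_⟩
    rcases hcur with ⟨h1, h2⟩ | h
    · refine Or.inl ⟨h1, fun i' hi' hi'' => ?_⟩
      rcases (by omega : i' = i ∨ m - t ≤ i') with rfl | h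
      · by_contra h
        exact hc ⟨h1, h⟩
      · exact h2 i' hi' h
    · exact Or.inr h
  obtain ⟨hnz, hne⟩ := hc
  have hcur' : ∀ i' < m, m - t ≤ i' → τ₁.mat A i' j = 0 := by
    rcases hcur with h | h
    · exact h.2
    · omega
  -- The flag of column `j` is still `0`, so every recorded pivot belongs to a strictly earlier
  -- column.
  have hpivot' : ∀ i < m, τ₁.arr piv i = 0 ∨ ∃ l, τ₁.arr piv i = l + 1 ∧
      l < j ∧ τ₁.mat A i l ≠ 0 ∧ ∀ i', i < i' → i' < m → τ₁.mat A i' l = 0 := by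
    intro i' hi'
    rcases hpivot i' hi' with h | ⟨l, h1, h2, h3⟩
    · exact Or.inl h
    · exact Or.inr ⟨l, h1, by omega, h3⟩
  rw [Code.exec]
  simp only [Test.eval, NExp.eval, hi₁, decide_eq_true_eq]
  split_ifs with hp
  · simp only [Code.exec, NExp.eval, hi₁, hj₁, Memory.setArr_reg]
    have hP : ∀ l, ((τ₁.setArr piv i (j + 1)).setArr nz j 1).arr piv l =
        if l = i then j + 1 else τ₁.arr piv l := by
      intro l
      simp [hpz]
    have hZ : ∀ l, ((τ₁.setArr piv i (j + 1)).setArr nz j 1).arr nz l =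
        if l = j then 1 else τ₁.arr nz l := by
      intro l
      simp [hpz.symm]
    refine ⟨⟨U, hU, hU1, hblock⟩, fun i' hi' => ?_, fun l hl => ?_, Or.inr ⟨?_, i, him, ?_⟩⟩
    · rw [hP, hZ, if_pos rfl]
      simp only [Memory.setArr_mat]
      by_cases h : i' = i
      · subst h
        rw [if_pos rfl]
        exact Or.inr ⟨j, rfl, Or.inr ⟨rfl, trivial⟩, hne,
          fun i'' h1 h2 => hcur' i'' h2 (by omega)⟩
      · rw [if_neg h]
        rcases hpivot' i' hi' with h | ⟨l, h1, h2, h3⟩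
        · exact Or.inl h
        · exact Or.inr ⟨l, h1, Or.inl h2, h3⟩
    · rw [hZ, if_neg hl.ne]
      rcases hdone l hl with h | ⟨h1, i', h2, h3⟩
      · exact Or.inl h
      · refine Or.inr ⟨h1, i', h2, ?_⟩
        rw [hP, if_neg, h3]
        rintro rfl
        omega
    · rw [hZ, if_pos rfl]
    · rw [hP, if_pos rfl]
  · obtain ⟨l, hpl, hlj, hnel, hlow⟩ := (hpivot' i him).resolve_left hp
    rw [Code.exec, Code.exec, Code.exec, Code.exec]
    simp only [NExp.eval, SExp.eval, hi₁, hpl, Memory.setReg_reg, if_true, reduceCtorEq, if_false,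
      hj₁, Nat.add_sub_cancel, Memory.setReg_mat]
    set x := τ₁.mat A i j / τ₁.mat A i l with hx
    let τ₂ : Memory k := ⟨(τ₁.setReg .l l).reg, τ₁.arr, x, τ₁.mat⟩
    change ReduceInv A piv nz M₀ j (t + 1) ((Code.loop .s (.reg rows) (.setMat A (.reg .s) (.reg .j)
      (.sub (.get A (.reg .s) (.reg .j)) (.mul .acc (.get A (.reg .s) (.reg .l)))))).exec τ₂)
    have hr₂ : ∀ y, τ₂.reg y = if y = NReg.l then l else τ₁.reg y := fun y => by simp [τ₂]
    have hA := exec_subtractColumn (A := A) (rows := rows) (σ := τ₂)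
      (by simp [hr₂, hj₁, hlj.ne'])
    have hF := frame_exec (Code.loop .s (.reg rows) (.setMat A (.reg .s) (.reg .j)
      (.sub (.get A (.reg .s) (.reg .j)) (.mul .acc (.get A (.reg .s) (.reg .l)))))) τ₂
    have hmat : ∀ r < m, ∀ c, ((Code.loop .s (.reg rows) (.setMat A (.reg .s) (.reg .j)
        (.sub (.get A (.reg .s) (.reg .j)) (.mul .acc (.get A (.reg .s) (.reg .l)))))).exec
        τ₂).mat A r c =
          if c = j then τ₁.mat A r c - x * τ₁.mat A r l else τ₁.mat A r c := by
      intro r hr c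
      rw [hA]
      simp [hj₁, hrl, hm₁, hr, τ₂]
    have harr := fun a => hF.arr a (by simp [Code.modArr])
    have hτarr : ∀ a, τ₂.arr a = τ₁.arr a := fun a => rfl
    clear hA hF hr₂
    generalize (Code.loop .s (.reg rows) (.setMat A (.reg .s) (.reg .j)
      (.sub (.get A (.reg .s) (.reg .j)) (.mul .acc (.get A (.reg .s) (.reg .l)))))).exec
        τ₂ = υ at *
    simp only [hτarr] at harr
    -- Since `l < j`, the transvection is upper unitriangular, so the new factor remains so.
    refine ⟨⟨U * Matrix.transvection ⟨l, hlj.trans hjn⟩ ⟨j, hjn⟩ (-x), ?_, ?_, ?_⟩, ?_, ?_,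
      Or.inl ⟨?_, ?_⟩⟩
    · exact hU.mul (Matrix.blockTriangular_transvection (b := id) (by simpa using hlj.le) _)
    · intro a
      by_cases ha : a = ⟨j, hjn⟩
      · subst ha
        rw [Matrix.mul_transvection_apply_same, hU1, hU (show (⟨l, hlj.trans hjn⟩ : Fin n) <
          ⟨j, hjn⟩ from hlj), mul_zero, add_zero]
      · rw [Matrix.mul_transvection_apply_of_ne _ _ _ _ ha, hU1]
    · rw [← Matrix.mul_assoc, ← hblock]
      exact block_eq_mul_transvection x hmat
    · intro i' hi'
      rw [harr, harr]
      rcases hpivot' i' hi' with h | ⟨l', h1, h2, h3, h4⟩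
      · exact Or.inl h
      · refine Or.inr ⟨l', h1, Or.inl h2, ?_, fun i'' h5 h6 => ?_⟩
        · rwa [hmat i' hi', if_neg h2.ne]
        · rw [hmat i'' h6, if_neg h2.ne, h4 i'' h5 h6]
    · intro l' hl'
      rw [harr, harr]
      rcases hdone l' hl' with ⟨h1, h2⟩ | h
      · exact Or.inl ⟨h1, fun i' hi' => by rw [hmat i' hi', if_neg hl'.ne, h2 i' hi']⟩
      · exact Or.inr h
    · rw [harr, hnz]
    · intro i' hi' hi''
      rw [hmat i' hi', if_pos rfl]
      rcases (by omega : i' = i ∨ m - t ≤ i') with rfl | h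
      · rw [hx, div_mul_cancel₀ _ hnel, sub_self]
      · rw [hcur' i' hi' h, hlow i' (by omega) hi', mul_zero, sub_zero]

/-- Correctness of the column reduction. -/
theorem exec_reduce {A : SArr} {rows cols : NReg} {piv nz : NArr} {σ : Memory k} {m n : ℕ}
    (hpz : piv ≠ nz) (hrows : rows ∉ [NReg.i, .j, .l, .s, .t])
    (hcols : cols ∉ [NReg.i, .j, .l, .s, .t]) (hm : σ.reg rows = m) (hn : σ.reg cols = n) :
    ∃ U : Matrix (Fin n) (Fin n) k, U.BlockTriangular id ∧ (∀ i, U i i = 1) ∧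
    ∃ p : Fin m → Option (Fin n), IsReduced (σ.block A m n * U) p ∧
      (∀ i : Fin m, ((reduce A rows cols piv nz).exec σ).arr piv i =
        (p i).elim 0 fun j => (j : ℕ) + 1) ∧
      ∀ j : Fin n, ((reduce A rows cols piv nz).exec σ).arr nz j = 0 ↔
        ∀ i, (σ.block A m n * U) i j = 0 := by
  simp only [List.mem_cons, List.not_mem_nil, or_false, not_or] at hrows hcols
  obtain ⟨hri, hrj, hrl, hrs, hrt⟩ := hrows
  obtain ⟨hci, hcj, hcl, hcs, hct⟩ := hcols
  let c₁ : Code := .loop .i (.reg rows) (.setArr piv (.reg .i) (.lit 0))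
  let c₂ : Code := .loop .j (.reg cols) (.seq (.setArr nz (.reg .j) (.lit 0))
    (.loop .t (.reg rows) (reduceStep A rows piv nz)))
  have hc : reduce A rows cols piv nz = .seq c₁ c₂ := rfl
  have hF := frame_exec c₁ σ
  have h1 : ∀ i < m, (c₁.exec σ).arr piv i = 0 := by
    rw [← hm]
    change ∀ i < (NExp.reg rows).eval σ, _
    refine exec_loop_forall (fun i (τ : Memory k) => τ.arr piv i = 0) ?_ ?_
    · intro i _ τ _
      simp [Code.exec, NExp.eval]
    · intro i _ l hl τ _ hQ
      simp [Code.exec, NExp.eval, hQ]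
  have hrows₁ : (c₁.exec σ).reg rows = m := by
    rw [hF.reg rows (by simp [c₁, Code.modReg, hri]), hm]
  have hcols₁ : (c₁.exec σ).reg cols = n := by
    rw [hF.reg cols (by simp [c₁, Code.modReg, hci]), hn]
  have hA₁ : (c₁.exec σ).mat A = σ.mat A := hF.mat A (by simp [c₁, Code.modMat])
  rw [hc, Code.exec]
  generalize c₁.exec σ = σ₁ at *
  clear hF hc
  -- The invariant between columns: `ReduceInv` without the clauses on the current column.
  let Outer : ℕ → Memory k → Prop := fun j τ =>
    (∃ U : Matrix (Fin n) (Fin n) k, U.BlockTriangular id ∧ (∀ i, U i i = 1) ∧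
      τ.block A m n = σ.block A m n * U) ∧
    (∀ i < m, τ.arr piv i = 0 ∨ ∃ l, τ.arr piv i = l + 1 ∧ l < j ∧ τ.mat A i l ≠ 0 ∧
      ∀ i', i < i' → i' < m → τ.mat A i' l = 0) ∧
    ∀ l < j, (τ.arr nz l = 0 ∧ ∀ i < m, τ.mat A i l = 0) ∨
      (τ.arr nz l = 1 ∧ ∃ i < m, τ.arr piv i = l + 1)
  have hout : Outer n (c₂.exec σ₁) := by
    have := exec_loop_invariant (x := .j) (e := .reg cols)
      (s := .seq (.setArr nz (.reg .j) (.lit 0))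
      (.loop .t (.reg rows) (reduceStep A rows piv nz))) (σ := σ₁) Outer ?_ ?_
    · rwa [show (NExp.reg cols).eval σ₁ = n from hcols₁] at this
    · refine ⟨⟨1, Matrix.blockTriangular_one, by simp, ?_⟩, fun i hi => Or.inl (h1 i hi), by simp⟩
      rw [Matrix.mul_one, Memory.block, Memory.block, hA₁]
    · rintro j hj τ hτ ⟨hU, hP, hd⟩
      replace hj : j < n := by rwa [show (NExp.reg cols).eval σ₁ = n from hcols₁] at hj
      have hτrows : τ.reg rows = m := by
        rw [hτ.reg rows (by
          simp [Code.modReg, reduceStep, hri, hrj, hrl, hrs, hrt]), hrows₁]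
      rw [Code.exec, Code.exec]
      simp only [NExp.eval, Memory.setReg_reg, if_true]
      set τ₁ := (τ.setReg .j j).setArr nz j 0 with hτ₁
      have hpz₁ : τ₁.arr piv = τ.arr piv := by
        funext l
        simp [hτ₁, hpz]
      have hnz₁ : ∀ l, τ₁.arr nz l = if l = j then 0 else τ.arr nz l := fun l => by simp [hτ₁]
      have hrow₁ : τ₁.reg rows = m := by simp [hτ₁, hrj, hτrows]
      have h0 : ReduceInv A piv nz (σ.block A m n) j 0 τ₁ := by
        -- For `t = 0` no row has to be clear yet: the condition `m - 0 ≤ i < m` is void.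
        refine ⟨hU, fun i hi => ?_, fun l hl => ?_, Or.inl ⟨?_, fun i hi hi' => by omega⟩⟩
        · rw [hpz₁]
          rcases hP i hi with h | ⟨l, h1, h2, h3⟩
          · exact Or.inl h
          · exact Or.inr ⟨l, h1, Or.inl h2, h3⟩
        · rw [hnz₁, if_neg hl.ne, hpz₁]
          exact hd l hl
        · rw [hnz₁, if_pos rfl]
      have hend := exec_loop_invariant (x := .t) (e := .reg rows)
        (s := reduceStep A rows piv nz) (σ := τ₁)
        (fun t υ => ReduceInv A piv nz (σ.block A m n) j t υ) h0 (by
          intro t ht υ hυ hinv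
          replace ht : t < m := by rwa [show (NExp.reg rows).eval τ₁ = m from hrow₁] at ht
          refine hinv.step hpz (by simp [hri, hrl, hrs, hrt]) ?_ ?_ hj ht
          · rw [hυ.reg rows (by simp [Code.modReg, reduceStep, hri, hrl, hrs, hrt]), hrow₁]
          · rw [hυ.reg .j (by simp [Code.modReg, reduceStep])]
            simp [hτ₁])
      rw [show (NExp.reg rows).eval τ₁ = m from hrow₁] at hend
      obtain ⟨hU', hP', hd', hc'⟩ := hend
      refine ⟨hU', fun i hi => ?_, fun l hl => ?_⟩
      · rcases hP' i hi with h | ⟨l, h1, h2, h3⟩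
        · exact Or.inl h
        · exact Or.inr ⟨l, h1, by omega, h3⟩
      · rcases Nat.lt_succ_iff_lt_or_eq.1 hl with hl | rfl
        · exact hd' l hl
        · rcases hc' with ⟨h1, h2⟩ | h
          · exact Or.inl ⟨h1, fun i hi => h2 i hi (by omega)⟩
          · exact Or.inr h
  generalize c₂.exec σ₁ = υ at *
  obtain ⟨⟨U, hU, hU1, hblock⟩, hP, hd⟩ := hout
  have hb : ∀ (i : Fin m) (j : Fin n), (σ.block A m n * U) i j = υ.mat A i j := fun i j => by
    rw [← hblock]
    rfl
  -- Decodes the array: `0` means no pivot and `l + 1` means column `l`. The test against `n` only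
  -- serves to form an element of `Fin n`.
  let p : Fin m → Option (Fin n) := fun i =>
    if h : 0 < υ.arr piv i ∧ υ.arr piv i ≤ n then some ⟨υ.arr piv i - 1, by omega⟩ else none
  have hp : ∀ i : Fin m, υ.arr piv i = (p i).elim 0 fun j => (j : ℕ) + 1 := by
    intro i
    simp only [p]
    rcases hP i i.2 with h | ⟨l, h1, h2, -⟩
    · simp [h]
    · rw [dif_pos (by omega)]
      simp only [Option.elim]
      omega
  have hsome : ∀ i j, p i = some j → υ.arr piv i = j + 1 := by
    intro i j hij
    rw [hp, hij]
    rfl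
  have hsome' : ∀ (i : Fin m) (j : Fin n), υ.arr piv i = j + 1 → p i = some j := by
    intro i j hij
    rw [hp] at hij
    cases hpi : p i with
    | none =>
      rw [hpi] at hij
      simp at hij
    | some j' =>
      rw [hpi] at hij
      simp only [Option.elim] at hij
      rw [Fin.ext (show (j' : ℕ) = j by omega)]
  refine ⟨U, hU, hU1, p, ⟨?_, ?_, ?_⟩, hp, ?_⟩
  · intro i j hij
    rw [hb]
    rcases hP i i.2 with h | ⟨l, h1, h2, h3, h4⟩
    · rw [hsome i j hij] at h
      omega
    · rw [hsome i j hij] at h1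
      rwa [show (j : ℕ) = l by omega]
  · intro i j hij i' hi'
    rw [hb]
    rcases hP i i.2 with h | ⟨l, h1, h2, h3, h4⟩
    · rw [hsome i j hij] at h
      omega
    · rw [hsome i j hij] at h1
      rw [show (j : ℕ) = l by omega]
      exact h4 i' hi' i'.2
  · rintro j ⟨i, hij⟩
    rw [hb] at hij
    rcases hd j j.2 with ⟨-, h⟩ | ⟨-, i', hi', h⟩
    · exact absurd (h i i.2) hij
    · exact ⟨⟨i', hi'⟩, hsome' ⟨i', hi'⟩ j h⟩
  · intro j
    simp only [hb]
    rcases hd j j.2 with ⟨h1, h2⟩ | ⟨h1, i, hi, h2⟩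
    · exact iff_of_true h1 fun i => h2 i i.2
    · refine iff_of_false (by omega) fun h0 => ?_
      rcases hP i hi with h | ⟨l, h3, h4, h5, h6⟩
      · omega
      · rw [h2] at h3
        exact h5 (by rw [← show (j : ℕ) = l by omega]; exact h0 ⟨i, hi⟩)

end ColumnReduction

/-! ### Deleting rows and reading off the bars -/

section Rows

variable {k : Type*} [Field k] [DecidableEq k]

/-- The rows that survive are enumerated by `Nat.nth`. -/
theorem exec_removeRows (σ : Memory k) :
    (removeRows.exec σ).reg .h = Nat.count (fun i => σ.arr .nzG i = 0) (σ.reg .m) ∧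
    ∀ a < Nat.count (fun i => σ.arr .nzG i = 0) (σ.reg .m),
      (removeRows.exec σ).arr .birth a = σ.arr .sdegG (Nat.nth (fun i => σ.arr .nzG i = 0) a) ∧
      ∀ j < σ.reg .c, (removeRows.exec σ).mat .K a j =
        σ.mat .sF (Nat.nth (fun i => σ.arr .nzG i = 0) a) j := by
  let p : ℕ → Prop := fun i => σ.arr .nzG i = 0
  have hrun := exec_loop_invariant (x := .i) (e := .reg .m)
    (s := .ifThen (.eq (.get .nzG (.reg .i)) (.lit 0))
      (.seq (.setArr .birth (.reg .h) (.get .sdegG (.reg .i)))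
        (.seq (.loop .j (.reg .c) (.setMat .K (.reg .h) (.reg .j) (.get .sF (.reg .i) (.reg .j))))
          (.setReg .h (.add (.reg .h) (.lit 1))))))
    (σ := (Code.setReg .h (.lit 0)).exec σ)
    -- The next free row of `K` is the number of rows kept so far; when row `i` is kept it gets
    -- index `Nat.count p i`, which `Nat.nth p` sends back to `i`.
    (fun i τ => τ.reg .h = Nat.count p i ∧ ∀ a < Nat.count p i,
      τ.arr .birth a = σ.arr .sdegG (Nat.nth p a) ∧
      ∀ j < σ.reg .c, τ.mat .K a j = σ.mat .sF (Nat.nth p a) j) (by simp [Code.exec, NExp.eval]) ?_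
  · have e : (NExp.reg .m).eval ((Code.setReg .h (.lit 0)).exec σ) = σ.reg .m := by
      simp [Code.exec, NExp.eval]
    rw [e] at hrun
    exact hrun
  · rintro i - τ hτ ⟨hh, hQ⟩
    have hnz : τ.arr .nzG = σ.arr .nzG := hτ.arr _ (by simp [Code.modArr])
    have hsd : τ.arr .sdegG = σ.arr .sdegG := hτ.arr _ (by simp [Code.modArr])
    have hsF : τ.mat .sF = σ.mat .sF := hτ.mat _ (by simp [Code.modMat])
    have hcr : τ.reg .c = σ.reg .c := by
      rw [hτ.reg _ (by simp [Code.modReg])]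
      simp [Code.exec]
    rw [Code.exec]
    simp only [Test.eval, NExp.eval, Memory.setReg_reg, Memory.setReg_arr, if_true, hnz,
      decide_eq_true_eq]
    split_ifs with hp
    · rw [Code.exec, Code.exec, Code.exec, Code.exec]
      simp only [NExp.eval, Memory.setReg_reg, Memory.setReg_arr, if_true, hsd, reduceCtorEq,
        if_false, hh]
      set τ₁ := (τ.setReg .i i).setArr .birth (Nat.count p i) (σ.arr .sdegG i) with hτ₁
      have hfill := exec_fill (x := .j) (e := .reg .c) (A := .K) (e₁ := .reg .h) (e₂ := .reg .j)
        (u := .get .sF (.reg .i) (.reg .j)) (σ := τ₁) (fun _ => Nat.count p i) (fun j => j)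
        (fun j => σ.mat .sF i j) (by
          intro j hj υ hυj hυ
          have h1 := hυ.reg .h (by simp [Code.modReg])
          have h2 := hυ.reg .i (by simp [Code.modReg])
          have h3 := hυ.mat .sF (by simp [Code.modMat])
          simp [NExp.eval, SExp.eval, hυj, h1, h2, h3, hτ₁, hh, hsF]) (fun _ _ _ h => h)
      have hF := frame_exec (Code.loop .j (.reg .c) (.setMat .K (.reg .h) (.reg .j)
        (.get .sF (.reg .i) (.reg .j)))) τ₁
      have hFh := hF.reg .h (by simp [Code.modReg])
      have hFb := hF.arr .birth (by simp [Code.modArr])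
      have hc₁ : (NExp.reg .c).eval τ₁ = σ.reg .c := by simp [NExp.eval, hτ₁, hcr]
      rw [hc₁] at hfill
      generalize (Code.loop .j (.reg .c) (.setMat .K (.reg .h) (.reg .j)
        (.get .sF (.reg .i) (.reg .j)))).exec τ₁ = υ at *
      have hcount : Nat.count p (i + 1) = Nat.count p i + 1 := by
        rw [Nat.count_succ, if_pos hp]
      rw [hcount, hFh]
      refine ⟨by simp [hτ₁, hh], fun a ha => ?_⟩
      simp only [Memory.setReg_mat, hFb]
      rcases Nat.lt_succ_iff_lt_or_eq.1 ha with ha | rfl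
      · refine ⟨?_, fun j hj => ?_⟩
        · rw [hτ₁]
          simp [ha.ne, (hQ a ha).1]
        · rw [hfill.2 a j (fun l _ h => absurd h ha.ne')]
          exact (hQ a ha).2 j hj
      · rw [Nat.nth_count (p := p) hp]
        exact ⟨by simp [hτ₁], fun j hj => hfill.1 j hj⟩
    · rw [Nat.count_succ, if_neg hp, add_zero]
      exact ⟨by simp [hh], hQ⟩

theorem exec_readBars (σ : Memory k) : ∀ i < σ.reg .h,
    ((readBars.exec σ).arr .finite i = if σ.arr .pivK i = 0 then 0 else 1) ∧
    (σ.arr .pivK i ≠ 0 →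
      (readBars.exec σ).arr .death i = σ.arr .sdegF (σ.arr .pivK i - 1)) := by
  unfold readBars
  change ∀ i < (NExp.reg .h).eval σ, _
  refine exec_loop_forall (fun i (τ : Memory k) =>
    (τ.arr .finite i = if σ.arr .pivK i = 0 then 0 else 1) ∧
    (σ.arr .pivK i ≠ 0 → τ.arr .death i = σ.arr .sdegF (σ.arr .pivK i - 1))) ?_ ?_
  · intro i _ τ hτ
    have h1 := hτ.arr .pivK (by simp [Code.modArr])
    have h2 := hτ.arr .sdegF (by simp [Code.modArr])
    by_cases h : σ.arr .pivK i = 0 <;>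
      simp [Code.exec, Test.eval, NExp.eval, h1, h2, h]
  · intro i _ l hl τ hτ hQ
    have h1 := hτ.arr .pivK (by simp [Code.modArr])
    by_cases h : σ.arr .pivK i = 0 <;>
      simpa [Code.exec, Test.eval, NExp.eval, h1, h, hl.ne] using hQ

end Rows

/-! ### Loops that copy matrices column by column -/

section Columns

variable {k : Type*} [Field k] [DecidableEq k]

/-- A pair of nested loops that fills columns, one block of rows at a time. -/
theorem exec_copyColumns {n n₁ : NReg} {a : NArr} {A : SArr} {e₀ ev : NExp} {u : SExp}
    {σ : Memory k} (off R : ℕ) (v : ℕ → ℕ) (w : ℕ → ℕ → k) (hn₁ : n₁ ∉ [NReg.i, .j])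
    (hR : σ.reg n₁ = R)
    (h : ∀ j < σ.reg n, ∀ τ, Frame (.loop .j (.reg n) (.seq (.setArr a e₀ ev)
      (.loop .i (.reg n₁) (.setMat A (.reg .i) e₀ u)))) σ τ → τ.reg .j = j →
        e₀.eval τ = off + j ∧ ev.eval τ = v j ∧ ∀ i < R, τ.reg .i = i → u.eval τ = w i j) :
    (∀ j < σ.reg n,
      ((Code.loop .j (.reg n) (.seq (.setArr a e₀ ev)
        (.loop .i (.reg n₁) (.setMat A (.reg .i) e₀ u)))).exec σ).arr a (off + j) = v j ∧
      ∀ i < R, ((Code.loop .j (.reg n) (.seq (.setArr a e₀ ev)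
        (.loop .i (.reg n₁) (.setMat A (.reg .i) e₀ u)))).exec σ).mat A i (off + j) = w i j) ∧
    ∀ l, (∀ j < σ.reg n, l ≠ off + j) →
      ((Code.loop .j (.reg n) (.seq (.setArr a e₀ ev)
        (.loop .i (.reg n₁) (.setMat A (.reg .i) e₀ u)))).exec σ).arr a l = σ.arr a l ∧
      ∀ i, ((Code.loop .j (.reg n) (.seq (.setArr a e₀ ev)
        (.loop .i (.reg n₁) (.setMat A (.reg .i) e₀ u)))).exec σ).mat A i l = σ.mat A i l := by
  simp only [List.mem_cons, List.not_mem_nil, or_false, not_or] at hn₁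
  refine exec_columns (e := .reg n) a A off R v w ?_
  intro j hj τ hτ
  rw [Code.exec, Code.exec]
  have hτj := hτ.trans (frame_setReg_loop .j (.reg n) _ τ j)
  obtain ⟨h1, h2, -⟩ := h j hj (τ.setReg .j j) hτj (by simp)
  rw [h1, h2]
  set τ₁ := (τ.setReg .j j).setArr a (off + j) (v j) with hτ₁
  have hτ₁f : Frame (.loop .j (.reg n) (.seq (.setArr a e₀ ev)
      (.loop .i (.reg n₁) (.setMat A (.reg .i) e₀ u)))) σ τ₁ := by
    refine hτj.trans ⟨fun _ _ => rfl, fun b hb => ?_, fun _ _ => rfl⟩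
    have : b ≠ a := by
      rintro rfl
      simp [Code.modArr] at hb
    funext l
    simp [hτ₁, this]
  have hR₁ : (NExp.reg n₁).eval τ₁ = R := by
    have := hτ₁f.reg n₁ (by simp [Code.modReg, hn₁])
    simp [NExp.eval, this, hR]
  have hfill := exec_fill (x := .i) (e := .reg n₁) (A := A) (e₁ := .reg .i) (e₂ := e₀) (u := u)
    (σ := τ₁) (fun i => i) (fun _ => off + j) (fun i => w i j) (by
      intro i hi υ hυi hυ
      rw [hR₁] at hi
      have hυf := hτ₁f.trans (hυ.mono (by simp [Code.modReg]) (by simp [Code.modArr])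
        (by simp [Code.modMat]))
      have hυj : υ.reg .j = j := by
        rw [hυ.reg .j (by simp [Code.modReg])]
        simp [hτ₁]
      obtain ⟨h3, -, h4⟩ := h j hj υ hυf hυj
      exact ⟨hυi, h3, h4 i hi hυi⟩) (fun _ _ h _ => h)
  rw [hR₁] at hfill
  have hF := frame_exec (Code.loop .i (.reg n₁) (.setMat A (.reg .i) e₀ u)) τ₁
  have harr := hF.arr a (by simp [Code.modArr])
  rw [harr]
  refine ⟨by simp [hτ₁], fun l hl => by simp [hτ₁, hl], hfill.1, fun i l hl => ?_⟩
  exact hfill.2 i l fun _ _ _ h' => hl h'.symm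

/-- Version for the columns of `F`, which consist of two stacked blocks of heights `R₁` and `R₂`. -/
theorem exec_copyColumns₂ {n n₁ n₂ : NReg} {a : NArr} {A : SArr} {e₀ ev : NExp} {u₁ u₂ : SExp}
    {σ : Memory k} (off R₁ R₂ : ℕ) (v : ℕ → ℕ) (w : ℕ → ℕ → k) (hn₁ : n₁ ∉ [NReg.i, .j])
    (hn₂ : n₂ ∉ [NReg.i, .j]) (hR₁ : σ.reg n₁ = R₁) (hR₂ : σ.reg n₂ = R₂)
    {c : Code} (hc : c = .loop .j (.reg n) (.seq (.setArr a e₀ ev)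
      (.seq (.loop .i (.reg n₁) (.setMat A (.reg .i) e₀ u₁))
        (.loop .i (.reg n₂) (.setMat A (.add (.reg n₁) (.reg .i)) e₀ u₂)))))
    (h : ∀ j < σ.reg n, ∀ τ, Frame c σ τ → τ.reg .j = j →
        e₀.eval τ = off + j ∧ ev.eval τ = v j ∧
        (∀ i < R₁, τ.reg .i = i → u₁.eval τ = w i j) ∧
        ∀ i < R₂, τ.reg .i = i → u₂.eval τ = w (R₁ + i) j) :
    (∀ j < σ.reg n, (c.exec σ).arr a (off + j) = v j ∧
      ∀ i < R₁ + R₂, (c.exec σ).mat A i (off + j) = w i j) ∧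
    ∀ l, (∀ j < σ.reg n, l ≠ off + j) → (c.exec σ).arr a l = σ.arr a l ∧
      ∀ i, (c.exec σ).mat A i l = σ.mat A i l := by
  subst hc
  simp only [List.mem_cons, List.not_mem_nil, or_false, not_or] at hn₁ hn₂
  refine exec_columns (e := .reg n) a A off (R₁ + R₂) v w ?_
  intro j hj τ hτ
  rw [Code.exec, Code.exec, Code.exec]
  have hτj := hτ.trans (frame_setReg_loop .j (.reg n) _ τ j)
  obtain ⟨h1, h2, -⟩ := h j hj (τ.setReg .j j) hτj (by simp)
  rw [h1, h2]
  set τ₁ := (τ.setReg .j j).setArr a (off + j) (v j) with hτ₁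
  have hτ₁f := hτj.trans (υ := τ₁) ⟨fun _ _ => rfl, fun b hb => by
    have : b ≠ a := by
      rintro rfl
      simp [Code.modArr] at hb
    funext l
    simp [hτ₁, this], fun _ _ => rfl⟩
  have hjτ₁ : τ₁.reg .j = j := by simp [hτ₁]
  have hτ₁R₁ : (NExp.reg n₁).eval τ₁ = R₁ := by
    have := hτ₁f.reg n₁ (by simp [Code.modReg, hn₁])
    simp [NExp.eval, this, hR₁]
  have hfill₁ := exec_fill (x := .i) (e := .reg n₁) (A := A) (e₁ := .reg .i) (e₂ := e₀) (u := u₁)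
    (σ := τ₁) (fun i => i) (fun _ => off + j) (fun i => w i j) (by
      intro i hi υ hυi hυ
      rw [hτ₁R₁] at hi
      have hυf := hτ₁f.trans (hυ.mono (by simp [Code.modReg]) (by simp [Code.modArr])
        (by simp [Code.modMat]))
      have hυj : υ.reg .j = j := by
        rw [hυ.reg .j (by simp [Code.modReg]), hjτ₁]
      obtain ⟨h3, -, h4, -⟩ := h j hj υ hυf hυj
      exact ⟨hυi, h3, h4 i hi hυi⟩) (fun _ _ h _ => h)
  rw [hτ₁R₁] at hfill₁
  have hF₁ := frame_exec (Code.loop .i (.reg n₁) (.setMat A (.reg .i) e₀ u₁)) τ₁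
  generalize (Code.loop .i (.reg n₁) (.setMat A (.reg .i) e₀ u₁)).exec τ₁ = τ₂ at *
  have hτ₂f := hτ₁f.trans (hF₁.mono (by simp [Code.modReg]) (by simp [Code.modArr])
    (by simp [Code.modMat]))
  have hjτ₂ : τ₂.reg .j = j := by rw [hF₁.reg .j (by simp [Code.modReg]), hjτ₁]
  have hτ₂R₂ : (NExp.reg n₂).eval τ₂ = R₂ := by
    have := hτ₂f.reg n₂ (by simp [Code.modReg, hn₂])
    simp [NExp.eval, this, hR₂]
  have hfill₂ := exec_fill (x := .i) (e := .reg n₂) (A := A) (e₁ := .add (.reg n₁) (.reg .i))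
    (e₂ := e₀) (u := u₂)
    (σ := τ₂) (fun i => R₁ + i) (fun _ => off + j) (fun i => w (R₁ + i) j) (by
      intro i hi υ hυi hυ
      rw [hτ₂R₂] at hi
      have hυf := hτ₂f.trans (hυ.mono (by simp [Code.modReg]) (by simp [Code.modArr])
        (by simp [Code.modMat]))
      have hυj : υ.reg .j = j := by
        rw [hυ.reg .j (by simp [Code.modReg]), hjτ₂]
      have hυR := hυf.reg n₁ (by simp [Code.modReg, hn₁])
      obtain ⟨h3, -, -, h4⟩ := h j hj υ hυf hυj
      exact ⟨by simp [NExp.eval, hυi, hυR, hR₁], h3, h4 i hi hυi⟩)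
      (fun _ _ h _ => Nat.add_left_cancel h)
  rw [hτ₂R₂] at hfill₂
  have hF₂ := frame_exec (Code.loop .i (.reg n₂)
    (.setMat A (.add (.reg n₁) (.reg .i)) e₀ u₂)) τ₂
  rw [hF₂.arr a (by simp [Code.modArr]), hF₁.arr a (by simp [Code.modArr])]
  refine ⟨by simp [hτ₁], fun l hl => by simp [hτ₁, hl], fun i hi => ?_, fun i l hl => ?_⟩
  -- The second inner loop writes only rows from `R₁` on, so it leaves the upper block intact.
  · by_cases hi₁ : i < R₁
    · rw [hfill₂.2 i _ (fun l _ hl => by omega), hfill₁.1 i hi₁]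
    · obtain ⟨l, rfl⟩ := Nat.exists_eq_add_of_le (not_lt.1 hi₁)
      exact hfill₂.1 l (by omega)
  · rw [hfill₂.2 i l fun _ _ _ h' => hl h'.symm, hfill₁.2 i l fun _ _ _ h' => hl h'.symm]
    rfl

end Columns

/-! ### Building and ordering the matrices -/

section Phases

theorem padVec_val {n : ℕ} (v : Fin n → ℕ) (i : Fin n) : padVec v i = v i := by
  simp [padVec]

theorem padMat_val {k : Type*} [Zero k] {m n : ℕ} (A : Matrix (Fin m) (Fin n) k) (i : Fin m)
    (j : Fin n) : padMat A i j = A i j := by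
  simp [padMat]

variable {k : Type*} [Field k] [DecidableEq k]

theorem exec_seq (s₁ s₂ : Code) (σ : Memory k) :
    (Code.seq s₁ s₂).exec σ = s₂.exec (s₁.exec σ) := rfl

theorem exec_build_regs (D : Input k) :
    (build.exec D.load).reg .m = D.nQ0 + D.nR1 ∧ (build.exec D.load).reg .c = D.nP0 + D.nQ1 := by
  rw [build, exec_seq, exec_seq]
  have h2 := frame_exec (Code.setReg .c (.add (.reg .nP0) (.reg .nQ1)))
    ((Code.setReg .m (.add (.reg .nQ0) (.reg .nR1))).exec D.load)
  constructor
  · rw [(frame_exec _ _).reg .m (by decide), h2.reg .m (by decide)]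
    simp [Code.exec, NExp.eval, Input.load]
  · rw [(frame_exec _ _).reg .c (by decide)]
    simp [Code.exec, NExp.eval, Input.load]

/-- `finSumFinEquiv` puts the left summand first and shifts the right one, which is exactly the
layout with offsets `nQ0` and `nP0` in memory. -/
theorem exec_build (D : Input k) :
    (∀ x, (build.exec D.load).arr .degG (finSumFinEquiv x : ℕ) = D.degQR x) ∧
    (∀ (i : Fin D.nR0) x, (build.exec D.load).mat .G i (finSumFinEquiv x : ℕ) = D.matG i x) ∧
    (∀ y, (build.exec D.load).arr .degF (finSumFinEquiv y : ℕ) = D.degPQ y) ∧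
    ∀ x y, (build.exec D.load).mat .F (finSumFinEquiv x : ℕ) (finSumFinEquiv y : ℕ) =
      D.matF x y := by
  rw [build, exec_seq, exec_seq]
  have h0 : ∀ x, x ∉ [NReg.m, .c] → ((Code.setReg .c (.add (.reg .nP0) (.reg .nQ1))).exec
      ((Code.setReg .m (.add (.reg .nQ0) (.reg .nR1))).exec D.load)).reg x = D.load.reg x := by
    intro x hx
    simp only [List.mem_cons, List.not_mem_nil, or_false, not_or] at hx
    simp [Code.exec, hx.1, hx.2]
  have h0a : ((Code.setReg .c (.add (.reg .nP0) (.reg .nQ1))).exec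
      ((Code.setReg .m (.add (.reg .nQ0) (.reg .nR1))).exec D.load)).arr = D.load.arr := rfl
  have h0m : ((Code.setReg .c (.add (.reg .nP0) (.reg .nQ1))).exec
      ((Code.setReg .m (.add (.reg .nQ0) (.reg .nR1))).exec D.load)).mat = D.load.mat := rfl
  generalize (Code.setReg .c (.add (.reg .nP0) (.reg .nQ1))).exec
    ((Code.setReg .m (.add (.reg .nQ0) (.reg .nR1))).exec D.load) = σ at *
  have hQ0 : σ.reg .nQ0 = D.nQ0 := h0 _ (by decide)
  have hR0 : σ.reg .nR0 = D.nR0 := h0 _ (by decide)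
  have hR1 : σ.reg .nR1 = D.nR1 := h0 _ (by decide)
  have hP0 : σ.reg .nP0 = D.nP0 := h0 _ (by decide)
  have hQ1 : σ.reg .nQ1 = D.nQ1 := h0 _ (by decide)
  have hdQ0 : σ.arr .degQ0 = padVec D.degQ0 := by rw [h0a]; rfl
  have hdR1 : σ.arr .degR1 = padVec D.degR1 := by rw [h0a]; rfl
  have hdP0 : σ.arr .degP0 = padVec D.degP0 := by rw [h0a]; rfl
  have hdQ1 : σ.arr .degQ1 = padVec D.degQ1 := by rw [h0a]; rfl
  have hg0 : σ.mat .g0 = padMat D.g0 := by rw [h0m]; rfl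
  have hg1 : σ.mat .g1 = padMat D.g1 := by rw [h0m]; rfl
  have hf0 : σ.mat .f0 = padMat D.f0 := by rw [h0m]; rfl
  have hq : σ.mat .q = padMat D.q := by rw [h0m]; rfl
  have hr : σ.mat .r = padMat D.r := by rw [h0m]; rfl
  clear h0 h0a h0m
  -- the columns of `G` that belong to `Q₀`
  rw [exec_seq]
  have s1 := exec_copyColumns (n := .nQ0) (n₁ := .nR0) (a := .degG) (A := .G) (e₀ := .reg .j)
    (ev := .get .degQ0 (.reg .j)) (u := .get .g0 (.reg .i) (.reg .j)) (σ := σ) 0 D.nR0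
    (padVec D.degQ0) (padMat D.g0) (by decide) hR0 (by
      intro j hj τ hτ hτj
      have h1 := hτ.arr .degQ0 (by decide)
      have h2 := hτ.mat .g0 (by decide)
      refine ⟨by simp [NExp.eval, hτj], by simp [NExp.eval, hτj, h1, hdQ0], fun i hi hτi => ?_⟩
      simp [SExp.eval, NExp.eval, hτj, hτi, h2, hg0])
  have F1 := frame_exec (.loop .j (.reg .nQ0) (.seq (.setArr .degG (.reg .j)
    (.get .degQ0 (.reg .j))) (.loop .i (.reg .nR0) (.setMat .G (.reg .i) (.reg .j)
      (.get .g0 (.reg .i) (.reg .j)))))) σ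
  generalize (Code.loop .j (.reg .nQ0) (.seq (.setArr .degG (.reg .j)
    (.get .degQ0 (.reg .j))) (.loop .i (.reg .nR0) (.setMat .G (.reg .i) (.reg .j)
      (.get .g0 (.reg .i) (.reg .j)))))).exec σ = σ₁ at *
  -- the columns of `G` that belong to `R₁`
  rw [exec_seq]
  have s2 := exec_copyColumns (n := .nR1) (n₁ := .nR0) (a := .degG) (A := .G)
    (e₀ := .add (.reg .nQ0) (.reg .j))
    (ev := .get .degR1 (.reg .j)) (u := .neg (.get .r (.reg .i) (.reg .j))) (σ := σ₁) D.nQ0 D.nR0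
    (padVec D.degR1) (fun i j => - padMat D.r i j) (by decide)
    (by rw [F1.reg _ (by decide), hR0]) (by
      intro j hj τ hτ hτj
      have h1 := (hτ.arr .degR1 (by decide)).trans (F1.arr _ (by decide))
      have h2 := (hτ.mat .r (by decide)).trans (F1.mat _ (by decide))
      have h3 := (hτ.reg .nQ0 (by decide)).trans (F1.reg _ (by decide))
      refine ⟨by simp [NExp.eval, hτj, h3, hQ0], by simp [NExp.eval, hτj, h1, hdR1],
        fun i hi hτi => ?_⟩
      simp [SExp.eval, NExp.eval, hτj, hτi, h2, hr])
  have F2 := frame_exec (.loop .j (.reg .nR1) (.seq (.setArr .degG (.add (.reg .nQ0) (.reg .j))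
    (.get .degR1 (.reg .j))) (.loop .i (.reg .nR0) (.setMat .G (.reg .i)
      (.add (.reg .nQ0) (.reg .j)) (.neg (.get .r (.reg .i) (.reg .j))))))) σ₁
  generalize (Code.loop .j (.reg .nR1) (.seq (.setArr .degG (.add (.reg .nQ0) (.reg .j))
    (.get .degR1 (.reg .j))) (.loop .i (.reg .nR0) (.setMat .G (.reg .i)
      (.add (.reg .nQ0) (.reg .j)) (.neg (.get .r (.reg .i) (.reg .j))))))).exec σ₁ = σ₂ at *
  -- the columns of `F` that belong to `P₀`
  rw [exec_seq]
  -- The padded matrix of `f₀` describes both blocks: it is zero from row `nQ0` on, as the lower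
  -- block has to be.
  have s3 := exec_copyColumns₂ (n := .nP0) (n₁ := .nQ0) (n₂ := .nR1) (a := .degF) (A := .F)
    (e₀ := .reg .j) (ev := .get .degP0 (.reg .j)) (u₁ := .get .f0 (.reg .i) (.reg .j))
    (u₂ := .zero) (σ := σ₂) 0 D.nQ0 D.nR1 (padVec D.degP0) (padMat D.f0) (by decide) (by decide)
    (by rw [F2.reg _ (by decide), F1.reg _ (by decide), hQ0])
    (by rw [F2.reg _ (by decide), F1.reg _ (by decide), hR1]) rfl (by
      intro j hj τ hτ hτj
      have h1 := ((hτ.arr .degP0 (by decide)).trans (F2.arr _ (by decide))).trans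
        (F1.arr _ (by decide))
      have h2 := ((hτ.mat .f0 (by decide)).trans (F2.mat _ (by decide))).trans
        (F1.mat _ (by decide))
      refine ⟨by simp [NExp.eval, hτj], by simp [NExp.eval, hτj, h1, hdP0],
        fun i hi hτi => ?_, fun i hi hτi => ?_⟩
      · simp [SExp.eval, NExp.eval, hτj, hτi, h2, hf0]
      · simp [SExp.eval, padMat])
  have F3 := frame_exec (.loop .j (.reg .nP0) (.seq (.setArr .degF (.reg .j)
    (.get .degP0 (.reg .j))) (.seq (.loop .i (.reg .nQ0) (.setMat .F (.reg .i) (.reg .j)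
      (.get .f0 (.reg .i) (.reg .j)))) (.loop .i (.reg .nR1)
        (.setMat .F (.add (.reg .nQ0) (.reg .i)) (.reg .j) .zero))))) σ₂
  generalize (Code.loop .j (.reg .nP0) (.seq (.setArr .degF (.reg .j)
    (.get .degP0 (.reg .j))) (.seq (.loop .i (.reg .nQ0) (.setMat .F (.reg .i) (.reg .j)
      (.get .f0 (.reg .i) (.reg .j)))) (.loop .i (.reg .nR1)
        (.setMat .F (.add (.reg .nQ0) (.reg .i)) (.reg .j) .zero))))).exec σ₂ = σ₃ at *
  -- the columns of `F` that belong to `Q₁`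
  have s4 := exec_copyColumns₂ (n := .nQ1) (n₁ := .nQ0) (n₂ := .nR1) (a := .degF) (A := .F)
    (e₀ := .add (.reg .nP0) (.reg .j)) (ev := .get .degQ1 (.reg .j))
    (u₁ := .neg (.get .q (.reg .i) (.reg .j)))
    (u₂ := .neg (.get .g1 (.reg .i) (.reg .j))) (σ := σ₃) D.nP0 D.nQ0 D.nR1 (padVec D.degQ1)
    (fun i j => if i < D.nQ0 then - padMat D.q i j else - padMat D.g1 (i - D.nQ0) j)
    (by decide) (by decide)
    (by rw [F3.reg _ (by decide), F2.reg _ (by decide), F1.reg _ (by decide), hQ0])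
    (by rw [F3.reg _ (by decide), F2.reg _ (by decide), F1.reg _ (by decide), hR1]) rfl (by
      intro j hj τ hτ hτj
      have h1 := (((hτ.arr .degQ1 (by decide)).trans (F3.arr _ (by decide))).trans
        (F2.arr _ (by decide))).trans (F1.arr _ (by decide))
      have h2 := (((hτ.mat .q (by decide)).trans (F3.mat _ (by decide))).trans
        (F2.mat _ (by decide))).trans (F1.mat _ (by decide))
      have h3 := (((hτ.mat .g1 (by decide)).trans (F3.mat _ (by decide))).trans
        (F2.mat _ (by decide))).trans (F1.mat _ (by decide))
      have h4 := (((hτ.reg .nP0 (by decide)).trans (F3.reg _ (by decide))).trans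
        (F2.reg _ (by decide))).trans (F1.reg _ (by decide))
      refine ⟨by simp [NExp.eval, hτj, h4, hP0], by simp [NExp.eval, hτj, h1, hdQ1],
        fun i hi hτi => ?_, fun i hi hτi => ?_⟩
      · simp [SExp.eval, NExp.eval, hτj, hτi, h2, hq, hi]
      · simp [SExp.eval, NExp.eval, hτj, hτi, h3, hg1])
  have F4 := frame_exec (.loop .j (.reg .nQ1) (.seq (.setArr .degF (.add (.reg .nP0) (.reg .j))
    (.get .degQ1 (.reg .j))) (.seq (.loop .i (.reg .nQ0) (.setMat .F (.reg .i)
      (.add (.reg .nP0) (.reg .j)) (.neg (.get .q (.reg .i) (.reg .j))))) (.loop .i (.reg .nR1)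
        (.setMat .F (.add (.reg .nQ0) (.reg .i)) (.add (.reg .nP0) (.reg .j))
          (.neg (.get .g1 (.reg .i) (.reg .j)))))))) σ₃
  generalize (Code.loop .j (.reg .nQ1) (.seq (.setArr .degF (.add (.reg .nP0) (.reg .j))
    (.get .degQ1 (.reg .j))) (.seq (.loop .i (.reg .nQ0) (.setMat .F (.reg .i)
      (.add (.reg .nP0) (.reg .j)) (.neg (.get .q (.reg .i) (.reg .j))))) (.loop .i (.reg .nR1)
        (.setMat .F (.add (.reg .nQ0) (.reg .i)) (.add (.reg .nP0) (.reg .j))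
          (.neg (.get .g1 (.reg .i) (.reg .j)))))))).exec σ₃ = σ₄ at *
  have r1 : σ₁.reg .nR1 = D.nR1 := by rw [F1.reg _ (by decide), hR1]
  have r2 : σ₂.reg .nP0 = D.nP0 := by rw [F2.reg _ (by decide), F1.reg _ (by decide), hP0]
  have r3 : σ₃.reg .nQ1 = D.nQ1 := by
    rw [F3.reg _ (by decide), F2.reg _ (by decide), F1.reg _ (by decide), hQ1]
  simp only [hQ0, r1, r2, r3, zero_add] at s1 s2 s3 s4
  have eG : σ₄.arr .degG = σ₂.arr .degG := by rw [F4.arr _ (by decide), F3.arr _ (by decide)]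
  have eGm : σ₄.mat .G = σ₂.mat .G := by rw [F4.mat _ (by decide), F3.mat _ (by decide)]
  refine ⟨?_, ?_, ?_, ?_⟩
  · rintro (x | x)
    · simp only [finSumFinEquiv_apply_left, Fin.val_castAdd, eG]
      rw [(s2.2 x (fun j _ => by omega)).1, (s1.1 x x.2).1, padVec_val]
      rfl
    · simp only [finSumFinEquiv_apply_right, Fin.val_natAdd, eG]
      rw [(s2.1 x x.2).1, padVec_val]
      rfl
  · rintro i (x | x)
    · simp only [finSumFinEquiv_apply_left, Fin.val_castAdd, eGm]
      rw [(s2.2 x (fun j _ => by omega)).2, (s1.1 x x.2).2 i i.2, padMat_val]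
      rfl
    · simp only [finSumFinEquiv_apply_right, Fin.val_natAdd, eGm]
      rw [(s2.1 x x.2).2 i i.2, padMat_val]
      rfl
  · rintro (y | y)
    · simp only [finSumFinEquiv_apply_left, Fin.val_castAdd]
      rw [(s4.2 y (fun j _ => by omega)).1, (s3.1 y y.2).1, padVec_val]
      rfl
    · simp only [finSumFinEquiv_apply_right, Fin.val_natAdd]
      rw [(s4.1 y y.2).1, padVec_val]
      rfl
  · rintro x (y | y)
    · simp only [finSumFinEquiv_apply_left, Fin.val_castAdd]
      rw [(s4.2 y (fun j _ => by omega)).2, (s3.1 y y.2).2 _ (finSumFinEquiv x).2]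
      rcases x with x | x
      · simp only [finSumFinEquiv_apply_left, Fin.val_castAdd, padMat_val]
        rfl
      · simp only [finSumFinEquiv_apply_right, Fin.val_natAdd]
        simp [padMat, Input.matF]
    · simp only [finSumFinEquiv_apply_right, Fin.val_natAdd]
      rw [(s4.1 y y.2).2 _ (finSumFinEquiv x).2]
      rcases x with x | x
      · simp [padMat_val, Input.matF]
      · simp [padMat_val, Input.matF]

/-- The memory after the first step of the algorithm. -/
theorem exec_order (D : Input k) :
    ∃ (e : Fin (D.nQ0 + D.nR1) ≃ Fin D.nQ0 ⊕ Fin D.nR1)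
      (e' : Fin (D.nP0 + D.nQ1) ≃ Fin D.nP0 ⊕ Fin D.nQ1),
      Monotone (D.degQR ∘ e) ∧ Monotone (D.degPQ ∘ e') ∧
      (∀ j : Fin (D.nQ0 + D.nR1), (order.exec (build.exec D.load)).arr .sdegG j = D.degQR (e j)) ∧
      (∀ j : Fin (D.nP0 + D.nQ1), (order.exec (build.exec D.load)).arr .sdegF j = D.degPQ (e' j)) ∧
      (order.exec (build.exec D.load)).block .sG _ _ = D.matG.submatrix id e ∧
      (order.exec (build.exec D.load)).block .sF _ _ = D.matF.submatrix e e' := by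
  obtain ⟨hm, hc⟩ := exec_build_regs D
  obtain ⟨hdG, hG, hdF, hF⟩ := exec_build D
  have hR0 : (build.exec D.load).reg .nR0 = D.nR0 := (frame_exec build D.load).reg .nR0 (by decide)
  generalize build.exec D.load = σ at *
  rw [order, exec_seq, exec_seq, exec_seq]
  obtain ⟨pG, hpG, hrG⟩ := exists_sorting_perm (D.nQ0 + D.nR1) (σ.arr .degG)
  obtain ⟨pF, hpF, hrF⟩ := exists_sorting_perm (D.nP0 + D.nQ1) (σ.arr .degF)
  have s1 := exec_sortBy (n := .m) (deg := .degG) (ord := .ordG) (σ := σ) (by decide) (by decide)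
  have F1 := frame_exec (sortBy .m .degG .ordG) σ
  generalize (sortBy .m .degG .ordG).exec σ = σ₁ at *
  have s2 := exec_sortBy (n := .c) (deg := .degF) (ord := .ordF) (σ := σ₁) (by decide) (by decide)
  have F2 := frame_exec (sortBy .c .degF .ordF) σ₁
  generalize (sortBy .c .degF .ordF).exec σ₁ = σ₂ at *
  rw [F1.reg _ (by decide), F1.arr .degF (by decide), hc] at s2
  rw [hm] at s1
  -- The index `pG s` has rank `s`, so `sortBy` stored it at position `s`.
  have oG : ∀ s : Fin (D.nQ0 + D.nR1), σ₂.arr .ordG s = pG s := by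
    intro s
    rw [F2.arr _ (by decide), ← hrG s, s1 _ (pG s).2]
  have oF : ∀ s : Fin (D.nP0 + D.nQ1), σ₂.arr .ordF s = pF s := by
    intro s
    rw [← hrF s, s2 _ (pF s).2]
  have hm₂ : σ₂.reg .m = D.nQ0 + D.nR1 := by rw [F2.reg _ (by decide), F1.reg _ (by decide), hm]
  have hc₂ : σ₂.reg .c = D.nP0 + D.nQ1 := by rw [F2.reg _ (by decide), F1.reg _ (by decide), hc]
  have hR₂ : σ₂.reg .nR0 = D.nR0 := by rw [F2.reg _ (by decide), F1.reg _ (by decide), hR0]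
  have edG : σ₂.arr .degG = σ.arr .degG := by rw [F2.arr _ (by decide), F1.arr _ (by decide)]
  have edF : σ₂.arr .degF = σ.arr .degF := by rw [F2.arr _ (by decide), F1.arr _ (by decide)]
  have eG : σ₂.mat .G = σ.mat .G := by rw [F2.mat _ (by decide), F1.mat _ (by decide)]
  have eF : σ₂.mat .F = σ.mat .F := by rw [F2.mat _ (by decide), F1.mat _ (by decide)]
  clear s1 s2 F1 F2 hrG hrF hm hc hR0
  have s3 := exec_copyColumns (n := .m) (n₁ := .nR0) (a := .sdegG) (A := .sG) (e₀ := .reg .j)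
    (ev := .get .degG (.get .ordG (.reg .j))) (u := .get .G (.reg .i) (.get .ordG (.reg .j)))
    (σ := σ₂) 0 D.nR0 (fun j => σ.arr .degG (σ₂.arr .ordG j))
    (fun i j => σ.mat .G i (σ₂.arr .ordG j)) (by decide) hR₂ (by
      intro j hj τ hτ hτj
      have h1 := hτ.arr .degG (by decide)
      have h2 := hτ.arr .ordG (by decide)
      have h3 := hτ.mat .G (by decide)
      refine ⟨by simp [NExp.eval, hτj], by simp [NExp.eval, hτj, h1, h2, edG],
        fun i hi hτi => ?_⟩
      simp [SExp.eval, NExp.eval, hτj, hτi, h2, h3, eG])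
  have F3 := frame_exec (.loop .j (.reg .m) (.seq (.setArr .sdegG (.reg .j)
    (.get .degG (.get .ordG (.reg .j)))) (.loop .i (.reg .nR0) (.setMat .sG (.reg .i) (.reg .j)
      (.get .G (.reg .i) (.get .ordG (.reg .j))))))) σ₂
  generalize (Code.loop .j (.reg .m) (.seq (.setArr .sdegG (.reg .j)
    (.get .degG (.get .ordG (.reg .j)))) (.loop .i (.reg .nR0) (.setMat .sG (.reg .i) (.reg .j)
      (.get .G (.reg .i) (.get .ordG (.reg .j))))))).exec σ₂ = σ₃ at *
  have s4 := exec_copyColumns (n := .c) (n₁ := .m) (a := .sdegF) (A := .sF) (e₀ := .reg .j)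
    (ev := .get .degF (.get .ordF (.reg .j)))
    (u := .get .F (.get .ordG (.reg .i)) (.get .ordF (.reg .j)))
    (σ := σ₃) 0 (D.nQ0 + D.nR1) (fun j => σ.arr .degF (σ₂.arr .ordF j))
    (fun i j => σ.mat .F (σ₂.arr .ordG i) (σ₂.arr .ordF j)) (by decide)
    (by rw [F3.reg _ (by decide), hm₂]) (by
      intro j hj τ hτ hτj
      have h1 := (hτ.arr .degF (by decide)).trans (F3.arr _ (by decide))
      have h2 := (hτ.arr .ordG (by decide)).trans (F3.arr _ (by decide))
      have h3 := (hτ.arr .ordF (by decide)).trans (F3.arr _ (by decide))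
      have h4 := (hτ.mat .F (by decide)).trans (F3.mat _ (by decide))
      refine ⟨by simp [NExp.eval, hτj], by simp [NExp.eval, hτj, h1, h3, edF],
        fun i hi hτi => ?_⟩
      simp [SExp.eval, NExp.eval, hτj, hτi, h2, h3, h4, eF])
  have F4 := frame_exec (.loop .j (.reg .c) (.seq (.setArr .sdegF (.reg .j)
    (.get .degF (.get .ordF (.reg .j)))) (.loop .i (.reg .m) (.setMat .sF (.reg .i) (.reg .j)
      (.get .F (.get .ordG (.reg .i)) (.get .ordF (.reg .j))))))) σ₃
  generalize (Code.loop .j (.reg .c) (.seq (.setArr .sdegF (.reg .j)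
    (.get .degF (.get .ordF (.reg .j)))) (.loop .i (.reg .m) (.setMat .sF (.reg .i) (.reg .j)
      (.get .F (.get .ordG (.reg .i)) (.get .ordF (.reg .j))))))).exec σ₃ = σ₄ at *
  have hc₃ : σ₃.reg .c = D.nP0 + D.nQ1 := by rw [F3.reg _ (by decide), hc₂]
  simp only [hm₂, hc₃, zero_add] at s3 s4
  have hdG' : ∀ s, σ.arr .degG (pG s) = D.degQR (finSumFinEquiv.symm (pG s)) := fun s => by
    rw [← hdG, Equiv.apply_symm_apply]
  have hdF' : ∀ s, σ.arr .degF (pF s) = D.degPQ (finSumFinEquiv.symm (pF s)) := fun s => by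
    rw [← hdF, Equiv.apply_symm_apply]
  refine ⟨pG.trans finSumFinEquiv.symm, pF.trans finSumFinEquiv.symm, ?_, ?_, ?_, ?_, ?_, ?_⟩
  · intro s t hst
    have := hpG hst
    simp only [hdG'] at this
    exact this
  · intro s t hst
    have := hpF hst
    simp only [hdF'] at this
    exact this
  · intro j
    rw [F4.arr _ (by decide), (s3.1 j j.2).1, oG, hdG']
    rfl
  · intro j
    rw [(s4.1 j j.2).1, oF, hdF']
    rfl
  · ext i j
    simp only [Memory.block, Matrix.of_apply]
    rw [F4.mat _ (by decide), (s3.1 j j.2).2 i i.2, oG]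
    simp [← hG]
  · ext i j
    simp only [Memory.block, Matrix.of_apply]
    rw [(s4.1 j j.2).2 i i.2, oG, oF]
    simp [← hF]

end Phases

/-! ### The output in terms of reduced matrices -/

section Output

variable {k : Type*} [Field k] [DecidableEq k]

/-- The output of the algorithm in terms of column reductions of the sorted matrices. -/
theorem exists_reduction_output (D : Input k) :
    ∃ (e : Fin (D.nQ0 + D.nR1) ≃ Fin D.nQ0 ⊕ Fin D.nR1)
      (e' : Fin (D.nP0 + D.nQ1) ≃ Fin D.nP0 ⊕ Fin D.nQ1),
      Monotone (D.degQR ∘ e) ∧ Monotone (D.degPQ ∘ e') ∧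
    ∃ U : Matrix (Fin (D.nQ0 + D.nR1)) (Fin (D.nQ0 + D.nR1)) k,
      U.BlockTriangular id ∧ (∀ i, U i i = 1) ∧
    ∃ pivG, IsReduced (D.matG.submatrix id e * U) pivG ∧
    ∃ (h : ℕ) (z : Fin h → Fin (D.nQ0 + D.nR1)), StrictMono z ∧
      (∀ j, (∃ a, z a = j) ↔ ∀ i, (D.matG.submatrix id e * U) i j = 0) ∧
    ∃ W : Matrix (Fin (D.nP0 + D.nQ1)) (Fin (D.nP0 + D.nQ1)) k,
      W.BlockTriangular id ∧ (∀ i, W i i = 1) ∧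
    ∃ piv, IsReduced ((D.matF.submatrix e e').submatrix z id * W) piv ∧
      D.output = Finset.univ.val.map fun a =>
        (D.degQR (e (z a)), (piv a).elim ⊤ fun g => (D.degPQ (e' g) : ℕ∞)) := by
  obtain ⟨e, e', he, he', hsG, hsF, hbG, hbF⟩ := exec_order D
  obtain ⟨hm, hc⟩ := exec_build_regs D
  have hR0 : (build.exec D.load).reg .nR0 = D.nR0 := (frame_exec build D.load).reg .nR0 (by decide)
  have hout : D.output = (readBars.exec ((reduce .K .h .c .pivK .nzK).exec (removeRows.exec
    ((reduce .sG .nR0 .m .pivG .nzG).exec (order.exec (build.exec D.load)))))).bars := rfl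
  have F1 := frame_exec order (build.exec D.load)
  replace hm := (F1.reg .m (by decide)).trans hm
  replace hc := (F1.reg .c (by decide)).trans hc
  replace hR0 := (F1.reg .nR0 (by decide)).trans hR0
  generalize order.exec (build.exec D.load) = σ at *
  clear F1
  refine ⟨e, e', he, he', ?_⟩
  obtain ⟨U, hU, hU1, pivG, hredG, -, hnz⟩ := exec_reduce (A := .sG) (piv := .pivG) (nz := .nzG)
    (by decide) (by decide) (by decide) hR0 hm
  rw [hbG] at hredG hnz
  refine ⟨U, hU, hU1, pivG, hredG, ?_⟩
  have F2 := frame_exec (reduce .sG .nR0 .m .pivG .nzG) σ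
  replace hm := (F2.reg .m (by decide)).trans hm
  replace hc := (F2.reg .c (by decide)).trans hc
  have hsG₁ := F2.arr .sdegG (by decide)
  have hsF₁ := F2.arr .sdegF (by decide)
  have hF₁ := F2.mat .sF (by decide)
  generalize (reduce .sG .nR0 .m .pivG .nzG).exec σ = σ₁ at *
  clear F2
  obtain ⟨hh, hK⟩ := exec_removeRows σ₁
  let p : ℕ → Prop := fun i => σ₁.arr .nzG i = 0
  change _ = Nat.count p _ at hh
  change ∀ a < Nat.count p _, _ at hK
  rw [hm] at hh hK
  have F3 := frame_exec removeRows σ₁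
  have hc₂ := (F3.reg .c (by decide)).trans hc
  have hsF₂ := (F3.arr .sdegF (by decide)).trans hsF₁
  generalize removeRows.exec σ₁ = σ₂ at *
  clear F3
  set h := Nat.count p (D.nQ0 + D.nR1) with hh'
  have hzlt : ∀ a : Fin h, Nat.nth p a < D.nQ0 + D.nR1 := fun a => Nat.nth_lt_of_lt_count a.2
  -- `Nat.nth` takes a default value beyond the cardinality of a finite set; indices below the count
  -- `h` never reach it.
  have hcard : ∀ a < h, ∀ hf : (Set.ofPred p).Finite, a < hf.toFinset.card := fun a ha hf =>
    ha.trans_le (Nat.count_le_card hf _)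
  let z : Fin h → Fin (D.nQ0 + D.nR1) := fun a => ⟨Nat.nth p a, hzlt a⟩
  have hz : StrictMono z := fun a b hab => Nat.nth_lt_nth' hab (hcard b b.2)
  have hz0 : ∀ j, (∃ a, z a = j) ↔ ∀ i, (D.matG.submatrix id e * U) i j = 0 := by
    intro j
    rw [← hnz j]
    constructor
    · rintro ⟨a, rfl⟩
      exact Nat.nth_mem a (hcard a a.2)
    · intro hj
      exact ⟨⟨Nat.count p j, Nat.count_strict_mono hj j.2⟩, Fin.ext (Nat.nth_count (p := p) hj)⟩
  refine ⟨h, z, hz, hz0, ?_⟩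
  obtain ⟨W, hW, hW1, piv, hred, hpiv, -⟩ := exec_reduce (A := .K) (piv := .pivK) (nz := .nzK)
    (by decide) (by decide) (by decide) hh hc₂
  have hbK : σ₂.block .K h (D.nP0 + D.nQ1) = (D.matF.submatrix e e').submatrix z id := by
    rw [← hbF]
    ext a j
    simp only [Memory.block, Matrix.of_apply, Matrix.submatrix_apply, id]
    rw [(hK a a.2).2 j (by rw [hc]; exact j.2), hF₁]
  rw [hbK] at hred
  refine ⟨W, hW, hW1, piv, hred, ?_⟩
  have F4 := frame_exec (reduce .K .h .c .pivK .nzK) σ₂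
  have hh₃ := (F4.reg .h (by decide)).trans hh
  have hsF₃ := (F4.arr .sdegF (by decide)).trans hsF₂
  have hbirth₃ := F4.arr .birth (by decide)
  generalize (reduce .K .h .c .pivK .nzK).exec σ₂ = σ₃ at *
  have hread := exec_readBars σ₃
  have F5 := frame_exec readBars σ₃
  have hh₄ := (F5.reg .h (by decide)).trans hh₃
  have hbirth₄ := (F5.arr .birth (by decide)).trans hbirth₃
  rw [hh₃] at hread
  rw [hout, Memory.bars, hh₄]
  have hrange : Multiset.range h = Finset.univ.val.map (Fin.val : Fin h → ℕ) := by
    have hmap : Finset.univ.map (Fin.valEmbedding : Fin h ↪ ℕ) = Finset.range h := by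
      ext i
      simp
    exact (congrArg Finset.val hmap).symm
  rw [hrange, Multiset.map_map]
  refine Multiset.map_congr rfl fun a _ => ?_
  obtain ⟨h1, h2⟩ := hread a a.2
  rw [hpiv a] at h1 h2
  refine Prod.ext ?_ ?_
  · change (readBars.exec σ₃).arr .birth a = _
    rw [hbirth₄, (hK a a.2).1, hsG₁, ← hsG (z a)]
  · change (if (readBars.exec σ₃).arr .finite a = 0 then (⊤ : ℕ∞) else
      ((readBars.exec σ₃).arr .death a : ℕ∞)) = _
    rw [h1]
    cases hp : piv a with
    | none => simp
    | some g =>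
      rw [hp] at h2
      simp only [Option.elim] at h2
      rw [h2 (Nat.succ_ne_zero _), Nat.add_sub_cancel, hsF₃, hsF g]
      simp

end Output

/-! ### The cubic time bound -/

section Time

variable {k : Type*} [Field k] [DecidableEq k]

/-- `m` and `c` are sums of two ranks and `h ≤ m`, whence the factor `2`. The bound is applied phase
by phase, because `m`, `c` and `h` are written in some phases but control loops only in phases that
do not write them. -/
theorem time_le_bound (D : Input k) {B : ℕ} (hB : D.SizeLE B) :
    D.time ≤ presHom.bound (2 * B) := by
  obtain ⟨hP0, hP1, hQ0, hQ1, hR0, hR1⟩ := hB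
  obtain ⟨hm, hc⟩ := exec_build_regs D
  have hR0' : (build.exec D.load).reg .nR0 = D.nR0 := (frame_exec build D.load).reg .nR0 (by decide)
  have F1 := frame_exec order (build.exec D.load)
  have hm₁ := (F1.reg .m (by decide)).trans hm
  have hc₁ := (F1.reg .c (by decide)).trans hc
  have hR0₁ := (F1.reg .nR0 (by decide)).trans hR0'
  have F2 := frame_exec (reduce .sG .nR0 .m .pivG .nzG) (order.exec (build.exec D.load))
  have hm₂ := (F2.reg .m (by decide)).trans hm₁
  have hc₂ := (F2.reg .c (by decide)).trans hc₁
  have F3 := frame_exec removeRows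
    ((reduce .sG .nR0 .m .pivG .nzG).exec (order.exec (build.exec D.load)))
  have hc₃ := (F3.reg .c (by decide)).trans hc₂
  have hh₃ := (exec_removeRows ((reduce .sG .nR0 .m .pivG .nzG).exec
    (order.exec (build.exec D.load)))).1.trans_le
      (Nat.count_le _)
  have F4 := frame_exec (reduce .K .h .c .pivK .nzK) (removeRows.exec
    ((reduce .sG .nR0 .m .pivG .nzG).exec (order.exec (build.exec D.load))))
  have hh₄ := (F4.reg .h (by decide)).trans_le hh₃
  rw [hm₂] at hh₃ hh₄
  refine Nat.add_le_add ?_ (Nat.add_le_add ?_ (Nat.add_le_add ?_ (Nat.add_le_add ?_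
    (Nat.add_le_add ?_ ?_))))
  · refine Code.steps_le_bound [.nP0, .nQ0, .nQ1, .nR0, .nR1] _ _
      (by simp [build, Code.LoopsIn]) (by decide) _ ?_
    simp only [List.mem_cons, List.not_mem_nil, or_false, forall_eq_or_imp, forall_eq]
    simp only [Input.load]
    omega
  · refine Code.steps_le_bound [.m, .c, .nR0] _ _
      (by simp [order, sortBy, Code.LoopsIn]) (by decide) _ ?_
    simp only [List.mem_cons, List.not_mem_nil, or_false, forall_eq_or_imp, forall_eq]
    omega
  · refine Code.steps_le_bound [.m, .nR0] _ _
      (by simp [reduce, Code.LoopsIn]) (by decide) _ ?_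
    simp only [List.mem_cons, List.not_mem_nil, or_false, forall_eq_or_imp, forall_eq]
    omega
  · refine Code.steps_le_bound [.m, .c] _ _
      (by simp [removeRows, Code.LoopsIn]) (by decide) _ ?_
    simp only [List.mem_cons, List.not_mem_nil, or_false, forall_eq_or_imp, forall_eq]
    omega
  · refine Code.steps_le_bound [.h, .c] _ _
      (by simp [reduce, Code.LoopsIn]) (by decide) _ ?_
    simp only [List.mem_cons, List.not_mem_nil, or_false, forall_eq_or_imp, forall_eq]
    omega
  · refine Code.steps_le_bound [.h] _ _
      (by simp [readBars, Code.LoopsIn]) (by decide) _ ?_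
    simp only [List.mem_cons, List.not_mem_nil, or_false, forall_eq]
    omega

/-- No more than three loops are nested, so the bound is a cubic polynomial in `B` with fixed
coefficients; `1000` is a generous constant. -/
theorem bound_presHom_le (B : ℕ) : presHom.bound B ≤ 1000 * (B + 1) ^ 3 := by
  simp only [presHom, build, order, sortBy, reduce, removeRows, readBars, Code.bound, NExp.cost,
    SExp.cost, Test.cost]
  ring_nf
  nlinarith [Nat.zero_le B, Nat.zero_le (B ^ 2), Nat.zero_le (B ^ 3)]

end Time

end GradedPres

/-! ### The main theorem -/

theorem theorem3p4 :
    (∀ (k : Type*) [Field k] [DecidableEq k]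
      (L : Type*) [AddCommGroup L] [Module k L] [Module k[X] L] [IsScalarTower k k[X] L]
      (M : Type*) [AddCommGroup M] [Module k M] [Module k[X] M] [IsScalarTower k k[X] M]
      (N : Type*) [AddCommGroup N] [Module k N] [Module k[X] N] [IsScalarTower k k[X] N]
      (degL : ℕ → Submodule k L) (degM : ℕ → Submodule k M) (degN : ℕ → Submodule k N)
      (_ : GradedPres.IsGrading degL) (_ : GradedPres.IsGrading degM)
      (_ : GradedPres.IsGrading degN)
      (φ : L →ₗ[k[X]] M) (ψ : M →ₗ[k[X]] N)
      (_ : GradedPres.IsHomogeneousMap degL degM φ) (_ : GradedPres.IsHomogeneousMap degM degN ψ)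
      (_ : ψ ∘ₗ φ = 0)
      (D : GradedPres.Input k)
      (lam : (Fin D.nP0 → k[X]) →ₗ[k[X]] L) (mu : (Fin D.nQ0 → k[X]) →ₗ[k[X]] M)
      (nu : (Fin D.nR0 → k[X]) →ₗ[k[X]] N)
      (_ : D.Presents degL degM degN φ ψ lam mu nu),
      (∀ b ∈ D.output, (b.1 : ℕ∞) ≤ b.2) ∧
      GradedPres.IsBarcode (GradedPres.homologyDeg degM φ ψ)
        (D.output.filter fun b => (b.1 : ℕ∞) < b.2)) ∧
    (∀ c : ℕ, ∃ C : ℕ, ∀ (k : Type*) [Field k] [DecidableEq k] (D : GradedPres.Input k) (n : ℕ),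
      1 ≤ n → D.SizeLE (c * n) → D.time ≤ C * n ^ 3) := by
  refine ⟨?_, ?_⟩
  · intro k _ _ L _ _ _ _ M _ _ _ _ N _ _ _ _ degL degM degN _ hM _ φ ψ _ _ _ D lam mu nu hD
    obtain ⟨e, e', he, he', U, hU, hU1, pivG, hredG, h, z, hz, hz0, W, hW, hW1, piv, hred, hout⟩ :=
      GradedPres.exists_reduction_output D
    rw [hout]
    refine ⟨?_, hD.isBarcode_homology hM e he e' he' hU hU1 hredG hz hz0 hW hW1 hred⟩
    intro b hb
    obtain ⟨a, -, rfl⟩ := Multiset.mem_map.1 hb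
    cases hp : piv a with
    | none => exact le_top
    | some g =>
      -- The reduced matrix `K W` is again compatible with the labels, and its pivot entry is
      -- nonzero; this is the inequality of birth and death.
      have hK : GradedPres.LabelCompatible (D.degQR ∘ e ∘ z) (D.degPQ ∘ e')
          ((D.matF.submatrix e e').submatrix z id) := fun i j hij => hD.matF_compatible _ _ hij
      have := hK.mul (GradedPres.labelCompatible_of_blockTriangular he' hW) a g
        (hred.ne_zero a g hp)
      exact Nat.cast_le.2 this
  · intro c
    -- Loop counts are at most `2 * (c * n)`, and `2 * (c * n) + 1 ≤ (2 * c + 1) * n` because `1 ≤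
    -- n`.
    refine ⟨1000 * (2 * c + 1) ^ 3, fun k _ _ D n hn hD => ?_⟩
    calc D.time ≤ GradedPres.presHom.bound (2 * (c * n)) := GradedPres.time_le_bound D hD
      _ ≤ 1000 * (2 * (c * n) + 1) ^ 3 := GradedPres.bound_presHom_le _
      _ ≤ 1000 * ((2 * c + 1) * n) ^ 3 := by
        gcongr
        nlinarith
      _ = 1000 * (2 * c + 1) ^ 3 * n ^ 3 := by ring
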